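/- Let $n\ge 2$, let $M$ be an $n$-dimensional smooth manifold, $h$ a smooth Riemannian metric on $M$, $W$ a smooth vector field on $M$, and $k$ a smooth function on $M$. If $h(W,W)=1$, put $a_{ij}=e^{-k}h_{ij}$, $b_i=2e^{-k}W_i$ (with $W_i=h_{ij}W^j$), $\alpha^2=a_{ij}(x)y^iy^j$ and $\beta=b_i(x)y^i$; the Kropina metric induced by the navigation data $(h,W)$ is the conic Finsler metric $$F=\frac{\alpha^2}{\beta}=\frac{h(y,y)}{2h(W,y)}\qquad\text{on the conic domain } A=\{(x,y)\in TM:\ \beta(x,y)>0\}.$$ Write $_{\|}$ for the Levi-Civita covariant derivative of $h$. The space $(M,F)$ is a (globally defined) *UK-Kropina space* if $h(W,W)=1$ and $W$ is a Killing field, $W_{i\|j}+W_{j\|i}=0$; it is a *CC-Kropina space* of constant curvature $K$ if moreover $(M,h)$ has constant sectional curvature $K$. The field $W$ is *parallel* if $W_{i\|j}=0$, and $(M,h)$ is *flat* if its Riemann curvature tensor vanishes. A geodesic of $(M,F)$ is a smooth curve $c:[a,b]\to M$ with all its velocity vectors in $A$, of constant speed $F(\dot c)$, which is a critical point of the length functional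 $\int_a^b F(\dot c)\,dt$ under variations with fixed end points. The space $(M,F)$ is *projectively flat* (a space with rectilinear extremals) if $M$ is covered by coordinate neighbourhoods in which the geodesics are the straight lines: every geodesic inside the neighbourhood lies on a straight line in the coordinates, and every straight segment in the coordinates from $p$ to $q$ whose direction $q-p$ belongs to $A$ at each of its points is, as a set of points, a geodesic from $p$ to $q$. Then: 1. A globally defined UK-Kropina space $(M,F)$ induced by $(h,W)$ is projectively flat if and only if $(M,h)$ is flat and $W$ is parallel with respect to $h$. 2. A CC-Kropina space $(M,F)$ of constant curvature $K\ge 0$ induced by $(h,W)$ is projectively flat if and only if $W$ is parallel with respect to $h$. 3. Every CC-Kropina space $(\mathbb{E}^n,F)$ of constant curvature $K=0$ on Euclidean space, i.e. with $M=\mathbb{R}^n$ and $h_{ij}=\delta_{ij}$, is projectively flat. -/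

import Mathlib

open scoped Manifold ContDiff Bundle

noncomputable section

namespace Kropina

/-- The coordinate space `ℝⁿ`. -/
abbrev Coord (n : ℕ) : Type := EuclideanSpace ℝ (Fin n)

/-- The `i`-th coordinate vector of `ℝⁿ`. -/
def basisVec {n : ℕ} (i : Fin n) : Coord n := EuclideanSpace.single i 1

/-- The partial derivative `∂f/∂xⁱ` of a function on `ℝⁿ`. -/
def pd {n : ℕ} (i : Fin n) (f : Coord n → ℝ) (x : Coord n) : ℝ :=
  fderiv ℝ f x (basisVec i)

/-- Smooth Riemannian metrics on the smooth `n`-manifold `M`. -/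
abbrev Metric (n : ℕ) (M : Type*) [TopologicalSpace M] [ChartedSpace (Coord n) M]
    [IsManifold (𝓡 n) ∞ M] : Type _ :=
  Bundle.ContMDiffRiemannianMetric (𝓡 n) ∞ (Coord n) (fun x : M => TangentSpace (𝓡 n) x)

/-- The Euclidean metric `h_{ij} = δ_{ij}` on `ℝⁿ`. -/
def euclideanMetric (n : ℕ) : Metric n (Coord n) where
  inner := (riemannianMetricVectorSpace (Coord n)).inner
  symm := (riemannianMetricVectorSpace (Coord n)).symm
  pos := (riemannianMetricVectorSpace (Coord n)).pos
  isVonNBounded := (riemannianMetricVectorSpace (Coord n)).isVonNBounded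
  contMDiff := (riemannianMetricVectorSpace (Coord n)).contMDiff.of_le le_top

section Manifold

variable {n : ℕ} {M : Type*} [TopologicalSpace M] [ChartedSpace (Coord n) M]
  [IsManifold (𝓡 n) ∞ M]

/-- The smooth charts of `M`. -/
def IsChart (e : OpenPartialHomeomorph M (Coord n)) : Prop :=
  e ∈ IsManifold.maximalAtlas (𝓡 n) ∞ M

/-- The tangent vector `yⁱ ∂/∂xⁱ` of `M` at the point with coordinates `x` in the chart `e`. -/
def vec (e : OpenPartialHomeomorph M (Coord n)) (x y : Coord n) :
    TangentSpace (𝓡 n) (e.symm x) :=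
  mfderiv (𝓡 n) (𝓡 n) e.symm x y

/-! ### Riemannian geometry in coordinates -/

/-- The components `h_{ij}` of the metric in the chart `e`. -/
def metricCoeff (h : Metric n M) (e : OpenPartialHomeomorph M (Coord n)) (i j : Fin n)
    (x : Coord n) : ℝ :=
  h.inner (e.symm x) (vec e x (basisVec i)) (vec e x (basisVec j))

/-- The components `h^{ij}` of the inverse of the matrix `(h_{ij})`. -/
def invMetricCoeff (h : Metric n M) (e : OpenPartialHomeomorph M (Coord n)) (i j : Fin n)
    (x : Coord n) : ℝ :=
  (Matrix.of fun p q : Fin n => metricCoeff h e p q x)⁻¹ i j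

/-- The Christoffel symbols of the Levi-Civita connection,
`γⁱ_{jk} = ½ h^{is} (∂_k h_{sj} - ∂_s h_{jk} + ∂_j h_{ks})`. -/
def christoffel (h : Metric n M) (e : OpenPartialHomeomorph M (Coord n)) (i j k : Fin n)
    (x : Coord n) : ℝ :=
  (1 / 2) * ∑ s, invMetricCoeff h e i s x *
    (pd k (metricCoeff h e s j) x - pd s (metricCoeff h e j k) x + pd j (metricCoeff h e k s) x)

/-- The components `Rⁱ_{jkl}` of the Riemann curvature tensor,
`R(∂_k, ∂_l) ∂_j = Rⁱ_{jkl} ∂_i`, where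
`R(X, Y) Z = ∇_X ∇_Y Z - ∇_Y ∇_X Z - ∇_{[X, Y]} Z`. -/
def riemann (h : Metric n M) (e : OpenPartialHomeomorph M (Coord n)) (i j k l : Fin n)
    (x : Coord n) : ℝ :=
  pd k (christoffel h e i l j) x - pd l (christoffel h e i k j) x +
    ∑ r, (christoffel h e i k r x * christoffel h e r l j x -
      christoffel h e i l r x * christoffel h e r k j x)

/-- `(M, h)` is flat: its curvature tensor vanishes. -/
def IsFlat (h : Metric n M) : Prop :=
  ∀ e : OpenPartialHomeomorph M (Coord n), IsChart e → ∀ x ∈ e.target,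
    ∀ i j k l : Fin n, riemann h e i j k l x = 0

/-- The sectional curvature `h(R(X, Y) Y, X) / (h(X, X) h(Y, Y) - h(X, Y)²)` of the plane spanned
by the tangent vectors with components `X` and `Y`. -/
def sectionalCurvature (h : Metric n M) (e : OpenPartialHomeomorph M (Coord n))
    (x X Y : Coord n) : ℝ :=
  (∑ i, ∑ j, ∑ k, ∑ l, ∑ m,
      metricCoeff h e i m x * riemann h e i j k l x * X k * Y l * Y j * X m) /
    (h.inner (e.symm x) (vec e x X) (vec e x X) * h.inner (e.symm x) (vec e x Y) (vec e x Y) -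
      h.inner (e.symm x) (vec e x X) (vec e x Y) ^ 2)

/-- `(M, h)` is of constant sectional curvature `K`. -/
def HasConstantSectionalCurvature (h : Metric n M) (K : ℝ) : Prop :=
  ∀ e : OpenPartialHomeomorph M (Coord n), IsChart e → ∀ x ∈ e.target, ∀ X Y : Coord n,
    LinearIndependent ℝ ![X, Y] → sectionalCurvature h e x X Y = K

/-- The covariant components `W_i = h_{ij} W^j` of the vector field `W`. -/
def covComp (h : Metric n M) (W : (p : M) → TangentSpace (𝓡 n) p)
    (e : OpenPartialHomeomorph M (Coord n)) (i : Fin n) (x : Coord n) : ℝ :=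
  h.inner (e.symm x) (W (e.symm x)) (vec e x (basisVec i))

/-- The components `W_{i‖j} = ∂_j W_i - γ^r_{ij} W_r` of the covariant derivative of `W` with
respect to the Levi-Civita connection of `h`. -/
def covDeriv (h : Metric n M) (W : (p : M) → TangentSpace (𝓡 n) p)
    (e : OpenPartialHomeomorph M (Coord n)) (i j : Fin n) (x : Coord n) : ℝ :=
  pd j (covComp h W e i) x - ∑ r, christoffel h e r i j x * covComp h W e r x

/-- `W` is parallel with respect to `h`: `W_{i‖j} = 0`. -/
def IsParallel (h : Metric n M) (W : (p : M) → TangentSpace (𝓡 n) p) : Prop :=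
  ∀ e : OpenPartialHomeomorph M (Coord n), IsChart e → ∀ x ∈ e.target,
    ∀ i j : Fin n, covDeriv h W e i j x = 0

/-- `W` is a Killing field of `h`: `W_{i‖j} + W_{j‖i} = 0`. -/
def IsKilling (h : Metric n M) (W : (p : M) → TangentSpace (𝓡 n) p) : Prop :=
  ∀ e : OpenPartialHomeomorph M (Coord n), IsChart e → ∀ x ∈ e.target,
    ∀ i j : Fin n, covDeriv h W e i j x + covDeriv h W e j i x = 0

/-! ### Kropina metrics -/

/-- The square `α² = a_{ij} yⁱ yʲ` of the norm of the Riemannian metric `a_{ij} = e^{-k} h_{ij}`. -/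
def alphaSq (h : Metric n M) (k : M → ℝ) (v : TangentBundle (𝓡 n) M) : ℝ :=
  Real.exp (-k v.proj) * h.inner v.proj v.snd v.snd

/-- The one-form `β = b_i yⁱ`, where `b_i = 2 e^{-k} W_i`. -/
def beta (h : Metric n M) (W : (p : M) → TangentSpace (𝓡 n) p) (k : M → ℝ)
    (v : TangentBundle (𝓡 n) M) : ℝ :=
  2 * Real.exp (-k v.proj) * h.inner v.proj (W v.proj) v.snd

/-- The conic domain `A = {β > 0}` of the Kropina metric. -/
def kropinaDomain (h : Metric n M) (W : (p : M) → TangentSpace (𝓡 n) p) (k : M → ℝ) :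
    Set (TangentBundle (𝓡 n) M) :=
  {v | 0 < beta h W k v}

/-- The Kropina metric `F = α²/β` (meaningful on its conic domain). -/
def kropinaMetric (h : Metric n M) (W : (p : M) → TangentSpace (𝓡 n) p) (k : M → ℝ)
    (v : TangentBundle (𝓡 n) M) : ℝ :=
  alphaSq h k v / beta h W k v

/-- The navigation data `(h, W)` and the smooth function `k` define a UK-Kropina space on `M`:
`W` is a globally defined smooth Killing field of unit length. -/
structure IsUKKropina (h : Metric n M) (W : (p : M) → TangentSpace (𝓡 n) p) (k : M → ℝ) :
    Prop where
  smooth_field : ContMDiff (𝓡 n) ((𝓡 n).prod 𝓘(ℝ, Coord n)) ∞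
    (fun p : M => (⟨p, W p⟩ : TangentBundle (𝓡 n) M))
  smooth_factor : ContMDiff (𝓡 n) 𝓘(ℝ, ℝ) ∞ k
  unit : ∀ p : M, h.inner p (W p) (W p) = 1
  killing : IsKilling h W

/-- The data define a CC-Kropina space of constant curvature `K`: moreover, `h` has constant
sectional curvature `K`. -/
structure IsCCKropina (h : Metric n M) (W : (p : M) → TangentSpace (𝓡 n) p) (k : M → ℝ)
    (K : ℝ) : Prop extends IsUKKropina h W k where
  constant_curvature : HasConstantSectionalCurvature h K

/-! ### Geodesics and projective flatness of conic Finsler metrics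

A conic Finsler metric is given by its domain `A` and the function `F` on `A`. Curves that stay in
the domain of a chart `e` are written in the coordinates of `e`, as smooth maps into `ℝⁿ`; only
their restriction to an interval `[a, b]` matters. -/

/-- The velocity vector at time `t` of the curve with coordinate expression `c`. -/
def velocity (e : OpenPartialHomeomorph M (Coord n)) (c : ℝ → Coord n) (t : ℝ) :
    TangentBundle (𝓡 n) M :=
  ⟨e.symm (c t), vec e (c t) (deriv c t)⟩

/-- The `F`-length of the curve `c` on `[a, b]`. -/
def curveLength (F : TangentBundle (𝓡 n) M → ℝ) (e : OpenPartialHomeomorph M (Coord n))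
    (c : ℝ → Coord n) (a b : ℝ) : ℝ :=
  ∫ t in a..b, F (velocity e c t)

/-- `c` is a smooth `F`-admissible curve on `[a, b]` in the domain of the chart `e`. -/
structure IsAdmissible (A : Set (TangentBundle (𝓡 n) M))
    (e : OpenPartialHomeomorph M (Coord n)) (c : ℝ → Coord n) (a b : ℝ) : Prop where
  smooth : ContDiff ℝ ∞ c
  mem_target : ∀ t ∈ Set.Icc a b, c t ∈ e.target
  velocity_mem : ∀ t ∈ Set.Icc a b, velocity e c t ∈ A

/-- `c` is a geodesic of `(A, F)` on `[a, b]`: an admissible curve of constant speed that is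
critical for the length functional under variations with fixed end points. -/
structure IsGeodesic (A : Set (TangentBundle (𝓡 n) M)) (F : TangentBundle (𝓡 n) M → ℝ)
    (e : OpenPartialHomeomorph M (Coord n)) (c : ℝ → Coord n) (a b : ℝ) : Prop where
  admissible : IsAdmissible A e c a b
  constant_speed : ∃ C : ℝ, ∀ t ∈ Set.Icc a b, F (velocity e c t) = C
  critical : ∀ η : ℝ → Coord n, ContDiff ℝ ∞ η → η a = 0 → η b = 0 →
    HasDerivAt (fun s : ℝ => curveLength F e (fun t => c t + s • η t) a b) 0 0

/-- In the chart `e` the extremals are the straight lines: every geodesic in the domain of `e` lies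
on a straight line and, conversely, every admissible straight segment is, as a set of points, a
geodesic. -/
structure IsRectilinearChart (A : Set (TangentBundle (𝓡 n) M)) (F : TangentBundle (𝓡 n) M → ℝ)
    (e : OpenPartialHomeomorph M (Coord n)) : Prop where
  isChart : IsChart e
  geodesic_straight : ∀ (c : ℝ → Coord n) (a b : ℝ), a < b → IsGeodesic A F e c a b →
    ∃ p v : Coord n, ∀ t ∈ Set.Icc a b, ∃ τ : ℝ, c t = p + τ • v
  straight_geodesic : ∀ p q : Coord n, segment ℝ p q ⊆ e.target →
    (∀ x ∈ segment ℝ p q, (⟨e.symm x, vec e x (q - p)⟩ : TangentBundle (𝓡 n) M) ∈ A) →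
    ∃ (c : ℝ → Coord n) (a b : ℝ), a < b ∧ IsGeodesic A F e c a b ∧ c a = p ∧ c b = q ∧
      c '' Set.Icc a b = segment ℝ p q

/-- `(M, F)` is projectively flat: it is a space with rectilinear extremals, that is, `M` is covered
by coordinate neighbourhoods in which the extremals are the straight lines. -/
def IsProjectivelyFlat (A : Set (TangentBundle (𝓡 n) M)) (F : TangentBundle (𝓡 n) M → ℝ) : Prop :=
  ∀ p : M, ∃ e : OpenPartialHomeomorph M (Coord n), p ∈ e.source ∧ IsRectilinearChart A F e

end Manifold

end Kropina

end

/-!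
Write `σ = h(W, ·)`. In a chart the Kropina metric is `F = h(y, y) / (2 σ(y))`: the factor `e^{-k}`
cancels. Everything rests on the notion of a *flat chart* (`IsFlatChart`), in which `h` is the
Euclidean metric and `σ` has constant coefficients; the three assertions follow once projective
flatness of a Kropina space with unit Killing field is identified with the existence of flat charts
around every point (`isProjectivelyFlat_iff`).

In a flat chart the Lagrangian `F` does not depend on the position, so that its fibre derivative,
the momentum, is constant along an extremal. For a unit form `σ` the momentum determines the
direction of the velocity, and the extremals are the straight lines
(`IsFlatChart.isRectilinearChart`).

Conversely, suppose that the straight segments are extremals in a chart. The Euler-Lagrange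
equation, read along a segment, is an identity in the position `x` and the direction `y` with
`σ(y) > 0` (`hasDerivAt_momentum_of_isRectilinearChart`). Expressed by the Levi-Civita connection
`Γ` and cleared of denominators, it is polynomial in `y`, and its behaviour as `σ(y) → 0` gives two
conclusions (`algebra_of_projectively_flat`): the covariant derivative of `σ` vanishes, and
`Γ(u, v) = P(u) v + P(v) u` for a one-form `P`. The curvature of such a connection is determined by
a bilinear form `Q`. It annihilates `W`, as `W` is parallel, and it is skew-symmetric with respect
to `h`; in dimension at least two this forces `Q = 0` (`eq_zero_of_skew_of_annihilates`). So `h` is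
flat and `W` is parallel in the chart. Flat coordinates are then constructed as primitives of a
parallel coframe, which exists by the Frobenius theorem (`exists_frobenius_solution`,
`exists_flat_coordinates`), and in them the parallel form `σ` has constant coefficients
(`exists_isFlatChart`).

If `h` has constant sectional curvature `K` and `W` is parallel, a plane containing `W` has
sectional curvature zero, so `K = 0` and `h` is flat (`isFlat_of_isParallel`). On Euclidean space,
a Killing field of unit length is bounded, hence constant (`eq_of_killing_of_bounded`), and the
identity is a flat chart.
-/

noncomputable section

namespace Kropina

set_option linter.unusedSectionVars false
set_option synthInstance.maxHeartbeats 200000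
set_option maxSynthPendingDepth 3

/-! ### The metric and the one-form in a chart -/

section Charts

variable {n : ℕ} {M : Type*} [TopologicalSpace M] [ChartedSpace (Coord n) M]
  [IsManifold (𝓡 n) ∞ M]

/-- The metric `h` in the chart `e`, as a field of bilinear forms on `ℝⁿ`. -/
def chartMetric (h : Metric n M) (e : OpenPartialHomeomorph M (Coord n)) (x : Coord n) :
    Coord n →L[ℝ] Coord n →L[ℝ] ℝ :=
  ContinuousLinearMap.bilinearComp (E := Coord n) (F := Coord n) (G := ℝ) (E' := Coord n)
    (F' := Coord n) (h.inner (e.symm x)) (mfderiv (𝓡 n) (𝓡 n) e.symm x)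
    (mfderiv (𝓡 n) (𝓡 n) e.symm x)

/-- The one-form `h(W, ·)` in the chart `e`. -/
def chartForm (h : Metric n M) (W : (p : M) → TangentSpace (𝓡 n) p)
    (e : OpenPartialHomeomorph M (Coord n)) (x : Coord n) : Coord n →L[ℝ] ℝ :=
  ContinuousLinearMap.comp (M₁ := Coord n) (M₂ := Coord n) (M₃ := ℝ)
    (h.inner (e.symm x) (W (e.symm x))) (mfderiv (𝓡 n) (𝓡 n) e.symm x)

variable (h : Metric n M) (W : (p : M) → TangentSpace (𝓡 n) p) (k : M → ℝ)
  {e e' : OpenPartialHomeomorph M (Coord n)}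

lemma chartMetric_apply (x u v : Coord n) :
    chartMetric h e x u v = h.inner (e.symm x) (vec e x u) (vec e x v) := rfl

lemma chartForm_apply (x u : Coord n) :
    chartForm h W e x u = h.inner (e.symm x) (W (e.symm x)) (vec e x u) := rfl

lemma metricCoeff_eq (i j : Fin n) (x : Coord n) :
    metricCoeff h e i j x = chartMetric h e x (basisVec i) (basisVec j) := rfl

lemma covComp_eq (i : Fin n) (x : Coord n) :
    covComp h W e i x = chartForm h W e x (basisVec i) := rfl

lemma chartMetric_symm (x u v : Coord n) : chartMetric h e x u v = chartMetric h e x v u :=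
  h.symm _ _ _

lemma isChart_mdifferentiable (he : IsChart e) : e.MDifferentiable (𝓡 n) (𝓡 n) :=
  ⟨(contMDiffOn_of_mem_maximalAtlas he).mdifferentiableOn (by simp),
    (contMDiffOn_symm_of_mem_maximalAtlas he).mdifferentiableOn (by simp)⟩

lemma vec_bijective (he : IsChart e) {x : Coord n} (hx : x ∈ e.target) :
    Function.Bijective (mfderiv (𝓡 n) (𝓡 n) e.symm x) := by
  have hd : e.MDifferentiable (𝓡 n) (𝓡 n) := isChart_mdifferentiable he
  exact hd.symm.mfderiv_bijective hx

lemma chartMetric_pos (he : IsChart e) {x : Coord n} (hx : x ∈ e.target) {u : Coord n}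
    (hu : u ≠ 0) : 0 < chartMetric h e x u u := by
  refine h.pos _ _ fun h0 => hu ?_
  apply (vec_bijective he hx).1
  exact h0.trans (map_zero _).symm

lemma contMDiffOn_vec (he : IsChart e) (u : Coord n) :
    ContMDiffOn (𝓡 n) ((𝓡 n).prod 𝓘(ℝ, Coord n)) ∞
      (fun x => (⟨e.symm x, vec e x u⟩ : TangentBundle (𝓡 n) M)) e.target := by
  have h1 : ContMDiffOn (𝓡 n) (𝓡 n) ∞ e.symm e.target := contMDiffOn_symm_of_mem_maximalAtlas he
  have h2 := h1.contMDiffOn_tangentMapWithin (m := ∞) (by simp) e.open_target.uniqueMDiffOn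
  have h3 : ContMDiffOn (𝓡 n) ((𝓡 n).prod 𝓘(ℝ, Coord n)) ∞
      (fun x : Coord n => (⟨x, u⟩ : TangentBundle (𝓡 n) (Coord n))) e.target := by
    exact contMDiffOn_vectorSpace_iff_contDiffOn
      (V := fun x : Coord n => (u : TangentSpace (𝓡 n) x)).2 contDiffOn_const
  refine (h2.comp h3 (fun x hx => hx)).congr fun x hx => ?_
  simp only [Function.comp, tangentMapWithin]
  rw [mfderivWithin_of_isOpen e.open_target hx]
  rfl

lemma contDiffOn_chartMetric (he : IsChart e) : ContDiffOn ℝ ∞ (chartMetric h e) e.target := by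
  rw [contDiffOn_clm_apply]
  intro u
  rw [contDiffOn_clm_apply]
  intro v
  have h1 : ContMDiffOn (𝓡 n) (𝓡 n) ∞ e.symm e.target := contMDiffOn_symm_of_mem_maximalAtlas he
  have h2 := h.contMDiff.comp_contMDiffOn h1
  have h3 := ContMDiffOn.clm_bundle_apply₂ (F₁ := Coord n) (F₂ := Coord n) (F₃ := ℝ)
    (E₃ := Bundle.Trivial M ℝ) h2 (contMDiffOn_vec he u) (contMDiffOn_vec he v)
  intro x hx
  have h4 := h3 x hx
  rw [Bundle.contMDiffWithinAt_totalSpace] at h4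
  exact h4.2.contDiffWithinAt

lemma contDiffOn_chartForm (hW : ContMDiff (𝓡 n) ((𝓡 n).prod 𝓘(ℝ, Coord n)) ∞
    (fun p : M => (⟨p, W p⟩ : TangentBundle (𝓡 n) M))) (he : IsChart e) :
    ContDiffOn ℝ ∞ (chartForm h W e) e.target := by
  rw [contDiffOn_clm_apply]
  intro u
  have h1 : ContMDiffOn (𝓡 n) (𝓡 n) ∞ e.symm e.target := contMDiffOn_symm_of_mem_maximalAtlas he
  have h2 := h.contMDiff.comp_contMDiffOn h1
  have h3 := ContMDiffOn.clm_bundle_apply₂ (F₁ := Coord n) (F₂ := Coord n) (F₃ := ℝ)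
    (E₃ := Bundle.Trivial M ℝ) h2 (hW.comp_contMDiffOn h1) (contMDiffOn_vec he u)
  intro x hx
  have h4 := h3 x hx
  rw [Bundle.contMDiffWithinAt_totalSpace] at h4
  exact h4.2.contDiffWithinAt

/-- The one-form `h(W, ·)` is dual to a vector in every chart. -/
lemma exists_dual_chartForm (he : IsChart e) {x : Coord n} (hx : x ∈ e.target) :
    ∃ w : Coord n, (∀ u, chartForm h W e x u = chartMetric h e x w u) ∧
      chartForm h W e x w = h.inner (e.symm x) (W (e.symm x)) (W (e.symm x)) := by
  obtain ⟨w, hw⟩ : ∃ w : Coord n, vec e x w = W (e.symm x) :=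
    (vec_bijective he hx).2 (W (e.symm x))
  refine ⟨w, fun u => ?_, ?_⟩
  · rw [chartForm_apply, chartMetric_apply, hw]
  · rw [chartForm_apply, hw]

lemma mem_kropinaDomain_iff (x y : Coord n) :
    (⟨e.symm x, vec e x y⟩ : TangentBundle (𝓡 n) M) ∈ kropinaDomain h W k ↔
      0 < chartForm h W e x y := by
  simp only [kropinaDomain, beta, Set.mem_ofPred_eq, chartForm_apply]
  rw [mul_pos_iff_of_pos_left (by positivity)]

/-- The conformal factor `e^{-k}` cancels in the Kropina metric. Where `σ` vanishes both sides are
the quotient by zero. -/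
lemma kropinaMetric_eq (x y : Coord n) :
    kropinaMetric h W k (⟨e.symm x, vec e x y⟩ : TangentBundle (𝓡 n) M) =
      chartMetric h e x y y / (2 * chartForm h W e x y) := by
  simp only [kropinaMetric, alphaSq, beta, chartForm_apply, chartMetric_apply]
  rw [mul_comm (2 : ℝ) (Real.exp _), mul_assoc, mul_div_mul_left _ _ (Real.exp_pos _).ne']

/-- The transition map from the chart `e` to the chart `e'`. -/
def transition (e e' : OpenPartialHomeomorph M (Coord n)) (x : Coord n) : Coord n := e' (e.symm x)

lemma isOpen_transition_domain : IsOpen (e.target ∩ e.symm ⁻¹' e'.source) :=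
  e.isOpen_inter_preimage_symm e'.open_source

lemma contDiffOn_transition (he : IsChart e) (he' : IsChart e') :
    ContDiffOn ℝ ∞ (transition e e') (e.target ∩ e.symm ⁻¹' e'.source) := by
  have h1 : ContMDiffOn (𝓡 n) (𝓡 n) ∞ e.symm e.target := contMDiffOn_symm_of_mem_maximalAtlas he
  have h2 : ContMDiffOn (𝓡 n) (𝓡 n) ∞ e' e'.source := contMDiffOn_of_mem_maximalAtlas he'
  exact (h2.comp (h1.mono Set.inter_subset_left) (fun x hx => hx.2)).contDiffOn

/-- Change of charts for coordinate vectors. The two sides belong to tangent spaces at points that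
are only propositionally equal, hence the comparison in the common model space. -/
lemma vec_transition (he : IsChart e) (he' : IsChart e') {x : Coord n} (hx : x ∈ e.target)
    (hx' : e.symm x ∈ e'.source) (u : Coord n) :
    (vec e x u : Coord n) = vec e' (transition e e' x) (fderiv ℝ (transition e e') x u) := by
  have hd : e.MDifferentiable (𝓡 n) (𝓡 n) := isChart_mdifferentiable he
  have hd' : e'.MDifferentiable (𝓡 n) (𝓡 n) := isChart_mdifferentiable he'
  have ho := isOpen_transition_domain (e := e) (e' := e')
  have h1 : MDifferentiableAt (𝓡 n) (𝓡 n) (transition e e') x :=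
    ((contDiffOn_transition he he').contDiffAt (ho.mem_nhds ⟨hx, hx'⟩)
      |>.differentiableAt (by simp)).mdifferentiableAt
  have h2 : MDifferentiableAt (𝓡 n) (𝓡 n) e'.symm (transition e e' x) :=
    hd'.mdifferentiableAt_symm (e'.map_source hx')
  have h3 := mfderiv_comp x h2 h1
  have h4 : e'.symm ∘ transition e e' =ᶠ[nhds x] e.symm := by
    filter_upwards [ho.mem_nhds ⟨hx, hx'⟩] with y hy
    exact e'.left_inv hy.2
  rw [h4.mfderiv_eq] at h3
  unfold vec
  rw [h3, mfderiv_eq_fderiv]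
  rfl

lemma chartMetric_transition (he : IsChart e) (he' : IsChart e') {x : Coord n} (hx : x ∈ e.target)
    (hx' : e.symm x ∈ e'.source) (u v : Coord n) :
    chartMetric h e x u v = chartMetric h e' (transition e e' x)
      (fderiv ℝ (transition e e') x u) (fderiv ℝ (transition e e') x v) := by
  -- transport along the propositional equality of base points
  have key : ∀ p q : M, p = q → ∀ a b : Coord n,
      (h.inner p : Coord n → Coord n →L[ℝ] ℝ) a b = (h.inner q : Coord n → Coord n →L[ℝ] ℝ) a b := by
    rintro p _ rfl a b; rfl
  have hp : e'.symm (transition e e' x) = e.symm x := e'.left_inv hx'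
  refine (key _ _ hp.symm (vec e x u) (vec e x v)).trans ?_
  rw [vec_transition he he' hx hx', vec_transition he he' hx hx']
  rfl

lemma chartForm_transition (he : IsChart e) (he' : IsChart e') {x : Coord n} (hx : x ∈ e.target)
    (hx' : e.symm x ∈ e'.source) (u : Coord n) :
    chartForm h W e x u = chartForm h W e' (transition e e' x)
      (fderiv ℝ (transition e e') x u) := by
  -- transport along the propositional equality of base points
  have key : ∀ p q : M, p = q → ∀ b : Coord n,
      (h.inner p (W p) : Coord n → ℝ) b = (h.inner q (W q) : Coord n → ℝ) b := by
    rintro p _ rfl b; rfl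
  have hp : e'.symm (transition e e' x) = e.symm x := e'.left_inv hx'
  refine (key _ _ hp.symm (vec e x u)).trans ?_
  rw [vec_transition he he' hx hx']
  rfl

lemma fderiv_transition_surjective (he : IsChart e) (he' : IsChart e') {x : Coord n}
    (hx : x ∈ e.target) (hx' : e.symm x ∈ e'.source) :
    Function.Surjective (fderiv ℝ (transition e e') x) := by
  intro v
  obtain ⟨u, hu⟩ := (vec_bijective he hx).2 (vec e' (transition e e' x) v : Coord n)
  refine ⟨u, (vec_bijective he' (e'.map_source hx')).1 ?_⟩
  exact (vec_transition he he' hx hx' u).symm.trans hu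

end Charts

/-! ### The Levi-Civita connection in a chart -/

section LeviCivita

lemma sum_smul_basisVec {n : ℕ} (u : Coord n) : ∑ i, u i • basisVec i = u := by
  simpa [basisVec] using (EuclideanSpace.basisFun (Fin n) ℝ).sum_repr u

lemma basisVec_apply {n : ℕ} (i j : Fin n) : (basisVec i : Coord n) j = if j = i then 1 else 0 := by
  simp [basisVec]

lemma map_eq_sum_basisVec {n : ℕ} {F : Type*} [AddCommGroup F] [Module ℝ F] {f : Coord n → F}
    (hf : IsLinearMap ℝ f) (u : Coord n) : f u = ∑ i, u i • f (basisVec i) := by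
  have := map_sum (hf.mk' f) (fun i => u i • basisVec i) Finset.univ
  rw [sum_smul_basisVec] at this
  simpa using this

lemma eq_of_eq_basisVec {n : ℕ} {F : Type*} [AddCommGroup F] [Module ℝ F] {f g : Coord n → F}
    (hf : IsLinearMap ℝ f) (hg : IsLinearMap ℝ g) (hb : ∀ i, f (basisVec i) = g (basisVec i))
    (u : Coord n) : f u = g u := by
  rw [map_eq_sum_basisVec hf, map_eq_sum_basisVec hg]
  simp [hb]

/-- A map of two variables that is linear in each of them. -/
structure IsBilinear {E F : Type*} [AddCommGroup E] [Module ℝ E] [AddCommGroup F] [Module ℝ F]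
    (T : E → E → F) : Prop where
  fst : ∀ v, IsLinearMap ℝ fun u => T u v
  snd : ∀ u, IsLinearMap ℝ fun v => T u v

/-- A map of three variables that is linear in each of them. -/
structure IsTrilinear {E F : Type*} [AddCommGroup E] [Module ℝ E] [AddCommGroup F] [Module ℝ F]
    (T : E → E → E → F) : Prop where
  fst : ∀ v w, IsLinearMap ℝ fun u => T u v w
  snd : ∀ u w, IsLinearMap ℝ fun v => T u v w
  trd : ∀ u v, IsLinearMap ℝ fun w => T u v w

/-- Bilinear maps are determined by their components. -/
lemma IsBilinear.ext_basisVec {n : ℕ} {F : Type*} [AddCommGroup F] [Module ℝ F]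
    {T T' : Coord n → Coord n → F} (hT : IsBilinear T) (hT' : IsBilinear T')
    (H : ∀ i j, T (basisVec i) (basisVec j) = T' (basisVec i) (basisVec j)) (u v : Coord n) :
    T u v = T' u v :=
  eq_of_eq_basisVec (hT.fst v) (hT'.fst v)
    (fun _ => eq_of_eq_basisVec (hT.snd _) (hT'.snd _) (fun _ => H _ _) v) u

/-- Trilinear maps are determined by their components: the passage from the coordinate formulas
for the Levi-Civita connection and its curvature to identities between vectors. -/
lemma IsTrilinear.ext_basisVec {n : ℕ} {F : Type*} [AddCommGroup F] [Module ℝ F]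
    {T T' : Coord n → Coord n → Coord n → F} (hT : IsTrilinear T) (hT' : IsTrilinear T')
    (H : ∀ i j k, T (basisVec i) (basisVec j) (basisVec k) =
      T' (basisVec i) (basisVec j) (basisVec k)) (u v w : Coord n) : T u v w = T' u v w :=
  eq_of_eq_basisVec (hT.fst v w) (hT'.fst v w) (fun _ => eq_of_eq_basisVec (hT.snd _ w)
    (hT'.snd _ w) (fun _ => eq_of_eq_basisVec (hT.trd _ _) (hT'.trd _ _) (fun _ => H _ _ _) w) v) u

section Multilinear

variable {E F : Type*} [NormedAddCommGroup E] [NormedSpace ℝ E] [NormedAddCommGroup F]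
  [NormedSpace ℝ F]

lemma isLinearMap_clm (B : E →L[ℝ] F) : IsLinearMap ℝ fun u => B u := ⟨map_add B, map_smul B⟩

lemma isLinearMap_clm_apply (B : E →L[ℝ] E →L[ℝ] F) (v : E) : IsLinearMap ℝ fun u => B u v :=
  ⟨by simp, by simp⟩

lemma isTrilinear_comp (B : E →L[ℝ] E →L[ℝ] F) (Γ : E →L[ℝ] E →L[ℝ] E) :
    IsTrilinear fun u v w => B (Γ u v) w :=
  ⟨fun _ _ => ⟨by simp, by simp⟩, fun _ _ => ⟨by simp, by simp⟩, fun _ _ => ⟨by simp, by simp⟩⟩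

lemma isTrilinear_clm (D : E →L[ℝ] E →L[ℝ] E →L[ℝ] F) : IsTrilinear fun u v w => D u v w :=
  ⟨fun v w => ⟨fun a b => congrArg (fun T => T v w) (D.map_add a b),
      fun a b => congrArg (fun T => T v w) (D.toLinearMap.map_smul a b)⟩,
    fun u w => isLinearMap_clm_apply (D u) w, fun u v => isLinearMap_clm (D u v)⟩

lemma IsTrilinear.add {T T' : E → E → E → F} (hT : IsTrilinear T) (hT' : IsTrilinear T') :
    IsTrilinear fun u v w => T u v w + T' u v w :=
  ⟨fun v w => ((hT.fst v w).mk' _ + (hT'.fst v w).mk' _).isLinear,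
    fun v w => ((hT.snd v w).mk' _ + (hT'.snd v w).mk' _).isLinear,
    fun v w => ((hT.trd v w).mk' _ + (hT'.trd v w).mk' _).isLinear⟩

lemma IsTrilinear.smul {T : E → E → E → F} (hT : IsTrilinear T) (c : ℝ) :
    IsTrilinear fun u v w => c • T u v w :=
  ⟨fun v w => (c • (hT.fst v w).mk' _).isLinear, fun v w => (c • (hT.snd v w).mk' _).isLinear,
    fun v w => (c • (hT.trd v w).mk' _).isLinear⟩

lemma IsTrilinear.sub {T T' : E → E → E → F} (hT : IsTrilinear T) (hT' : IsTrilinear T') :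
    IsTrilinear fun u v w => T u v w - T' u v w := by
  simpa [sub_eq_add_neg] using hT.add (hT'.smul (-1))

lemma IsTrilinear.rotate {T : E → E → E → F} (hT : IsTrilinear T) :
    IsTrilinear fun u v w => T v w u :=
  ⟨fun v w => hT.trd v w, fun u w => hT.fst w u, fun u v => hT.snd v u⟩

lemma IsTrilinear.swap {T : E → E → E → F} (hT : IsTrilinear T) :
    IsTrilinear fun u v w => T v u w :=
  ⟨fun v w => hT.snd v w, fun u w => hT.fst u w, fun u v => hT.trd v u⟩

lemma isTrilinear_koszul (D : E →L[ℝ] E →L[ℝ] E →L[ℝ] ℝ) :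
    IsTrilinear fun u v w => (1 / 2) * (D v w u - D w u v + D u v w) :=
  (((isTrilinear_clm D).rotate.sub (isTrilinear_clm D).rotate.rotate).add
    (isTrilinear_clm D)).smul (1 / 2)

lemma isBilinear_fderiv_sub (D : E →L[ℝ] E →L[ℝ] ℝ) (l : E →L[ℝ] ℝ) (Γ : E →L[ℝ] E →L[ℝ] E) :
    IsBilinear fun u v => D v u - l (Γ u v) := by
  refine ⟨fun _ => ⟨fun a b => ?_, fun a b => ?_⟩, fun _ => ⟨fun a b => ?_, fun a b => ?_⟩⟩ <;>
    simp <;> ring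

lemma isBilinear_neg_flip {T : E → E → ℝ} (hT : IsBilinear T) : IsBilinear fun u v => - T v u := by
  refine ⟨fun v => ⟨fun a b => ?_, fun a b => ?_⟩, fun v => ⟨fun a b => ?_, fun a b => ?_⟩⟩
  · rw [(hT.snd v).map_add]; ring
  · rw [(hT.snd v).map_smul, smul_neg]
  · rw [(hT.fst v).map_add]; ring
  · rw [(hT.fst v).map_smul, smul_neg]

/-- The curvature `(∂_u Γ)(v, z) - (∂_v Γ)(u, z) + Γ(u, Γ(v, z)) - Γ(v, Γ(u, z))` of the linear
connection with Christoffel symbols `Γ` on an open set of a normed space. -/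
def curvature (Γ : E → E →L[ℝ] E →L[ℝ] E) (x u v z : E) : E :=
  fderiv ℝ Γ x u v z - fderiv ℝ Γ x v u z + Γ x u (Γ x v z) - Γ x v (Γ x u z)

lemma isTrilinear_curvature (Γ : E → E →L[ℝ] E →L[ℝ] E) (x : E) :
    IsTrilinear (curvature Γ x) := by
  have h1 : IsTrilinear fun u v z => fderiv ℝ Γ x u v z := isTrilinear_clm _
  have h2 : IsTrilinear fun u v z => Γ x u (Γ x v z) :=
    ⟨fun _ _ => ⟨by simp, by simp⟩, fun _ _ => ⟨by simp, by simp⟩, fun _ _ => ⟨by simp, by simp⟩⟩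
  exact ((h1.sub h1.swap).add h2).sub h2.swap

lemma isTrilinear_zero : IsTrilinear fun _ _ _ : E => (0 : F) :=
  ⟨fun _ _ => ⟨by simp, by simp⟩, fun _ _ => ⟨by simp, by simp⟩, fun _ _ => ⟨by simp, by simp⟩⟩

end Multilinear

variable {n : ℕ} {M : Type*} [TopologicalSpace M] [ChartedSpace (Coord n) M]
  [IsManifold (𝓡 n) ∞ M] (h : Metric n M) {W : (p : M) → TangentSpace (𝓡 n) p}
  {e : OpenPartialHomeomorph M (Coord n)}

/-- The Christoffel symbols of `h` in the chart `e`, as a field of bilinear maps on `ℝⁿ`. -/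
def chartConnection (e : OpenPartialHomeomorph M (Coord n)) (x : Coord n) :
    Coord n →L[ℝ] Coord n →L[ℝ] Coord n :=
  ∑ i, ∑ j, ∑ k, christoffel h e i j k x •
    (EuclideanSpace.proj j : Coord n →L[ℝ] ℝ).smulRight
      ((EuclideanSpace.proj k : Coord n →L[ℝ] ℝ).smulRight (basisVec i))

lemma chartConnection_apply (x u v : Coord n) (i : Fin n) :
    chartConnection h e x u v i = ∑ j, ∑ k, christoffel h e i j k x * u j * v k := by
  simp only [chartConnection, _root_.sum_apply, _root_.smul_apply,
    ContinuousLinearMap.smulRight_apply, PiLp.proj_apply, PiLp.smul_apply, smul_eq_mul,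
    WithLp.ofLp_sum, Finset.sum_apply, basisVec_apply]
  rw [Finset.sum_eq_single i]
  · refine Finset.sum_congr rfl fun j _ => Finset.sum_congr rfl fun k _ => ?_
    simp [mul_assoc]
  · intro b _ hb
    simp [hb.symm]
  · simp

lemma chartConnection_basisVec (x : Coord n) (i j k : Fin n) :
    chartConnection h e x (basisVec j) (basisVec k) i = christoffel h e i j k x := by
  simp [chartConnection_apply, basisVec_apply]

lemma differentiableAt_chartMetric (he : IsChart e) {x : Coord n} (hx : x ∈ e.target) :
    DifferentiableAt ℝ (chartMetric h e) x :=
  ((contDiffOn_chartMetric h he).contDiffAt (e.open_target.mem_nhds hx)).differentiableAt (by simp)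

lemma fderiv_clm_apply_apply {E F G H : Type*} [NormedAddCommGroup E] [NormedSpace ℝ E]
    [NormedAddCommGroup F] [NormedSpace ℝ F] [NormedAddCommGroup G] [NormedSpace ℝ G]
    [NormedAddCommGroup H] [NormedSpace ℝ H] {B : E → F →L[ℝ] G →L[ℝ] H} {x : E}
    (hB : DifferentiableAt ℝ B x) (u : F) (v : G) (w : E) :
    fderiv ℝ (fun y => B y u v) x w = fderiv ℝ B x w u v := by
  have := ((hB.hasFDerivAt.clm_apply (hasFDerivAt_const u x)).clm_apply
    (hasFDerivAt_const v x)).fderiv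
  rw [this]
  simp

lemma pd_metricCoeff (he : IsChart e) {x : Coord n} (hx : x ∈ e.target) (i j k : Fin n) :
    pd k (metricCoeff h e i j) x =
      fderiv ℝ (chartMetric h e) x (basisVec k) (basisVec i) (basisVec j) :=
  fderiv_clm_apply_apply (differentiableAt_chartMetric h he hx) _ _ _

lemma fderiv_chartMetric_symm (he : IsChart e) {x : Coord n} (hx : x ∈ e.target)
    (u v w : Coord n) :
    fderiv ℝ (chartMetric h e) x w u v = fderiv ℝ (chartMetric h e) x w v u := by
  rw [← fderiv_clm_apply_apply (differentiableAt_chartMetric h he hx),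
    ← fderiv_clm_apply_apply (differentiableAt_chartMetric h he hx)]
  simp_rw [chartMetric_symm h _ u v]

lemma det_metricCoeff_ne_zero (he : IsChart e) {x : Coord n} (hx : x ∈ e.target) :
    (Matrix.of fun p q : Fin n => metricCoeff h e p q x).det ≠ 0 := by
  intro h0
  obtain ⟨v, hv, hv0⟩ := Matrix.exists_mulVec_eq_zero_iff.2 h0
  set u : Coord n := WithLp.toLp 2 v with hu
  have hne : u ≠ 0 := fun hu0 => hv (by simpa [hu] using congrArg WithLp.ofLp hu0)
  have hpos := chartMetric_pos h he hx hne
  have hz : ∀ p, chartMetric h e x (basisVec p) u = 0 := by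
    intro p
    have := congrFun hv0 p
    simp only [Matrix.mulVec, dotProduct, Matrix.of_apply, metricCoeff_eq, Pi.zero_apply] at this
    rw [map_eq_sum_basisVec (f := fun z => chartMetric h e x (basisVec p) z)
      (isLinearMap_clm _), ← this]
    refine Finset.sum_congr rfl fun q _ => ?_
    rw [smul_eq_mul, mul_comm]
  have := map_eq_sum_basisVec (f := fun z => chartMetric h e x z u) (isLinearMap_clm_apply _ _) u
  simp only [hz, smul_zero, Finset.sum_const_zero] at this
  exact hpos.ne' this

lemma sum_metricCoeff_mul_invMetricCoeff (he : IsChart e) {x : Coord n} (hx : x ∈ e.target)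
    (m s : Fin n) :
    ∑ i, metricCoeff h e m i x * invMetricCoeff h e i s x = if m = s then 1 else 0 := by
  have := Matrix.mul_nonsing_inv (Matrix.of fun p q : Fin n => metricCoeff h e p q x)
    (isUnit_iff_ne_zero.2 (det_metricCoeff_ne_zero h he hx))
  have := congrFun (congrFun this m) s
  rw [Matrix.mul_apply, Matrix.one_apply] at this
  exact this

/-- The Koszul formula. -/
lemma koszul (he : IsChart e) {x : Coord n} (hx : x ∈ e.target) (u v w : Coord n) :
    chartMetric h e x (chartConnection h e x u v) w =
      (1 / 2) * (fderiv ℝ (chartMetric h e) x v w u - fderiv ℝ (chartMetric h e) x w u v +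
        fderiv ℝ (chartMetric h e) x u v w) := by
  refine (isTrilinear_comp (chartMetric h e x) (chartConnection h e x)).ext_basisVec
    (isTrilinear_koszul (fderiv ℝ (chartMetric h e) x)) (fun j k m => ?_) u v w
  rw [chartMetric_symm, map_eq_sum_basisVec (f := fun z => chartMetric h e x (basisVec m) z)
      (isLinearMap_clm _)]
  simp_rw [chartConnection_basisVec, ← metricCoeff_eq, smul_eq_mul, christoffel, mul_assoc,
    Finset.sum_mul, mul_assoc]
  rw [← Finset.mul_sum, Finset.sum_comm]
  congr 1
  have : ∀ s, ∑ i, invMetricCoeff h e i s x * ((pd k (metricCoeff h e s j) x -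
      pd s (metricCoeff h e j k) x + pd j (metricCoeff h e k s) x) * metricCoeff h e m i x) =
      (if m = s then 1 else 0) * (pd k (metricCoeff h e s j) x -
      pd s (metricCoeff h e j k) x + pd j (metricCoeff h e k s) x) := by
    intro s
    rw [← sum_metricCoeff_mul_invMetricCoeff h he hx, Finset.sum_mul]
    exact Finset.sum_congr rfl fun i _ => by ring
  rw [Finset.sum_congr rfl fun s _ => this s]
  simp [pd_metricCoeff h he hx]

lemma eq_of_chartMetric_eq (he : IsChart e) {x : Coord n} (hx : x ∈ e.target) {u v : Coord n}
    (huv : ∀ w, chartMetric h e x u w = chartMetric h e x v w) : u = v := by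
  by_contra hne
  have := chartMetric_pos h he hx (sub_ne_zero.2 hne)
  rw [(isLinearMap_clm_apply (chartMetric h e x) (u - v)).map_sub, huv, sub_self] at this
  exact this.ne' rfl

/-- The Levi-Civita connection is torsion-free. -/
lemma chartConnection_symm (he : IsChart e) {x : Coord n} (hx : x ∈ e.target) (u v : Coord n) :
    chartConnection h e x u v = chartConnection h e x v u := by
  refine eq_of_chartMetric_eq h he hx fun w => ?_
  rw [koszul h he hx, koszul h he hx, fderiv_chartMetric_symm h he hx w u,
    fderiv_chartMetric_symm h he hx u v, fderiv_chartMetric_symm h he hx v w]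
  ring

/-- The Levi-Civita connection is metric. -/
lemma fderiv_chartMetric (he : IsChart e) {x : Coord n} (hx : x ∈ e.target) (u v w : Coord n) :
    fderiv ℝ (chartMetric h e) x u v w =
      chartMetric h e x (chartConnection h e x u v) w +
        chartMetric h e x v (chartConnection h e x u w) := by
  rw [chartMetric_symm h x v, koszul h he hx, koszul h he hx, fderiv_chartMetric_symm h he hx w u,
    fderiv_chartMetric_symm h he hx w v, fderiv_chartMetric_symm h he hx u v]
  ring

lemma contDiffOn_det {E : Type*} [NormedAddCommGroup E] [NormedSpace ℝ E] {m : ℕ}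
    {A : E → Matrix (Fin m) (Fin m) ℝ} {s : Set E} {N : WithTop ℕ∞}
    (hA : ∀ i j, ContDiffOn ℝ N (fun x => A x i j) s) : ContDiffOn ℝ N (fun x => (A x).det) s := by
  simp_rw [Matrix.det_apply]
  refine ContDiffOn.sum fun σ _ => ContDiffOn.const_smul _ ?_
  exact contDiffOn_prod fun i _ => hA _ _

lemma contDiffOn_invMetricCoeff (he : IsChart e) (i j : Fin n) :
    ContDiffOn ℝ ∞ (invMetricCoeff h e i j) e.target := by
  have hm : ∀ i j, ContDiffOn ℝ ∞ (metricCoeff h e i j) e.target := fun i j =>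
    ((contDiffOn_chartMetric h he).clm_apply contDiffOn_const).clm_apply contDiffOn_const
  have hadj : ContDiffOn ℝ ∞ (fun x =>
      (Matrix.of fun p q : Fin n => metricCoeff h e p q x).adjugate i j) e.target := by
    simp_rw [Matrix.adjugate_apply]
    refine contDiffOn_det fun p q => ?_
    by_cases hp : p = j
    · subst hp
      simp only [Matrix.updateRow_self]
      exact contDiffOn_const
    · simp only [Matrix.updateRow_ne hp]
      exact hm p q
  have hdet : ContDiffOn ℝ ∞ (fun x =>
      (Matrix.of fun p q : Fin n => metricCoeff h e p q x).det) e.target :=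
    contDiffOn_det fun p q => hm p q
  refine ((hdet.inv fun x hx => det_metricCoeff_ne_zero h he hx).mul hadj).congr fun x hx => ?_
  simp [invMetricCoeff, Matrix.inv_def]

lemma contDiffOn_christoffel (he : IsChart e) (i j k : Fin n) :
    ContDiffOn ℝ ∞ (christoffel h e i j k) e.target := by
  have hm : ∀ i j k, ContDiffOn ℝ ∞ (pd k (metricCoeff h e i j)) e.target := fun i j k => by
    have h1 : ContDiffOn ℝ ∞ (metricCoeff h e i j) e.target :=
      ((contDiffOn_chartMetric h he).clm_apply contDiffOn_const).clm_apply contDiffOn_const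
    exact (h1.fderiv_of_isOpen (m := ∞) e.open_target (by simp)).clm_apply contDiffOn_const
  refine contDiffOn_const.mul (ContDiffOn.sum fun s _ => ?_)
  exact (contDiffOn_invMetricCoeff h he i s).mul (((hm _ _ _).sub (hm _ _ _)).add (hm _ _ _))

lemma contDiffOn_chartConnection (he : IsChart e) :
    ContDiffOn ℝ ∞ (chartConnection h e) e.target := by
  rw [contDiffOn_clm_apply]
  intro u
  rw [contDiffOn_clm_apply]
  intro v
  rw [contDiffOn_euclidean]
  intro i
  simp_rw [chartConnection_apply]
  exact ContDiffOn.sum fun j _ => ContDiffOn.sum fun k _ =>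
    ((contDiffOn_christoffel h he i j k).mul contDiffOn_const).mul contDiffOn_const

lemma differentiableAt_chartConnection (he : IsChart e) {x : Coord n} (hx : x ∈ e.target) :
    DifferentiableAt ℝ (chartConnection h e) x :=
  ((contDiffOn_chartConnection h he).contDiffAt (e.open_target.mem_nhds hx)).differentiableAt
    (by simp)

lemma riemann_eq (he : IsChart e) {x : Coord n} (hx : x ∈ e.target) (i j k l : Fin n) :
    riemann h e i j k l x =
      curvature (chartConnection h e) x (basisVec k) (basisVec l) (basisVec j) i := by
  have hpd : ∀ k l j, pd k (christoffel h e i l j) x =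
      fderiv ℝ (chartConnection h e) x (basisVec k) (basisVec l) (basisVec j) i := by
    intro k l j
    rw [← fderiv_clm_apply_apply (differentiableAt_chartConnection h he hx)]
    have hd : DifferentiableAt ℝ (fun y => chartConnection h e y (basisVec l) (basisVec j)) x :=
      ((differentiableAt_chartConnection h he hx).clm_apply
        (differentiableAt_const _)).clm_apply (differentiableAt_const _)
    have := ((EuclideanSpace.proj i : Coord n →L[ℝ] ℝ).hasFDerivAt.comp x hd.hasFDerivAt).fderiv
    have h2 : (EuclideanSpace.proj i : Coord n →L[ℝ] ℝ) ∘
        (fun y => chartConnection h e y (basisVec l) (basisVec j)) = christoffel h e i l j := by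
      ext y; exact chartConnection_basisVec h y i l j
    rw [h2] at this
    rw [pd, this]
    rfl
  have hsum : ∀ k l, ∑ r, christoffel h e i k r x * christoffel h e r l j x =
      chartConnection h e x (basisVec k) (chartConnection h e x (basisVec l) (basisVec j)) i := by
    intro k l
    rw [map_eq_sum_basisVec (f := fun z => chartConnection h e x (basisVec k) z)
      (isLinearMap_clm _)]
    simp [chartConnection_basisVec, mul_comm]
  simp only [riemann, curvature, hpd, Finset.sum_sub_distrib, hsum, PiLp.sub_apply, PiLp.add_apply]
  ring

lemma curvature_eq_zero_iff (he : IsChart e) {x : Coord n} (hx : x ∈ e.target) :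
    (∀ i j k l, riemann h e i j k l x = 0) ↔
      ∀ u v z, curvature (chartConnection h e) x u v z = 0 := by
  simp_rw [riemann_eq h he hx]
  refine ⟨fun H u v z => ?_, fun H i j k l => by rw [H]; rfl⟩
  refine (isTrilinear_curvature _ x).ext_basisVec isTrilinear_zero (fun k l j => ?_) u v z
  ext i
  exact H i j k l

lemma sum_riemann_eq (he : IsChart e) {x : Coord n} (hx : x ∈ e.target) (X Y : Coord n) :
    (∑ i, ∑ j, ∑ k, ∑ l, ∑ m,
      metricCoeff h e i m x * riemann h e i j k l x * X k * Y l * Y j * X m) =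
    chartMetric h e x (curvature (chartConnection h e) x X Y Y) X := by
  have hR : ∀ i, curvature (chartConnection h e) x X Y Y i =
      ∑ j, ∑ k, ∑ l, riemann h e i j k l x * X k * Y l * Y j := by
    intro i
    simp_rw [riemann_eq h he hx]
    rw [map_eq_sum_basisVec (f := fun z => curvature (chartConnection h e) x X Y z) ((isTrilinear_curvature _ x).trd X Y)]
    simp only [WithLp.ofLp_sum, Finset.sum_apply, PiLp.smul_apply, smul_eq_mul]
    refine Finset.sum_congr rfl fun j _ => ?_
    rw [map_eq_sum_basisVec (f := fun z => curvature (chartConnection h e) x z Y (basisVec j))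
      ((isTrilinear_curvature _ x).fst Y _)]
    simp only [WithLp.ofLp_sum, Finset.sum_apply, PiLp.smul_apply, smul_eq_mul, Finset.mul_sum]
    refine Finset.sum_congr rfl fun k _ => ?_
    rw [map_eq_sum_basisVec
      (f := fun z => curvature (chartConnection h e) x (basisVec k) z (basisVec j))
      ((isTrilinear_curvature _ x).snd _ _)]
    simp only [WithLp.ofLp_sum, Finset.sum_apply, PiLp.smul_apply, smul_eq_mul, Finset.mul_sum]
    exact Finset.sum_congr rfl fun l _ => by ring
  rw [map_eq_sum_basisVec (f := fun z => chartMetric h e x z X) (isLinearMap_clm_apply _ _)]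
  refine Finset.sum_congr rfl fun i _ => ?_
  rw [hR, map_eq_sum_basisVec (f := fun z => chartMetric h e x (basisVec i) z)
      (isLinearMap_clm _), smul_eq_mul, Finset.sum_mul]
  refine Finset.sum_congr rfl fun j _ => ?_
  rw [Finset.sum_mul]
  refine Finset.sum_congr rfl fun k _ => ?_
  rw [Finset.sum_mul]
  refine Finset.sum_congr rfl fun l _ => ?_
  rw [Finset.mul_sum]
  refine Finset.sum_congr rfl fun m _ => ?_
  rw [metricCoeff_eq, smul_eq_mul]
  ring

lemma covDeriv_eq {x : Coord n} (hω : DifferentiableAt ℝ (chartForm h W e) x) (i j : Fin n) :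
    covDeriv h W e i j x = fderiv ℝ (chartForm h W e) x (basisVec j) (basisVec i) -
      chartForm h W e x (chartConnection h e x (basisVec i) (basisVec j)) := by
  have h1 : pd j (covComp h W e i) x = fderiv ℝ (chartForm h W e) x (basisVec j) (basisVec i) := by
    have := (hω.hasFDerivAt.clm_apply (hasFDerivAt_const (basisVec i) x)).fderiv
    change fderiv ℝ (fun y => chartForm h W e y (basisVec i)) x _ = _
    rw [this]
    simp
  rw [covDeriv, h1, map_eq_sum_basisVec (f := fun z => chartForm h W e x z) (isLinearMap_clm _)]
  simp [chartConnection_basisVec, covComp_eq]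

lemma covDeriv_eq_zero_iff {x : Coord n} (hω : DifferentiableAt ℝ (chartForm h W e) x) :
    (∀ i j, covDeriv h W e i j x = 0) ↔ ∀ u v, fderiv ℝ (chartForm h W e) x v u =
      chartForm h W e x (chartConnection h e x u v) := by
  simp_rw [covDeriv_eq h hω, sub_eq_zero]
  refine ⟨fun H u v => ?_, fun H i j => H _ _⟩
  rw [← sub_eq_zero]
  exact (isBilinear_fderiv_sub _ _ _).ext_basisVec (T' := fun _ _ => (0 : ℝ))
    ⟨fun _ => ⟨by simp, by simp⟩, fun _ => ⟨by simp, by simp⟩⟩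
    (fun i j => sub_eq_zero.2 (H i j)) u v

lemma IsKilling.fderiv_chartForm (hK : IsKilling h W) (he : IsChart e) {x : Coord n}
    (hx : x ∈ e.target) (hω : DifferentiableAt ℝ (chartForm h W e) x) (u v : Coord n) :
    fderiv ℝ (chartForm h W e) x v u - chartForm h W e x (chartConnection h e x u v) =
      -(fderiv ℝ (chartForm h W e) x u v - chartForm h W e x (chartConnection h e x v u)) := by
  have hB := isBilinear_fderiv_sub (fderiv ℝ (chartForm h W e) x) (chartForm h W e x)
    (chartConnection h e x)
  refine hB.ext_basisVec (isBilinear_neg_flip hB) (fun i j => ?_) u v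
  have := hK e he x hx i j
  rw [covDeriv_eq h hω, covDeriv_eq h hω] at this
  linarith

end LeviCivita

/-! ### Curvature identities and the algebra of projective flatness -/

section CurvatureIdentities

variable {E F : Type*} [NormedAddCommGroup E] [NormedSpace ℝ E] [NormedAddCommGroup F]
  [NormedSpace ℝ F]

lemma two_le_minSmoothness_infty : minSmoothness ℝ 2 ≤ (∞ : WithTop ℕ∞) := by
  simp only [minSmoothness_of_isRCLikeNormedField]
  exact WithTop.coe_le_coe.2 (le_top : (2 : ℕ∞) ≤ ⊤)

lemma curvature_swap (Γ : E → E →L[ℝ] E →L[ℝ] E) (x u v z : E) :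
    curvature Γ x u v z = -curvature Γ x v u z := by
  simp only [curvature]; abel

/-- The first Bianchi identity for a torsion-free connection. -/
lemma curvature_bianchi {Γ : E → E →L[ℝ] E →L[ℝ] E} {s : Set E} (hs : IsOpen s)
    (hΓ : ContDiffOn ℝ ∞ Γ s) (hsymm : ∀ x ∈ s, ∀ u v, Γ x u v = Γ x v u) {x : E} (hx : x ∈ s)
    (u v z : E) : curvature Γ x u v z + curvature Γ x v z u + curvature Γ x z u v = 0 := by
  have hd : DifferentiableAt ℝ Γ x :=
    (hΓ.contDiffAt (hs.mem_nhds hx)).differentiableAt (by simp)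
  have hD : ∀ w a b, fderiv ℝ Γ x w a b = fderiv ℝ Γ x w b a := by
    intro w a b
    rw [← fderiv_clm_apply_apply hd, ← fderiv_clm_apply_apply hd]
    congr 1
    refine Filter.EventuallyEq.fderiv_eq ?_
    filter_upwards [hs.mem_nhds hx] with y hy using hsymm y hy a b
  simp only [curvature, hD u z v, hD v u z, hD z v u, hsymm x hx z v, hsymm x hx u z,
    hsymm x hx v u]
  abel

/-- The curvature operators of a metric connection are skew-symmetric. -/
lemma curvature_skew {G : E → E →L[ℝ] E →L[ℝ] ℝ} {Γ : E → E →L[ℝ] E →L[ℝ] E} {s : Set E}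
    (hs : IsOpen s) (hG : ContDiffOn ℝ ∞ G s) (hΓ : ContDiffOn ℝ ∞ Γ s)
    (hcompat : ∀ x ∈ s, ∀ u v w, fderiv ℝ G x u v w = G x (Γ x u v) w + G x v (Γ x u w))
    {x : E} (hx : x ∈ s) (u v a b : E) :
    G x (curvature Γ x u v a) b + G x a (curvature Γ x u v b) = 0 := by
  have hGx : ContDiffAt ℝ ∞ G x := hG.contDiffAt (hs.mem_nhds hx)
  have hGd : DifferentiableAt ℝ G x := hGx.differentiableAt (by simp)
  have hΓd : DifferentiableAt ℝ Γ x := (hΓ.contDiffAt (hs.mem_nhds hx)).differentiableAt (by simp)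
  obtain ⟨φ, hφ⟩ : ∃ φ : E → ℝ, φ = fun y => G y a b := ⟨_, rfl⟩
  have hφx : ContDiffAt ℝ ∞ φ x := by
    rw [hφ]; exact (hGx.clm_apply contDiffAt_const).clm_apply contDiffAt_const
  have hφd : DifferentiableAt ℝ (fderiv ℝ φ) x :=
    (hφx.fderiv_right (m := ∞) (by simp)).differentiableAt (by simp)
  have hsymm : IsSymmSndFDerivAt ℝ φ x := hφx.isSymmSndFDerivAt two_le_minSmoothness_infty
  have hφ' : ∀ y ∈ s, ∀ v, fderiv ℝ φ y v = G y (Γ y v a) b + G y a (Γ y v b) := by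
    intro y hy v
    rw [hφ, fderiv_clm_apply_apply ((hG.contDiffAt (hs.mem_nhds hy)).differentiableAt (by simp)),
      hcompat y hy]
  have key : ∀ u v, fderiv ℝ (fderiv ℝ φ) x u v =
      G x (Γ x u (Γ x v a)) b + G x (Γ x v a) (Γ x u b) + G x (fderiv ℝ Γ x u v a) b +
      (G x (Γ x u a) (Γ x v b) + G x a (Γ x u (Γ x v b)) + G x a (fderiv ℝ Γ x u v b)) := by
    intro u v
    have hΓa := (hΓd.hasFDerivAt.clm_apply (hasFDerivAt_const v x)).clm_apply
      (hasFDerivAt_const a x)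
    have hΓb := (hΓd.hasFDerivAt.clm_apply (hasFDerivAt_const v x)).clm_apply
      (hasFDerivAt_const b x)
    have h1 := (hGd.hasFDerivAt.clm_apply hΓa).clm_apply (hasFDerivAt_const b x)
    have h2 := (hGd.hasFDerivAt.clm_apply (hasFDerivAt_const a x)).clm_apply hΓb
    have h3 : HasFDerivAt (fun y => fderiv ℝ φ y v) _ x := (h1.add h2).congr_of_eventuallyEq (by
      filter_upwards [hs.mem_nhds hx] with y hy using hφ' y hy v)
    have h4 := hφd.hasFDerivAt.clm_apply (hasFDerivAt_const v x)
    have h5 := congrArg (fun T => T u) (h4.unique h3)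
    simp only [ContinuousLinearMap.comp_zero, zero_add, ContinuousLinearMap.flip_apply,
      _root_.add_apply, ContinuousLinearMap.comp_apply] at h5
    rw [h5, hcompat x hx, hcompat x hx]
    ring
  have h1 := key u v
  rw [hsymm u v, key v u] at h1
  have hl := isLinearMap_clm_apply (G x) b
  have hr := isLinearMap_clm (G x a)
  simp only [curvature, hl.map_sub, hl.map_add, hr.map_sub, hr.map_add]
  linarith

/-- The Ricci identity for a parallel one-form. -/
lemma apply_curvature_of_parallel {θ : E → E →L[ℝ] F} {Γ : E → E →L[ℝ] E →L[ℝ] E} {s : Set E}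
    (hs : IsOpen s) (hθ : ContDiffOn ℝ ∞ θ s) (hΓ : ContDiffOn ℝ ∞ Γ s)
    (hpar : ∀ x ∈ s, ∀ u v, fderiv ℝ θ x u v = θ x (Γ x u v))
    {x : E} (hx : x ∈ s) (u v z : E) : θ x (curvature Γ x u v z) = 0 := by
  have hθx : ContDiffAt ℝ ∞ θ x := hθ.contDiffAt (hs.mem_nhds hx)
  have hθd : DifferentiableAt ℝ θ x := hθx.differentiableAt (by simp)
  have hΓd : DifferentiableAt ℝ Γ x := (hΓ.contDiffAt (hs.mem_nhds hx)).differentiableAt (by simp)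
  have hθ'd : DifferentiableAt ℝ (fderiv ℝ θ) x :=
    (hθx.fderiv_right (m := ∞) (by simp)).differentiableAt (by simp)
  have hsymm : IsSymmSndFDerivAt ℝ θ x := hθx.isSymmSndFDerivAt two_le_minSmoothness_infty
  have key : ∀ u v, fderiv ℝ (fderiv ℝ θ) x u v z =
      θ x (fderiv ℝ Γ x u v z) + θ x (Γ x u (Γ x v z)) := by
    intro u v
    have hΓz := (hΓd.hasFDerivAt.clm_apply (hasFDerivAt_const v x)).clm_apply
      (hasFDerivAt_const z x)
    have h3 : HasFDerivAt (fun y => fderiv ℝ θ y v z) _ x :=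
      (hθd.hasFDerivAt.clm_apply hΓz).congr_of_eventuallyEq (by
      filter_upwards [hs.mem_nhds hx] with y hy using hpar y hy v z)
    have h4 := (hθ'd.hasFDerivAt.clm_apply (hasFDerivAt_const v x)).clm_apply
      (hasFDerivAt_const z x)
    have h5 := congrArg (fun T => T u) (h4.unique h3)
    simp only [ContinuousLinearMap.comp_zero, zero_add, ContinuousLinearMap.flip_apply,
      _root_.add_apply, ContinuousLinearMap.comp_apply] at h5
    rw [h5, hpar x hx]
  have h1 := key u v
  rw [hsymm u v, key v u] at h1
  simp only [curvature, map_sub, map_add]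
  rw [← sub_eq_zero] at h1
  rw [← neg_eq_zero, ← h1]
  abel

end CurvatureIdentities

section Algebra

variable {E : Type*} [NormedAddCommGroup E] [NormedSpace ℝ E]

/-- A positive definite form is non-degenerate. -/
lemma eq_of_forall_inner_eq {g : E →L[ℝ] E →L[ℝ] ℝ} (hpos : ∀ u, u ≠ 0 → 0 < g u u) {u v : E}
    (huv : ∀ z, g u z = g v z) : u = v := by
  by_contra hne
  have := hpos _ (sub_ne_zero.2 hne)
  rw [(isLinearMap_clm_apply g (u - v)).map_sub, huv, sub_self] at this
  exact this.ne' rfl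

/-- An algebraic curvature tensor with vanishing sectional curvatures is zero. -/
lemma eq_zero_of_sectional_eq_zero {g : E →L[ℝ] E →L[ℝ] ℝ} (hpos : ∀ u, u ≠ 0 → 0 < g u u)
    {R : E → E → E → E} (hR : IsTrilinear R) (hswap : ∀ u v z, R u v z = -R v u z)
    (hskew : ∀ u v a b, g (R u v a) b + g (R u v b) a = 0)
    (hbianchi : ∀ u v z, R u v z + R v z u + R z u v = 0)
    (hsec : ∀ u v, g (R u v v) u = 0) (u v z : E) : R u v z = 0 := by
  obtain ⟨T, hT⟩ : ∃ T : E → E → E → E → ℝ, ∀ u v z t, T u v z t = g (R u v z) t := ⟨_, fun _ _ _ _ => rfl⟩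
  have h1 : ∀ u v z t, T u v z t = -T v u z t := fun u v z t => by
    rw [hT, hT, hswap, map_neg]; rfl
  have h2 : ∀ u v z t, T u v z t = -T u v t z := fun u v z t => by
    rw [hT, hT]; linarith [hskew u v z t]
  have h3 : ∀ u v z t, T u v z t + T v z u t + T z u v t = 0 := fun u v z t => by
    have := congrArg (fun p => g p t) (hbianchi u v z)
    simp only [(isLinearMap_clm_apply g t).map_add, (isLinearMap_clm_apply g t).map_zero] at this
    simp only [hT, this]
  have h4 : ∀ u v, T u v v u = 0 := fun u v => by rw [hT, hsec]
  have a1 : ∀ u u' v z t, T (u + u') v z t = T u v z t + T u' v z t := fun u u' v z t => by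
    simp only [hT, (hR.fst v z).map_add, (isLinearMap_clm_apply g t).map_add]
  have a2 : ∀ u v v' z t, T u (v + v') z t = T u v z t + T u v' z t := fun u v v' z t => by
    simp only [hT, (hR.snd u z).map_add, (isLinearMap_clm_apply g t).map_add]
  have a3 : ∀ u v z z' t, T u v (z + z') t = T u v z t + T u v z' t := fun u v z z' t => by
    simp only [hT, (hR.trd u v).map_add, (isLinearMap_clm_apply g t).map_add]
  have a4 : ∀ u v z t t', T u v z (t + t') = T u v z t + T u v z t' := fun u v z t t' => by
    simp only [hT, map_add]
  have hpair : ∀ u v z t, T u v z t = T z t u v := fun u v z t => by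
    linarith [h3 u v z t, h3 v z t u, h3 z t u v, h3 t u v z, h1 u v z t, h1 v z u t, h1 z u v t,
      h1 v z t u, h1 z t v u, h1 t v z u, h1 z t u v, h1 t u z v, h1 u z t v, h1 t u v z,
      h1 u v t z, h1 v t u z, h2 u v z t, h2 v z u t, h2 z u v t,
      h2 v z t u, h2 z t v u, h2 t v z u, h2 z t u v, h2 t u z v, h2 u z t v, h2 t u v z,
      h2 u v t z, h2 v t u z]
  have h5 : ∀ u v t, T u v v t = 0 := fun u v t => by
    have h := h4 (u + t) v
    rw [a1, a4, a4] at h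
    linarith [h4 u v, h4 t v, hpair t v v u, h1 v u t v, h2 u v t v]
  have h6 : ∀ u v z t, T u v z t = -T u z v t := fun u v z t => by
    have h := h5 u (v + z) t
    rw [a2, a3, a3] at h
    linarith [h5 u v t, h5 u z t]
  refine eq_of_forall_inner_eq hpos fun t => ?_
  rw [map_zero, ← hT]
  change T u v z t = 0
  linarith [h3 u v z t, h6 v z u t, h1 v u z t, h1 z u v t, h6 u z v t]

/-- Values at `g w y = 0` of an identity known for `g w y > 0`. -/
lemma eq_of_eq_of_pos {X : Type*} [TopologicalSpace X] [T2Space X] {l : E →L[ℝ] ℝ} {w : E}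
    (hw : 0 < l w) {f f' : E → X} (hf : Continuous f) (hf' : Continuous f')
    (H : ∀ y, 0 < l y → f y = f' y) {y : E} (hy : 0 ≤ l y) : f y = f' y := by
  have hc : Continuous fun t : ℝ => y + t • w := by fun_prop
  have h1 : Filter.Tendsto (fun t : ℝ => f (y + t • w)) (nhdsWithin 0 (Set.Ioi 0)) (nhds (f y)) := by
    have := (hf.comp hc).tendsto 0
    simp only [Function.comp, zero_smul, add_zero] at this
    exact this.mono_left nhdsWithin_le_nhds
  have h2 : Filter.Tendsto (fun t : ℝ => f' (y + t • w)) (nhdsWithin 0 (Set.Ioi 0))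
      (nhds (f' y)) := by
    have := (hf'.comp hc).tendsto 0
    simp only [Function.comp, zero_smul, add_zero] at this
    exact this.mono_left nhdsWithin_le_nhds
  refine tendsto_nhds_unique h1 (h2.congr' ?_)
  filter_upwards [self_mem_nhdsWithin] with t ht
  refine (H _ ?_).symm
  rw [map_add, map_smul, smul_eq_mul]
  have := mul_pos ht hw
  linarith

/-- The pointwise consequences of the projective flatness equation of a Kropina metric. Here `B`
stands for the Christoffel symbols, `S` for the covariant derivative of the one-form dual to the
unit Killing field `w`. Pairing the equation with `w` and letting `y` tend to `w^⊥`, where the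
factor `g w y` vanishes, yields `g w (B u u) = 0` for `u ⊥ w`, and then `S = 0`. -/
lemma algebra_of_projectively_flat {g : E →L[ℝ] E →L[ℝ] ℝ} (hsymm : ∀ u v, g u v = g v u)
    (hpos : ∀ u, u ≠ 0 → 0 < g u u) {w : E} (hw : g w w = 1) {B : E →L[ℝ] E →L[ℝ] E}
    (hB : ∀ u v, B u v = B v u) {S : E →L[ℝ] E →L[ℝ] ℝ} (hS : ∀ u v, S u v = -S v u)
    (hSw : ∀ u, S u w = 0)
    (H : ∀ y, 0 < g w y → ∀ z, (g w y) ^ 2 * g (B y y) z -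
      g w y * (g y z * g w (B y y) + g (B y y) y * g w z + g y y * S y z) +
        g y y * g w z * g w (B y y) = 0) :
    (∀ u v, S u v = 0) ∧ ∃ P : E →L[ℝ] ℝ, ∀ u v, B u v = P u • v + P v • u := by
  have hw0 : 0 < g w w := by rw [hw]; exact one_pos
  -- `H` for `z = w`, extended by continuity to `g w y = 0`
  have H1 : ∀ y, 0 < g w y → g y y * g w (B y y) = g w y * g (B y y) y := by
    intro y hy
    have h := H y hy w
    rw [hSw, hw, hsymm y w, hsymm (B y y) w] at h
    linarith
  have H1' : ∀ y, 0 ≤ g w y → g y y * g w (B y y) = g w y * g (B y y) y := fun y hy =>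
    eq_of_eq_of_pos (f := fun y => g y y * g w (B y y)) (f' := fun y => g w y * g (B y y) y)
      hw0 (by fun_prop) (by fun_prop) H1 hy
  -- by `H1` the terms of `H` with the factor `g w z` cancel
  have H2 : ∀ z y, 0 < g w y → g w y * g (B y y) z = g y z * g w (B y y) + g y y * S y z := by
    intro z y hy
    have h := H y hy z
    have h1 := H1 y hy
    have h2 : g w y * (g w y * g (B y y) z) =
        g w y * (g y z * g w (B y y) + g y y * S y z) := by
      linear_combination h - g w z * h1
    exact mul_left_cancel₀ hy.ne' h2
  have H2' : ∀ z y, 0 ≤ g w y → g w y * g (B y y) z = g y z * g w (B y y) + g y y * S y z :=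
    fun z y hy => eq_of_eq_of_pos (f := fun y => g w y * g (B y y) z)
      (f' := fun y => g y z * g w (B y y) + g y y * S y z) hw0 (by fun_prop) (by fun_prop)
      (H2 z) hy
  have H3 : ∀ u, g w u = 0 → g w (B u u) = 0 := by
    intro u hu
    by_cases h0 : u = 0
    · simp [h0]
    · have h := H1' u hu.ge
      rw [hu, zero_mul] at h
      exact (mul_eq_zero.1 h).resolve_left (hpos u h0).ne'
  have H4 : ∀ u, g w u = 0 → ∀ z, S u z = 0 := by
    intro u hu z
    by_cases h0 : u = 0
    · simp [h0]
    · have h := H2' z u hu.ge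
      rw [hu, H3 u hu, zero_mul, mul_zero, zero_add] at h
      exact (mul_eq_zero.1 h.symm).resolve_left (hpos u h0).ne'
  have hperp : ∀ y, g w (y - g w y • w) = 0 := fun y => by
    rw [map_sub, map_smul, hw, smul_eq_mul, mul_one, sub_self]
  have H5 : ∀ u v, S u v = 0 := by
    intro u v
    have h := H4 _ (hperp u) v
    rw [(isLinearMap_clm_apply S v).map_sub, (isLinearMap_clm_apply S v).map_smul, hS w v, hSw,
      neg_zero, smul_zero, sub_zero] at h
    exact h
  refine ⟨H5, (g w).comp (B w) - ((1 / 2) * g w (B w w)) • g w, ?_⟩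
  -- `g w (B u u) = 0` for `u ⊥ w` says that `g w y` divides `g w (B y y)`, with quotient `2 P`
  set P : E →L[ℝ] ℝ := (g w).comp (B w) - ((1 / 2) * g w (B w w)) • g w with hP
  have hPy : ∀ y, P y = g w (B w y) - (1 / 2) * g w (B w w) * g w y := fun y => rfl
  have H6 : ∀ y, g w (B y y) = 2 * g w y * P y := by
    intro y
    have h := H3 _ (hperp y)
    simp only [map_sub, map_smul, _root_.sub_apply, _root_.smul_apply, smul_eq_mul] at h
    rw [hB y w] at h
    rw [hPy]
    linear_combination h
  have H7 : ∀ y, 0 < g w y → B y y = (2 * P y) • y := by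
    intro y hy
    refine eq_of_forall_inner_eq hpos fun z => ?_
    have h := H2 z y hy
    rw [H5, mul_zero, add_zero, H6] at h
    rw [(isLinearMap_clm_apply g z).map_smul, smul_eq_mul]
    refine mul_left_cancel₀ hy.ne' ?_
    linear_combination h
  have H8 : ∀ y, B y y = (2 * P y) • y := by
    intro y
    rcases le_total 0 (g w y) with hy | hy
    · exact eq_of_eq_of_pos (f := fun y => B y y) (f' := fun y => (2 * P y) • y) hw0
        (by fun_prop) (by fun_prop) H7 hy
    · have := eq_of_eq_of_pos (f := fun y => B y y) (f' := fun y => (2 * P y) • y) hw0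
        (by fun_prop) (by fun_prop) H7 (y := -y) (by rw [map_neg]; linarith)
      simpa using this
  intro u v
  have h := H8 (u + v)
  simp only [map_add, _root_.add_apply, H8 u, H8 v, hB v u] at h
  have h2 : (2 : ℝ) • B u v = (2 : ℝ) • (P u • v + P v • u) := by
    have h3 : (2 * P u) • u + B u v + (B u v + (2 * P v) • v) - (2 * (P u + P v)) • (u + v) = 0 :=
      sub_eq_zero.2 h
    rw [← sub_eq_zero, ← h3]
    module
  exact smul_right_injective E two_ne_zero h2

/-- The tensor `Q` determining the curvature of a projectively flat connection vanishes if the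
curvature annihilates a unit vector `w` and is skew-symmetric, in dimension at least two. -/
lemma eq_zero_of_skew_of_annihilates {g Q : E →L[ℝ] E →L[ℝ] ℝ} (hsymm : ∀ u v, g u v = g v u)
    {w X : E} (hw : g w w = 1) (hX : g w X = 0) (hXX : 0 < g X X)
    (hpos : ∀ u, u ≠ 0 → 0 < g u u)
    (H1 : ∀ u v z, (Q u v - Q v u) * g w z + Q u z * g w v - Q v z * g w u = 0)
    (H2 : ∀ u v z, (Q u v - Q v u) * g z z + Q u z * g v z - Q v z * g u z = 0) (u v : E) :
    Q u v = 0 := by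
  have h1 : ∀ u, g w u = 0 → Q u w = 0 ∧ Q w u = 0 := by
    intro u hu
    by_cases h0 : u = 0
    · simp [h0]
    have e1 := H1 u w w
    rw [hw, hu] at e1
    have e2 := H2 u w u
    rw [hu] at e2
    have hq : Q u w - Q w u - Q w u = 0 := by
      refine mul_right_cancel₀ (hpos u h0).ne' ?_
      linear_combination e2
    constructor <;> linarith
  have h2 : ∀ u z, g w u = 0 → g w z = 0 → Q u z = 0 := by
    intro u z hu hz
    have e1 := H1 u w z
    rw [hw, hu, hz] at e1
    linarith
  -- the one place where a nonzero vector orthogonal to `w` is needed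
  have h3 : Q w w = 0 := by
    have e2 := H2 X w (X + w)
    simp only [map_add, _root_.add_apply, hsymm X w, hX, hw, (h1 X hX).1, (h1 X hX).2,
      h2 X X hX hX] at e2
    have : Q w w * g X X = 0 := by linear_combination -e2
    exact (mul_eq_zero.1 this).resolve_right hXX.ne'
  have hperp : ∀ y, g w (y - g w y • w) = 0 := fun y => by
    rw [map_sub, map_smul, hw, smul_eq_mul, mul_one, sub_self]
  have e := h2 _ _ (hperp u) (hperp v)
  have e1 := (h1 _ (hperp u)).1
  have e2 := (h1 _ (hperp v)).2
  simp only [map_sub, map_smul, _root_.sub_apply, _root_.smul_apply, smul_eq_mul, h3] at e e1 e2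
  linear_combination e + g w v * e1 + g w u * e2

/-- A connection whose Christoffel symbols are `P(u) v + P(v) u` has the straight lines as its
geodesics; this is its curvature. -/
lemma curvature_of_projective {Γ : E → E →L[ℝ] E →L[ℝ] E} {P : E → E →L[ℝ] ℝ} {s : Set E}
    (hs : IsOpen s) (hΓ : ContDiffOn ℝ ∞ Γ s) {x : E} (hx : x ∈ s)
    (hP : DifferentiableAt ℝ P x)
    (H : ∀ y ∈ s, ∀ u v, Γ y u v = P y u • v + P y v • u) (u v z : E) :
    curvature Γ x u v z =
      ((fderiv ℝ P x u v - P x u * P x v) - (fderiv ℝ P x v u - P x v * P x u)) • z +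
      (fderiv ℝ P x u z - P x u * P x z) • v - (fderiv ℝ P x v z - P x v * P x z) • u := by
  have hΓd : DifferentiableAt ℝ Γ x := (hΓ.contDiffAt (hs.mem_nhds hx)).differentiableAt (by simp)
  have hD : ∀ u v z, fderiv ℝ Γ x u v z = fderiv ℝ P x u v • z + fderiv ℝ P x u z • v := by
    intro u v z
    have h1 : ∀ a b : E, HasFDerivAt (fun y => P y a • b) _ x := fun a b =>
      (hP.hasFDerivAt.clm_apply (hasFDerivAt_const a x)).smul (hasFDerivAt_const b x)
    have h2 : HasFDerivAt (fun y => Γ y v z) _ x := ((h1 v z).add (h1 z v)).congr_of_eventuallyEq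
      (by filter_upwards [hs.mem_nhds hx] with y hy using H y hy v z)
    have h3 := (hΓd.hasFDerivAt.clm_apply (hasFDerivAt_const v x)).clm_apply
      (hasFDerivAt_const z x)
    have h5 := congrArg (fun T => T u) (h3.unique h2)
    simpa using h5
  simp only [curvature, hD, H x hx, map_add, map_smul, smul_add, smul_eq_mul]
  module

end Algebra

/-! ### The Frobenius theorem for linear systems -/

section Frobenius

variable {E F : Type*} [NormedAddCommGroup E] [NormedSpace ℝ E] [NormedAddCommGroup F]
  [NormedSpace ℝ F]

/-- The growth factor in the Grönwall estimates on `[0, 1]`. -/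
lemma exp_half_mul_le_two {t : ℝ} (ht : t ∈ Set.Icc (0 : ℝ) 1) : Real.exp (1 / 2 * t) ≤ 2 := by
  have h1 : Real.exp (1 / 2 * t) ≤ Real.exp (1 / 2) :=
    Real.exp_le_exp.2 (by linarith [ht.2])
  have h2 : Real.exp (1 / 2) * Real.exp (1 / 2) = Real.exp 1 := by
    rw [← Real.exp_add]; norm_num
  nlinarith [Real.exp_one_lt_d9, Real.exp_pos (1 / 2)]

/-- Grönwall's inequality on `[0, 1]` with Lipschitz constant `1 / 2` and zero initial value. -/
lemma norm_le_two_mul_of_deriv_le {f f' : ℝ → F} {ε : ℝ} (hε : 0 ≤ ε) (h0 : f 0 = 0)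
    (hf : ∀ t ∈ Set.Icc (0 : ℝ) 1, HasDerivWithinAt f (f' t) (Set.Icc 0 1) t)
    (hb : ∀ t ∈ Set.Icc (0 : ℝ) 1, ‖f' t‖ ≤ 1 / 2 * ‖f t‖ + ε) :
    ∀ t ∈ Set.Icc (0 : ℝ) 1, ‖f t‖ ≤ 2 * ε := by
  intro t ht
  have h := norm_le_gronwallBound_of_norm_deriv_right_le (δ := 0) (K := 1 / 2) (ε := ε)
    (fun t ht => (hf t ht).continuousWithinAt)
    (fun t ht => (hf t (Set.Ico_subset_Icc_self ht)).mono_of_mem_nhdsWithin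
      (Icc_mem_nhdsGE_of_mem ht)) (by simp [h0])
    (fun t ht => hb t (Set.Ico_subset_Icc_self ht)) t ht
  rw [gronwallBound_of_K_ne_0 (by norm_num)] at h
  rw [sub_zero] at h
  have := exp_half_mul_le_two ht
  nlinarith

/-- Linear differential equations with small coefficients are solvable on `[0, 1]`. -/
lemma exists_linear_ode_solution [CompleteSpace F] {a : ℝ → F →L[ℝ] F}
    (ha : ContinuousOn a (Set.Icc 0 1)) (hb : ∀ t ∈ Set.Icc (0 : ℝ) 1, ‖a t‖ ≤ 1 / 2) (u₀ : F) :
    ∃ u : ℝ → F, u 0 = u₀ ∧ (∀ t ∈ Set.Icc (0 : ℝ) 1,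
      HasDerivWithinAt u (a t (u t)) (Set.Icc 0 1) t) ∧
      ∀ t ∈ Set.Icc (0 : ℝ) 1, ‖u t‖ ≤ 2 * ‖u₀‖ := by
  have hP : IsPicardLindelof (fun t x => a t x) (tmin := 0) (tmax := 1)
      ⟨0, by simp⟩ u₀ (‖u₀‖₊ + 1) 0 (‖u₀‖₊ + 1) (1 / 2) := by
    refine ⟨fun t ht => ?_, fun x _ => ?_, fun t ht x hx => ?_, ?_⟩
    · refine ((a t).lipschitz.weaken ?_).lipschitzOnWith
      have := hb t ht
      rw [← NNReal.coe_le_coe]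
      simpa using this
    · exact ha.clm_apply continuousOn_const
    · have h1 : ‖x‖ ≤ ‖u₀‖ + (‖u₀‖ + 1) := by
        have h2 := norm_le_norm_add_norm_sub u₀ x
        rw [Metric.mem_closedBall, dist_eq_norm, norm_sub_rev] at hx
        simp only [NNReal.coe_add, coe_nnnorm, NNReal.coe_one] at hx
        linarith
      have h2 := (a t).le_opNorm x
      have h3 := hb t ht
      simp only [NNReal.coe_add, coe_nnnorm, NNReal.coe_one]
      nlinarith [norm_nonneg x, norm_nonneg u₀, norm_nonneg (a t)]
    · simp
  obtain ⟨u, hu0, hu⟩ := hP.exists_eq_forall_mem_Icc_hasDerivWithinAt₀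
  refine ⟨u, hu0, hu, fun t ht => ?_⟩
  have h := norm_le_gronwallBound_of_norm_deriv_right_le (δ := ‖u₀‖) (K := 1 / 2) (ε := 0)
    (fun t ht => (hu t ht).continuousWithinAt)
    (fun t ht => (hu t (Set.Ico_subset_Icc_self ht)).mono_of_mem_nhdsWithin
      (Icc_mem_nhdsGE_of_mem ht)) (by rw [show u 0 = u₀ from hu0])
    (fun t ht => by
      have h2 := (a t).le_opNorm (u t)
      have h3 := hb t (Set.Ico_subset_Icc_self ht)
      have := mul_le_mul_of_nonneg_right h3 (norm_nonneg (u t))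
      linarith) t ht
  rw [gronwallBound_ε0, sub_zero] at h
  have := exp_half_mul_le_two ht
  nlinarith [norm_nonneg u₀]

/-- Near a point, a smooth map satisfies uniform bounds of order zero, one and two. -/
lemma exists_taylor_bounds {G : Type*} [NormedAddCommGroup G] [NormedSpace ℝ G] {A : E → G}
    {s : Set E} (hs : IsOpen s) (hA : ContDiffOn ℝ ∞ A s) {x₀ : E} (hx₀ : x₀ ∈ s) :
    ∃ r > 0, ∃ K : ℝ, 0 ≤ K ∧ Metric.ball x₀ r ⊆ s ∧
      (∀ p ∈ Metric.ball x₀ r, ‖A p‖ ≤ K) ∧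
      (∀ p ∈ Metric.ball x₀ r, ∀ q ∈ Metric.ball x₀ r, ‖A q - A p‖ ≤ K * ‖q - p‖) ∧
      (∀ p ∈ Metric.ball x₀ r, ∀ q ∈ Metric.ball x₀ r,
        ‖A q - A p - fderiv ℝ A p (q - p)‖ ≤ K * ‖q - p‖ ^ 2) := by
  have hAx : ContDiffAt ℝ ∞ A x₀ := hA.contDiffAt (hs.mem_nhds hx₀)
  obtain ⟨K₁, t₁, ht₁, hK₁⟩ := (hAx.of_le (m := 1) (by simp)).exists_lipschitzOnWith
  have hAx' : ContDiffAt ℝ ∞ (fderiv ℝ A) x₀ := hAx.fderiv_right (m := ∞) (by simp)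
  obtain ⟨K₂, t₂, ht₂, hK₂⟩ := (hAx'.of_le (m := 1) (by simp)).exists_lipschitzOnWith
  have hc : ∀ᶠ p in nhds x₀, ‖A p‖ < ‖A x₀‖ + 1 :=
    hAx.continuousAt.norm.eventually_lt continuousAt_const (by linarith)
  obtain ⟨r, hr, hball⟩ := Metric.mem_nhds_iff.1
    (Filter.inter_mem (Filter.inter_mem (Filter.inter_mem ht₁ ht₂) hc) (hs.mem_nhds hx₀))
  refine ⟨r, hr, max (max K₁ K₂) (‖A x₀‖ + 1), le_max_of_le_right (by positivity),
    fun p hp => (hball hp).2, fun p hp => ?_, fun p hp q hq => ?_, fun p hp q hq => ?_⟩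
  · exact (le_of_lt (hball hp).1.2).trans (le_max_right _ _)
  · have := hK₁.norm_sub_le (hball hq).1.1.1 (hball hp).1.1.1
    refine this.trans (mul_le_mul_of_nonneg_right ?_ (norm_nonneg _))
    exact (le_max_left _ _).trans (le_max_left _ _)
  · have hseg : segment ℝ p q ⊆ Metric.ball x₀ r := (convex_ball x₀ r).segment_subset hp hq
    have h1 := (convex_segment p q).norm_image_sub_le_of_norm_hasFDerivWithin_le'
      (f := A) (f' := fderiv ℝ A) (φ := fderiv ℝ A p) (C := K₂ * ‖q - p‖) (fun z hz =>
        ((hA.contDiffAt (hs.mem_nhds (hball (hseg hz)).2)).differentiableAt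
          (by simp)).hasFDerivAt.hasFDerivWithinAt) (fun z hz => by
        refine (hK₂.norm_sub_le (hball (hseg hz)).1.1.2 (hball hp).1.1.2).trans ?_
        refine mul_le_mul_of_nonneg_left ?_ K₂.2
        obtain ⟨θ, hθ, rfl⟩ := (segment_eq_image' ℝ p q ▸ hz :)
        rw [add_sub_cancel_left, norm_smul, Real.norm_of_nonneg hθ.1]
        exact mul_le_of_le_one_left (norm_nonneg _) hθ.2)
      (left_mem_segment ℝ p q) (right_mem_segment ℝ p q)
    refine h1.trans ?_
    rw [mul_assoc, ← sq]
    refine mul_le_mul_of_nonneg_right ?_ (sq_nonneg _)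
    exact (le_max_right _ _).trans (le_max_left _ _)

lemma hasDerivAt_comp_line {G : Type*} [NormedAddCommGroup G] [NormedSpace ℝ G] {A : E → G}
    {x y : E} {t : ℝ} (hA : DifferentiableAt ℝ A (x + t • y)) :
    HasDerivAt (fun t : ℝ => A (x + t • y)) (fderiv ℝ A (x + t • y) y) t := by
  have h : HasDerivAt (fun t : ℝ => x + t • y) y t := by
    simpa using ((hasDerivAt_id t).smul_const y).const_add x
  exact hA.hasFDerivAt.comp_hasDerivAt t h

lemma hasFDerivAt_clm_sub (L : E →L[ℝ] F) (p x : E) : HasFDerivAt (fun z => L (z - p)) L x := by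
  simp only [map_sub]
  exact L.hasFDerivAt.sub_const (L p)

/-- Comparison of the solutions `u`, `w` of two linear equations with coefficients `α`, `β` that
are close to each other. If `t γ u` solves the linearized equation, then it is the first order
part of `w - u`. -/
lemma norm_sub_sub_le_of_linearized {α β γ γ' κ : ℝ → F →L[ℝ] F} {u w : ℝ → F} {a b c : ℝ}
    (ha : 0 ≤ a) (hb : 0 ≤ b) (hc : 0 ≤ c) (h0 : w 0 = u 0)
    (hu : ∀ t ∈ Set.Icc (0 : ℝ) 1, HasDerivWithinAt u (α t (u t)) (Set.Icc 0 1) t)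
    (hw : ∀ t ∈ Set.Icc (0 : ℝ) 1, HasDerivWithinAt w (β t (w t)) (Set.Icc 0 1) t)
    (hγ : ∀ t ∈ Set.Icc (0 : ℝ) 1, HasDerivWithinAt γ (γ' t) (Set.Icc 0 1) t)
    (hint : ∀ t ∈ Set.Icc (0 : ℝ) 1, ∀ f, γ' t f + γ t (α t f) = κ t f + α t (γ t f))
    (hα : ∀ t ∈ Set.Icc (0 : ℝ) 1, ‖α t‖ ≤ 1 / 2)
    (hβ : ∀ t ∈ Set.Icc (0 : ℝ) 1, ‖β t - α t‖ ≤ a)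
    (hκ : ∀ t ∈ Set.Icc (0 : ℝ) 1, ‖β t - α t - γ t - t • κ t‖ ≤ b)
    (huc : ∀ t ∈ Set.Icc (0 : ℝ) 1, ‖u t‖ ≤ c) (hwc : ∀ t ∈ Set.Icc (0 : ℝ) 1, ‖w t‖ ≤ c) :
    ‖w 1 - u 1 - γ 1 (u 1)‖ ≤ 2 * (b * c + a * (2 * (a * c))) := by
  have hd : ∀ t ∈ Set.Icc (0 : ℝ) 1, ‖w t - u t‖ ≤ 2 * (a * c) := by
    refine norm_le_two_mul_of_deriv_le (f := fun t => w t - u t) (by positivity)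
      (by simp [h0]) (fun t ht => (hw t ht).sub (hu t ht)) fun t ht => ?_
    have e : β t (w t) - α t (u t) = α t (w t - u t) + (β t - α t) (w t) := by
      rw [_root_.sub_apply, map_sub]; abel
    rw [e]
    refine (norm_add_le _ _).trans (add_le_add ((α t).le_of_opNorm_le (hα t ht) _) ?_)
    exact ((β t - α t).le_of_opNorm_le (hβ t ht) _).trans
      (mul_le_mul_of_nonneg_left (hwc t ht) ha)
  have hfin := norm_le_two_mul_of_deriv_le (f := fun t => w t - u t - t • γ t (u t))
    (f' := fun t => β t (w t) - α t (u t) -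
      (t • (γ' t (u t) + γ t (α t (u t))) + (1 : ℝ) • γ t (u t)))
    (ε := b * c + a * (2 * (a * c))) (by positivity) (by simp [h0])
    (fun t ht => ((hw t ht).sub (hu t ht)).sub
      ((hasDerivWithinAt_id t _).smul ((hγ t ht).clm_apply (hu t ht))))
    (fun t ht => ?_) 1 (by simp)
  · simpa using hfin
  · have e : β t (w t) - α t (u t) - (t • (γ' t (u t) + γ t (α t (u t))) + (1 : ℝ) • γ t (u t)) =
        α t (w t - u t - t • γ t (u t)) +
          ((β t - α t - γ t - t • κ t) (u t) + (β t - α t) (w t - u t)) := by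
      rw [hint t ht]
      simp only [_root_.sub_apply, map_sub, map_smul, _root_.smul_apply, smul_add, one_smul]
      abel
    rw [e]
    refine (norm_add_le _ _).trans (add_le_add ((α t).le_of_opNorm_le (hα t ht) _) ?_)
    refine (norm_add_le _ _).trans (add_le_add ?_ ?_)
    · exact (ContinuousLinearMap.le_of_opNorm_le _ (hκ t ht) _).trans
        (mul_le_mul_of_nonneg_left (huc t ht) hb)
    · exact ((β t - α t).le_of_opNorm_le (hβ t ht) _).trans
        (mul_le_mul_of_nonneg_left (hd t ht) ha)

set_option maxHeartbeats 1000000 in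
/-- **Frobenius theorem** for linear systems `dU(v) = A(v) U`. The candidate solution is obtained
by solving the system along rays. The difference of the solutions along two neighbouring rays
agrees to first order with `t A(v) U`: by integrability, the two sides satisfy the same
linearized equation up to a quadratic error, and Grönwall's inequality applies. -/
theorem exists_frobenius_solution [CompleteSpace F] {A : E → E →L[ℝ] F →L[ℝ] F} {s : Set E}
    (hs : IsOpen s) (hA : ContDiffOn ℝ ∞ A s)
    (hint : ∀ x ∈ s, ∀ v w f, fderiv ℝ A x v w f + A x w (A x v f) =
      fderiv ℝ A x w v f + A x v (A x w f)) {x₀ : E} (hx₀ : x₀ ∈ s) :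
    ∃ r > 0, Metric.ball x₀ r ⊆ s ∧ ∀ u₀ : F, ∃ U : E → F, U x₀ = u₀ ∧
      ∀ x ∈ Metric.ball x₀ r, HasFDerivAt U ((A x).flip (U x)) x := by
  obtain ⟨r₀, hr₀, K, hK, hball, hA0, hA1, hA2⟩ := exists_taylor_bounds hs hA hx₀
  obtain ⟨r, hr, hrr₀, hr1, hKr⟩ : ∃ r > 0, r ≤ r₀ ∧ r ≤ 1 ∧ K * r ≤ 1 / 2 := by
    refine ⟨min (min r₀ 1) (1 / (2 * (K + 1))), by positivity, ?_, ?_, ?_⟩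
    · exact (min_le_left _ _).trans (min_le_left _ _)
    · exact (min_le_left _ _).trans (min_le_right _ _)
    · have h1 := min_le_right (min r₀ 1) (1 / (2 * (K + 1)))
      have h2 := mul_le_mul_of_nonneg_left h1 hK
      refine h2.trans ?_
      rw [mul_one_div, div_le_div_iff₀ (by positivity) (by norm_num)]
      linarith
  have hsub : Metric.ball x₀ r ⊆ Metric.ball x₀ r₀ := Metric.ball_subset_ball hrr₀
  refine ⟨r, hr, hsub.trans hball, fun u₀ => ?_⟩
  have hray : ∀ y : E, ‖y‖ < r → ∀ t ∈ Set.Icc (0 : ℝ) 1, x₀ + t • y ∈ Metric.ball x₀ r₀ := by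
    intro y hy t ht
    rw [mem_ball_iff_norm, add_sub_cancel_left, norm_smul, Real.norm_of_nonneg ht.1]
    exact (mul_le_of_le_one_left (norm_nonneg _) ht.2).trans_lt (hy.trans_le hrr₀)
  have hAd : ∀ p ∈ Metric.ball x₀ r₀, DifferentiableAt ℝ A p := fun p hp =>
    (hA.contDiffAt (hs.mem_nhds (hball hp))).differentiableAt (by simp)
  have hline : ∀ y v : E, ‖y‖ < r → ∀ t ∈ Set.Icc (0 : ℝ) 1, HasDerivWithinAt
      (fun t : ℝ => A (x₀ + t • y) v) (fderiv ℝ A (x₀ + t • y) y v) (Set.Icc 0 1) t := by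
    intro y v hy t ht
    have hd := hAd _ (hray y hy t ht)
    have h1 : DifferentiableAt ℝ (fun p => A p v) (x₀ + t • y) :=
      hd.clm_apply (differentiableAt_const v)
    have h2 := (hd.hasFDerivAt.clm_apply (hasFDerivAt_const v _)).fderiv
    have h3 := (hasDerivAt_comp_line h1).hasDerivWithinAt (s := Set.Icc 0 1)
    rw [h2] at h3
    simpa using h3
  have hbound : ∀ y : E, ‖y‖ < r → ∀ t ∈ Set.Icc (0 : ℝ) 1, ∀ v : E,
      ‖A (x₀ + t • y) v‖ ≤ K * ‖v‖ := fun y hy t ht v =>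
    ((A (x₀ + t • y)).le_opNorm v).trans
      (mul_le_mul_of_nonneg_right (hA0 _ (hray y hy t ht)) (norm_nonneg _))
  have hhalf : ∀ y : E, ‖y‖ < r → ∀ t ∈ Set.Icc (0 : ℝ) 1, ‖A (x₀ + t • y) y‖ ≤ 1 / 2 :=
    fun y hy t ht => (hbound y hy t ht y).trans
      ((mul_le_mul_of_nonneg_left hy.le hK).trans hKr)
  have hex : ∀ y : E, ∃ u : ℝ → F, ‖y‖ < r → u 0 = u₀ ∧ (∀ t ∈ Set.Icc (0 : ℝ) 1,
      HasDerivWithinAt u (A (x₀ + t • y) y (u t)) (Set.Icc 0 1) t) ∧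
      ∀ t ∈ Set.Icc (0 : ℝ) 1, ‖u t‖ ≤ 2 * ‖u₀‖ := by
    intro y
    by_cases hy : ‖y‖ < r
    · obtain ⟨u, hu⟩ := exists_linear_ode_solution (a := fun t => A (x₀ + t • y) y)
        (fun t ht => (hline y y hy t ht).continuousWithinAt) (hhalf y hy) u₀
      exact ⟨u, fun _ => hu⟩
    · exact ⟨0, fun h => absurd h hy⟩
  choose u hu using hex
  refine ⟨fun x => u (x - x₀) 1, ?_, fun x hx => ?_⟩
  · obtain ⟨h0, h1, h2⟩ := hu (x₀ - x₀) (by simpa using hr)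
    have h3 := norm_le_two_mul_of_deriv_le (f := fun t => u (x₀ - x₀) t - u₀) (f' := fun _ => 0)
      (ε := 0) le_rfl (by rw [h0, sub_self]) (fun t ht => by
        have := (h1 t ht).sub_const u₀
        simpa using this) (fun t ht => by simp) 1 (by simp)
    simpa [sub_eq_zero] using h3
  · obtain ⟨y, rfl⟩ : ∃ y, x = x₀ + y := ⟨x - x₀, by abel⟩
    have hy : ‖y‖ < r := by simpa [mem_ball_iff_norm] using hx
    obtain ⟨hy0, hy1, hy2⟩ := hu y hy
    set C := 2 * (2 * K * (2 * ‖u₀‖) + 2 * K * (2 * (2 * K * (2 * ‖u₀‖)))) with hC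
    have hest : ∀ v : E, ‖y + v‖ < r →
        ‖u (y + v) 1 - u y 1 - A (x₀ + y) v (u y 1)‖ ≤ C * ‖v‖ ^ 2 := by
      intro v hyv
      obtain ⟨hv0, hv1, hv2⟩ := hu (y + v) hyv
      have hmono : ∀ t ∈ Set.Icc (0 : ℝ) 1, ‖t • v‖ ≤ ‖v‖ := by
        intro t ht
        rw [norm_smul, Real.norm_of_nonneg ht.1]
        exact mul_le_of_le_one_left (norm_nonneg _) ht.2
      have hstep : ∀ t : ℝ, x₀ + t • (y + v) - (x₀ + t • y) = t • v := fun t => by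
        rw [smul_add]; abel
      have hincr : ∀ t ∈ Set.Icc (0 : ℝ) 1, ∀ z : E,
          ‖(A (x₀ + t • (y + v)) - A (x₀ + t • y)) z‖ ≤ K * ‖v‖ * ‖z‖ := by
        intro t ht z
        refine ContinuousLinearMap.le_of_opNorm_le _ ?_ z
        refine (hA1 _ (hray y hy t ht) _ (hray _ hyv t ht)).trans ?_
        rw [hstep]
        exact mul_le_mul_of_nonneg_left (hmono t ht) hK
      have hyv1 : ‖y + v‖ ≤ 1 := hyv.le.trans hr1
      have hy1' : ‖y‖ ≤ 1 := hy.le.trans hr1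
      have hest := norm_sub_sub_le_of_linearized (a := 2 * K * ‖v‖) (b := 2 * K * ‖v‖ ^ 2)
        (c := 2 * ‖u₀‖) (α := fun t => A (x₀ + t • y) y)
        (β := fun t => A (x₀ + t • (y + v)) (y + v)) (γ := fun t => A (x₀ + t • y) v)
        (γ' := fun t => fderiv ℝ A (x₀ + t • y) y v) (κ := fun t => fderiv ℝ A (x₀ + t • y) v y)
        (by positivity) (by positivity) (by positivity) (hv0.trans hy0.symm) hy1 hv1
        (fun t ht => hline y v hy t ht)
        (fun t ht f => hint _ (hball (hray y hy t ht)) y v f) (hhalf y hy)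
        (fun t ht => ?_) (fun t ht => ?_) hy2 hv2
      · rw [one_smul] at hest
        refine hest.trans (le_of_eq ?_)
        rw [hC]; ring
      · have e : A (x₀ + t • (y + v)) (y + v) - A (x₀ + t • y) y =
            (A (x₀ + t • (y + v)) - A (x₀ + t • y)) (y + v) + A (x₀ + t • y) v := by
          rw [_root_.sub_apply, map_add (A (x₀ + t • y))]; abel
        rw [e]
        refine (norm_add_le _ _).trans ?_
        have e1 := hincr t ht (y + v)
        have e2 := hbound y hy t ht v
        have e3 : K * ‖v‖ * ‖y + v‖ ≤ K * ‖v‖ * 1 :=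
          mul_le_mul_of_nonneg_left hyv1 (by positivity)
        linarith
      · have e : A (x₀ + t • (y + v)) (y + v) - A (x₀ + t • y) y - A (x₀ + t • y) v -
            t • fderiv ℝ A (x₀ + t • y) v y =
            (A (x₀ + t • (y + v)) - A (x₀ + t • y) - fderiv ℝ A (x₀ + t • y) (t • v)) y +
              (A (x₀ + t • (y + v)) - A (x₀ + t • y)) v := by
          simp only [_root_.sub_apply, map_add, map_smul, _root_.smul_apply]
          abel
        rw [e]
        have h1 := hA2 _ (hray y hy t ht) _ (hray _ hyv t ht)
        rw [hstep] at h1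
        have h2 : ‖t • v‖ ^ 2 ≤ ‖v‖ ^ 2 :=
          pow_le_pow_left₀ (norm_nonneg _) (hmono t ht) 2
        have h3 := ContinuousLinearMap.le_of_opNorm_le _
          (h1.trans (mul_le_mul_of_nonneg_left h2 hK)) y
        have h4 := hincr t ht v
        have h5 : K * ‖v‖ ^ 2 * ‖y‖ ≤ K * ‖v‖ ^ 2 * 1 :=
          mul_le_mul_of_nonneg_left hy1' (by positivity)
        refine (norm_add_le _ _).trans ?_
        linarith
    obtain ⟨L, hL⟩ : ∃ L : E →L[ℝ] F, L = (A (x₀ + y)).flip (u y 1) := ⟨_, rfl⟩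
    have hLz : ∀ z, A (x₀ + y) z (u y 1) = L z := fun z => by
      rw [hL, ContinuousLinearMap.flip_apply]
    have hO : (fun z => u (z - x₀) 1 - u y 1 - L (z - (x₀ + y))) =O[nhds (x₀ + y)]
        fun z => ‖z - (x₀ + y)‖ ^ 2 := by
      refine Asymptotics.IsBigO.of_bound C ?_
      filter_upwards [Metric.isOpen_ball.mem_nhds hx] with z hz
      have := hest (z - (x₀ + y)) (by
        rw [mem_ball_iff_norm] at hz
        rwa [show y + (z - (x₀ + y)) = z - x₀ by abel])
      rw [show y + (z - (x₀ + y)) = z - x₀ by abel] at this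
      rw [Real.norm_of_nonneg (sq_nonneg _), ← hLz]
      exact this
    have hyy : x₀ + y - x₀ = y := by abel
    have h3 := ((hO.hasFDerivAt (𝕜 := ℝ) (by norm_num)).add
      (hasFDerivAt_clm_sub L (x₀ + y) (x₀ + y))).add_const (u y 1)
    rw [zero_add] at h3
    beta_reduce
    rw [hyy, ← hL]
    refine h3.congr_of_eventuallyEq (Filter.Eventually.of_forall fun z => ?_)
    simp only [Pi.add_apply]
    abel

end Frobenius

/-! ### Flat coordinates -/

section FlatCoordinates

open scoped MatrixOrder in
/-- A positive definite form is the pullback of the Euclidean inner product. The map is obtained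
from a factorization of the Gram matrix. -/
lemma exists_inner_eq {n : ℕ} {g : Coord n →L[ℝ] Coord n →L[ℝ] ℝ} (hsymm : ∀ u v, g u v = g v u)
    (hpos : ∀ u, u ≠ 0 → 0 < g u u) :
    ∃ L : Coord n →L[ℝ] Coord n, ∀ u v, g u v = inner ℝ (L u) (L v) := by
  have hexp : ∀ u v, g u v = ∑ i, ∑ j, u i * v j * g (basisVec i) (basisVec j) := by
    intro u v
    rw [map_eq_sum_basisVec (f := fun u => g u v) (isLinearMap_clm_apply _ _)]
    refine Finset.sum_congr rfl fun i _ => ?_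
    rw [map_eq_sum_basisVec (f := fun v => g (basisVec i) v) (isLinearMap_clm _), Finset.smul_sum]
    exact Finset.sum_congr rfl fun j _ => by simp only [smul_eq_mul]; ring
  have hA : (Matrix.of fun i j : Fin n => g (basisVec i) (basisVec j)).PosSemidef := by
    refine Matrix.PosSemidef.of_dotProduct_mulVec_nonneg ?_ ?_
    · ext i j
      simp [hsymm (basisVec j)]
    · intro v
      have h1 : dotProduct (star v) ((Matrix.of fun i j : Fin n =>
          g (basisVec i) (basisVec j)).mulVec v) = g (WithLp.toLp 2 v) (WithLp.toLp 2 v) := by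
        rw [hexp]
        simp only [dotProduct, Matrix.mulVec, Finset.mul_sum, Matrix.of_apply, star_trivial]
        exact Finset.sum_congr rfl fun i _ => Finset.sum_congr rfl fun j _ => by ring
      rw [h1]
      by_cases h0 : (WithLp.toLp 2 v : Coord n) = 0
      · simp [h0]
      · exact (hpos _ h0).le
  obtain ⟨B, hB⟩ := CStarAlgebra.nonneg_iff_eq_star_mul_self.mp hA.nonneg
  refine ⟨(Matrix.toEuclideanLin B).toContinuousLinearMap, fun u v => ?_⟩
  have hg : ∀ i j, g (basisVec i) (basisVec j) = ∑ k, B k i * B k j := fun i j => by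
    have := congrFun (congrFun hB i) j
    simpa [Matrix.mul_apply] using this
  rw [hexp, PiLp.inner_apply]
  simp only [hg, LinearMap.coe_toContinuousLinearMap', Matrix.toLpLin_apply, Matrix.mulVec,
    dotProduct, RCLike.inner_apply, conj_trivial, Finset.mul_sum, Finset.sum_mul]
  rw [Finset.sum_comm]
  rw [Finset.sum_congr rfl fun j _ => Finset.sum_comm, Finset.sum_comm]
  refine Finset.sum_congr rfl fun k _ => ?_
  rw [Finset.sum_comm]
  refine Finset.sum_congr rfl fun j _ => Finset.sum_congr rfl fun i _ => ?_
  ring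

variable {E : Type*} [NormedAddCommGroup E] [InnerProductSpace ℝ E] [FiniteDimensional ℝ E]

lemma fderiv_apply_apply_apply {F G H : Type*} [NormedAddCommGroup F] [NormedSpace ℝ F]
    [NormedAddCommGroup G] [NormedSpace ℝ G] [NormedAddCommGroup H] [NormedSpace ℝ H]
    {Γ : E → E →L[ℝ] F →L[ℝ] G} {x : E} (hΓ : DifferentiableAt ℝ Γ x) (w : E) :
    HasFDerivAt (fun y => Γ y w) ((fderiv ℝ Γ x).flip w) x := by
  simpa using hΓ.hasFDerivAt.clm_apply (hasFDerivAt_const w x)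

/-- A flat connection has local parallel coframes with prescribed initial value. -/
lemma exists_parallel_coframe {Γ : E → E →L[ℝ] E →L[ℝ] E} {s : Set E} (hs : IsOpen s)
    (hΓ : ContDiffOn ℝ ∞ Γ s) (hR : ∀ x ∈ s, ∀ u v z, curvature Γ x u v z = 0) {x₀ : E}
    (hx₀ : x₀ ∈ s) (L : E →L[ℝ] E) :
    ∃ r > 0, Metric.ball x₀ r ⊆ s ∧ ∃ Θ : E → E →L[ℝ] E, Θ x₀ = L ∧
      ∀ x ∈ Metric.ball x₀ r, DifferentiableAt ℝ Θ x ∧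
        ∀ v, fderiv ℝ Θ x v = (Θ x).comp (Γ x v) := by
  obtain ⟨A, hA⟩ : ∃ A : E → E →L[ℝ] (E →L[ℝ] E) →L[ℝ] (E →L[ℝ] E),
      A = fun x => ((ContinuousLinearMap.compL ℝ E E E).flip).comp (Γ x) := ⟨_, rfl⟩
  have hAapp : ∀ x v f, A x v f = f.comp (Γ x v) := fun x v f => by rw [hA]; rfl
  have hAs : ContDiffOn ℝ ∞ A s := by rw [hA]; exact contDiffOn_const.clm_comp hΓ
  have hd : ∀ x ∈ s, ∀ v w f, fderiv ℝ A x v w f = f.comp (fderiv ℝ Γ x v w) := by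
    intro x hx v w f
    rw [← fderiv_clm_apply_apply ((hAs.contDiffAt (hs.mem_nhds hx)).differentiableAt (by simp))]
    simp only [hAapp]
    have h1 := fderiv_apply_apply_apply (H := ℝ)
      ((hΓ.contDiffAt (hs.mem_nhds hx)).differentiableAt (by simp)) w
    have h2 := ((hasFDerivAt_const f x).clm_comp h1).fderiv
    rw [h2]
    ext z
    simp
  obtain ⟨r, hr, hrs, H⟩ := exists_frobenius_solution hs hAs (fun x hx v w f => by
    rw [hd x hx, hd x hx]
    simp only [hAapp]
    ext z
    have := congrArg f (hR x hx v w z)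
    simp only [curvature, map_zero, map_sub, map_add] at this
    simp only [_root_.add_apply, ContinuousLinearMap.comp_apply]
    rw [← sub_eq_zero, ← this]
    abel) hx₀
  obtain ⟨Θ, hΘ0, hΘ⟩ := H L
  refine ⟨r, hr, hrs, Θ, hΘ0, fun x hx => ⟨(hΘ x hx).differentiableAt, fun v => ?_⟩⟩
  rw [(hΘ x hx).fderiv, ContinuousLinearMap.flip_apply, hAapp]

/-- A flat connection has local parallel frames with prescribed initial value. -/
lemma exists_parallel_frame {Γ : E → E →L[ℝ] E →L[ℝ] E} {s : Set E} (hs : IsOpen s)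
    (hΓ : ContDiffOn ℝ ∞ Γ s) (hR : ∀ x ∈ s, ∀ u v z, curvature Γ x u v z = 0) {x₀ : E}
    (hx₀ : x₀ ∈ s) (L : E →L[ℝ] E) :
    ∃ r > 0, Metric.ball x₀ r ⊆ s ∧ ∃ Y : E → E →L[ℝ] E, Y x₀ = L ∧
      ∀ x ∈ Metric.ball x₀ r, DifferentiableAt ℝ Y x ∧
        ∀ v, fderiv ℝ Y x v = -(Γ x v).comp (Y x) := by
  obtain ⟨A, hA⟩ : ∃ A : E → E →L[ℝ] (E →L[ℝ] E) →L[ℝ] (E →L[ℝ] E),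
      A = fun x => (-ContinuousLinearMap.compL ℝ E E E).comp (Γ x) := ⟨_, rfl⟩
  have hAapp : ∀ x v f, A x v f = -(Γ x v).comp f := fun x v f => by rw [hA]; rfl
  have hAs : ContDiffOn ℝ ∞ A s := by rw [hA]; exact contDiffOn_const.clm_comp hΓ
  have hd : ∀ x ∈ s, ∀ v w f, fderiv ℝ A x v w f = -(fderiv ℝ Γ x v w).comp f := by
    intro x hx v w f
    rw [← fderiv_clm_apply_apply ((hAs.contDiffAt (hs.mem_nhds hx)).differentiableAt (by simp))]
    simp only [hAapp]
    have h1 := fderiv_apply_apply_apply (H := ℝ)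
      ((hΓ.contDiffAt (hs.mem_nhds hx)).differentiableAt (by simp)) w
    have h2 : fderiv ℝ (fun y => -(Γ y w).comp f) x = _ :=
      ((h1.clm_comp (hasFDerivAt_const f x)).neg).fderiv
    rw [h2]
    ext z
    simp
  obtain ⟨r, hr, hrs, H⟩ := exists_frobenius_solution hs hAs (fun x hx v w f => by
    rw [hd x hx, hd x hx]
    simp only [hAapp]
    ext z
    have := hR x hx v w (f z)
    simp only [curvature] at this
    simp only [_root_.add_apply, _root_.neg_apply, ContinuousLinearMap.comp_apply, map_neg, neg_neg]
    rw [← sub_eq_zero, ← neg_eq_zero, ← this]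
    abel) hx₀
  obtain ⟨Θ, hΘ0, hΘ⟩ := H L
  refine ⟨r, hr, hrs, Θ, hΘ0, fun x hx => ⟨(hΘ x hx).differentiableAt, fun v => ?_⟩⟩
  rw [(hΘ x hx).fderiv, ContinuousLinearMap.flip_apply, hAapp]

/-- Local existence of flat coordinates: where the curvature of the Levi-Civita connection
vanishes, the metric is locally the pullback of the Euclidean metric. The coordinates are
primitives of a parallel coframe, which is closed since the connection is torsion-free; the dual
frame `Y` is parallel as well. -/
theorem exists_flat_coordinates {n : ℕ} {G : Coord n → Coord n →L[ℝ] Coord n →L[ℝ] ℝ}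
    {Γ : Coord n → Coord n →L[ℝ] Coord n →L[ℝ] Coord n} {s : Set (Coord n)} (hs : IsOpen s)
    (hG : ContDiffOn ℝ ∞ G s) (hΓ : ContDiffOn ℝ ∞ Γ s)
    (hGsymm : ∀ x ∈ s, ∀ u v, G x u v = G x v u) (hGpos : ∀ x ∈ s, ∀ u, u ≠ 0 → 0 < G x u u)
    (hΓsymm : ∀ x ∈ s, ∀ u v, Γ x u v = Γ x v u)
    (hcompat : ∀ x ∈ s, ∀ u v w, fderiv ℝ G x u v w = G x (Γ x u v) w + G x v (Γ x u w))
    (hR : ∀ x ∈ s, ∀ u v z, curvature Γ x u v z = 0) {x₀ : Coord n} (hx₀ : x₀ ∈ s) :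
    ∃ r > 0, Metric.ball x₀ r ⊆ s ∧ ∃ φ : Coord n → Coord n,
      ∃ Y : Coord n → Coord n →L[ℝ] Coord n, ContDiffOn ℝ ∞ φ (Metric.ball x₀ r) ∧
        ∀ x ∈ Metric.ball x₀ r, (∀ u v, G x u v = inner ℝ (fderiv ℝ φ x u) (fderiv ℝ φ x v)) ∧
          (∀ u, Y x (fderiv ℝ φ x u) = u) ∧ (∀ a, fderiv ℝ φ x (Y x a) = a) ∧
          DifferentiableAt ℝ Y x ∧ ∀ v, fderiv ℝ Y x v = -(Γ x v).comp (Y x) := by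
  obtain ⟨L, hL⟩ := exists_inner_eq (hGsymm x₀ hx₀) (hGpos x₀ hx₀)
  have hLinj : Function.Injective L := by
    refine (injective_iff_map_eq_zero L).2 fun u hu => ?_
    by_contra h0
    have := hGpos x₀ hx₀ u h0
    rw [hL, hu, inner_zero_left] at this
    exact this.ne rfl
  obtain ⟨N, hLN⟩ : ∃ N : Coord n →L[ℝ] Coord n, ∀ u, L (N u) = u := by
    have hb : Function.Bijective (L : Coord n →ₗ[ℝ] Coord n) :=
      ⟨hLinj, LinearMap.injective_iff_surjective.1 hLinj⟩
    refine ⟨((LinearEquiv.ofBijective (L : Coord n →ₗ[ℝ] Coord n) hb).symm :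
      Coord n →ₗ[ℝ] Coord n).toContinuousLinearMap, fun u => ?_⟩
    exact (LinearEquiv.ofBijective (L : Coord n →ₗ[ℝ] Coord n) hb).apply_symm_apply u
  obtain ⟨r₁, hr₁, hrs₁, Θ, hΘ0, hΘ⟩ := exists_parallel_coframe hs hΓ hR hx₀ L
  obtain ⟨r₂, hr₂, hrs₂, Y, hY0, hY⟩ := exists_parallel_frame hs hΓ hR hx₀ N
  obtain ⟨r, hr, h1, h2⟩ : ∃ r > 0, r ≤ r₁ ∧ r ≤ r₂ :=
    ⟨min r₁ r₂, lt_min hr₁ hr₂, min_le_left _ _, min_le_right _ _⟩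
  replace hΘ := fun x hx => hΘ x (Metric.ball_subset_ball h1 hx)
  replace hY := fun x hx => hY x (Metric.ball_subset_ball h2 hx)
  have hrs : Metric.ball x₀ r ⊆ s := (Metric.ball_subset_ball h1).trans hrs₁
  have hx₀' : x₀ ∈ Metric.ball x₀ r := Metric.mem_ball_self hr
  have hconn : IsPreconnected (Metric.ball x₀ r) := (convex_ball x₀ r).isPreconnected
  have hYd : ∀ a : Coord n, ∀ x ∈ Metric.ball x₀ r,
      HasFDerivAt (fun y => Y y a) ((fderiv ℝ Y x).flip a) x := fun a x hx => by
    simpa using (hY x hx).1.hasFDerivAt.clm_apply (hasFDerivAt_const a x)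
  have hΘY : ∀ x ∈ Metric.ball x₀ r, ∀ a, Θ x (Y x a) = a := by
    intro x hx a
    have hd : ∀ x ∈ Metric.ball x₀ r, HasFDerivAt (𝕜 := ℝ) (fun y => Θ y (Y y a)) 0 x := by
      intro x hx
      have h := (hΘ x hx).1.hasFDerivAt.clm_apply (hYd a x hx)
      refine h.congr_fderiv (ContinuousLinearMap.ext fun v => ?_)
      simp [(hΘ x hx).2, (hY x hx).2]
    have h := Metric.isOpen_ball.is_const_of_fderiv_eq_zero (𝕜 := ℝ) hconn
      (fun x hx => (hd x hx).differentiableAt.differentiableWithinAt)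
      (fun x hx => (hd x hx).fderiv) hx hx₀'
    rw [h, hΘ0, hY0, hLN]
  have hGY : ∀ x ∈ Metric.ball x₀ r, ∀ a b, G x (Y x a) (Y x b) = inner ℝ a b := by
    intro x hx a b
    have hd : ∀ x ∈ Metric.ball x₀ r, HasFDerivAt (𝕜 := ℝ) (fun y => G y (Y y a) (Y y b)) 0 x := by
      intro x hx
      have hGd : DifferentiableAt ℝ G x :=
        (hG.contDiffAt (hs.mem_nhds (hrs hx))).differentiableAt (by simp)
      have h := (hGd.hasFDerivAt.clm_apply (hYd a x hx)).clm_apply (hYd b x hx)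
      refine h.congr_fderiv (ContinuousLinearMap.ext fun v => ?_)
      simp [(hY x hx).2, hcompat x (hrs hx)]
    have h := Metric.isOpen_ball.is_const_of_fderiv_eq_zero (𝕜 := ℝ) hconn
      (fun x hx => (hd x hx).differentiableAt.differentiableWithinAt)
      (fun x hx => (hd x hx).fderiv) hx hx₀'
    rw [h, hY0, hL, hLN, hLN]
  have hYΘ : ∀ x ∈ Metric.ball x₀ r, ∀ u, Y x (Θ x u) = u := by
    intro x hx u
    have hinj : Function.Injective (Y x : Coord n →ₗ[ℝ] Coord n) :=
      Function.LeftInverse.injective (hΘY x hx)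
    obtain ⟨a, rfl⟩ := LinearMap.injective_iff_surjective.1 hinj u
    exact congrArg (Y x) (hΘY x hx a)
  have hΘs : ContDiffOn ℝ ∞ Θ (Metric.ball x₀ r) := by
    rw [contDiffOn_infty]
    intro m
    induction m with
    | zero => exact contDiffOn_zero.2 fun x hx => (hΘ x hx).1.continuousAt.continuousWithinAt
    | succ m ih =>
      refine (contDiffOn_succ_iff_fderiv_of_isOpen Metric.isOpen_ball).2
        ⟨fun x hx => (hΘ x hx).1.differentiableWithinAt,
          fun h => absurd h (WithTop.coe_ne_top (a := (m : ℕ∞))), ?_⟩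
      rw [contDiffOn_clm_apply]
      intro v
      have hΓm : ContDiffOn ℝ m Γ (Metric.ball x₀ r) := (hΓ.mono hrs).of_le (by exact_mod_cast le_top)
      exact (ih.clm_comp (hΓm.clm_apply contDiffOn_const)).congr fun x hx => (hΘ x hx).2 v
  obtain ⟨φ, hφ⟩ := (convex_ball x₀ r).exists_forall_hasFDerivAt_of_fderiv_symmetric
    Metric.isOpen_ball (fun x hx => (hΘ x hx).1.differentiableWithinAt) (fun x hx u v => by
      rw [(hΘ x hx).2, (hΘ x hx).2, ContinuousLinearMap.comp_apply, ContinuousLinearMap.comp_apply,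
        hΓsymm x (hrs hx)])
  refine ⟨r, hr, hrs, φ, Y, ?_, fun x hx => ⟨fun u v => ?_, fun u => ?_, fun a => ?_, hY x hx⟩⟩
  · refine (contDiffOn_infty_iff_fderiv_of_isOpen Metric.isOpen_ball).2
      ⟨fun x hx => (hφ x hx).differentiableAt.differentiableWithinAt, ?_⟩
    exact hΘs.congr fun x hx => (hφ x hx).fderiv
  · rw [(hφ x hx).fderiv, ← hGY x hx, hYΘ x hx, hYΘ x hx]
  · rw [(hφ x hx).fderiv, hYΘ x hx]
  · rw [(hφ x hx).fderiv, hΘY x hx]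

end FlatCoordinates

/-! ### The first variation of the Kropina length -/

section Variations

open MeasureTheory

variable {V : Type*} [NormedAddCommGroup V] [NormedSpace ℝ V]

/-- Differentiation of `∫ L(γ + s ζ)` at `s = 0`. -/
lemma hasDerivAt_integral_add_smul {L : V → ℝ} {U : Set V} (hU : IsOpen U)
    (hL : ContDiffOn ℝ ∞ L U) {γ ζ : ℝ → V} (hγ : Continuous γ) (hζ : Continuous ζ) {a b : ℝ}
    (hab : a ≤ b) (hmem : ∀ t ∈ Set.Icc a b, γ t ∈ U) :
    HasDerivAt (fun s : ℝ => ∫ t in a..b, L (γ t + s • ζ t))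
      (∫ t in a..b, fderiv ℝ L (γ t) (ζ t)) 0 := by
  have hc : Continuous fun p : ℝ × ℝ => γ p.2 + p.1 • ζ p.2 := by fun_prop
  have hnear : ∀ᶠ s in nhds (0 : ℝ), ∀ t ∈ Set.Icc a b, γ t + s • ζ t ∈ U := by
    refine isCompact_Icc.eventually_forall_of_forall_eventually fun t ht => ?_
    have h0 : (fun p : ℝ × ℝ => γ p.2 + p.1 • ζ p.2) (0, t) ∈ U := by simpa using hmem t ht
    exact hc.continuousAt.eventually_mem (hU.mem_nhds h0)
  obtain ⟨δ, hδ, hball⟩ := Metric.eventually_nhds_iff_ball.1 hnear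
  have hδ2 : Metric.closedBall (0 : ℝ) (δ / 2) ⊆ Metric.ball 0 δ :=
    Metric.closedBall_subset_ball (by linarith)
  have hmaps : Set.MapsTo (fun p : ℝ × ℝ => γ p.2 + p.1 • ζ p.2)
      (Metric.closedBall 0 (δ / 2) ×ˢ Set.Icc a b) U :=
    fun p hp => hball p.1 (hδ2 hp.1) p.2 hp.2
  have hL' : ContinuousOn (fderiv ℝ L) U := hL.continuousOn_fderiv_of_isOpen hU (by simp)
  have hcont : ContinuousOn (fun p : ℝ × ℝ => fderiv ℝ L (γ p.2 + p.1 • ζ p.2) (ζ p.2))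
      (Metric.closedBall 0 (δ / 2) ×ˢ Set.Icc a b) :=
    (hL'.comp hc.continuousOn hmaps).clm_apply (hζ.comp continuous_snd).continuousOn
  obtain ⟨C, hC⟩ := ((isCompact_closedBall (0 : ℝ) (δ / 2)).prod
    (isCompact_Icc (a := a) (b := b))).exists_bound_of_continuousOn hcont
  have hΙ : Set.uIoc a b ⊆ Set.Icc a b := by
    rw [Set.uIoc_of_le hab]; exact Set.Ioc_subset_Icc_self
  have hslice : ∀ s ∈ Metric.closedBall (0 : ℝ) (δ / 2),
      ContinuousOn (fun t => L (γ t + s • ζ t)) (Set.Icc a b) := fun s hs =>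
    hL.continuousOn.comp (by fun_prop) fun t ht => hmaps (x := (s, t)) ⟨hs, ht⟩
  have h0mem : (0 : ℝ) ∈ Metric.closedBall (0 : ℝ) (δ / 2) := by simp; positivity
  have key := intervalIntegral.hasDerivAt_integral_of_dominated_loc_of_deriv_le (μ := volume)
    (a := a) (b := b) (F := fun s t => L (γ t + s • ζ t))
    (F' := fun s t => fderiv ℝ L (γ t + s • ζ t) (ζ t)) (x₀ := (0 : ℝ))
    (s := Metric.closedBall 0 (δ / 2)) (bound := fun _ => C)
    (Metric.closedBall_mem_nhds _ (by positivity)) ?_ ?_ ?_ ?_ ?_ ?_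
  · simpa using key.2
  · filter_upwards [Metric.closedBall_mem_nhds (0 : ℝ) (ε := δ / 2) (by positivity)] with s hs
    exact ((hslice s hs).mono hΙ).aestronglyMeasurable measurableSet_uIoc
  · refine ContinuousOn.intervalIntegrable ?_
    rw [Set.uIcc_of_le hab]
    exact hslice 0 h0mem
  · have h1 : ContinuousOn (fun t => fderiv ℝ L (γ t + (0 : ℝ) • ζ t) (ζ t)) (Set.Icc a b) :=
      hcont.comp (f := fun t : ℝ => ((0 : ℝ), t)) (by fun_prop) fun t ht => ⟨h0mem, ht⟩
    exact (h1.mono hΙ).aestronglyMeasurable measurableSet_uIoc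
  · exact Filter.Eventually.of_forall fun t ht s hs => hC (s, t) ⟨hs, hΙ ht⟩
  · exact intervalIntegrable_const
  · refine Filter.Eventually.of_forall fun t ht s hs => ?_
    have hd : DifferentiableAt ℝ L (γ t + s • ζ t) :=
      (hL.contDiffAt (hU.mem_nhds (hmaps (x := (s, t)) ⟨hs, hΙ ht⟩))).differentiableAt (by simp)
    have h1 : HasDerivAt (fun s : ℝ => γ t + s • ζ t) (ζ t) s := by
      simpa using ((hasDerivAt_id s).smul_const (ζ t)).const_add (γ t)
    exact hd.hasFDerivAt.comp_hasDerivAt s h1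

/-- The fundamental lemma of the calculus of variations, in the form of du Bois-Reymond. -/
lemma hasDerivAt_of_forall_integral_eq_zero {p q : ℝ → ℝ} {T : Set ℝ} (hT : IsOpen T)
    (hp : ContDiffOn ℝ 1 p T) (hq : ContinuousOn q T) {a b : ℝ} (hab : a < b)
    (hsub : Set.Icc a b ⊆ T)
    (H : ∀ g : ℝ → ℝ, ContDiff ℝ ∞ g → g a = 0 → g b = 0 →
      ∫ t in a..b, (g t * q t + deriv g t * p t) = 0) {t : ℝ} (ht : t ∈ Set.Ioo a b) :
    HasDerivAt p (q t) t := by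
  have hp' : ContinuousOn (deriv p) T := hp.continuousOn_deriv_of_isOpen hT le_rfl
  have hpd : ∀ t ∈ T, HasDerivAt p (deriv p t) t := fun t ht =>
    ((hp.contDiffAt (hT.mem_nhds ht)).differentiableAt (by simp)).hasDerivAt
  have hf : ContinuousOn (fun t => q t - deriv p t) T := hq.sub hp'
  have hIoo : Set.Ioo a b ⊆ T := Set.Ioo_subset_Icc_self.trans hsub
  have hu : Set.uIcc a b ⊆ T := by rwa [Set.uIcc_of_le hab.le]
  have hae : ∀ᵐ t, t ∈ Set.Ioo a b → q t - deriv p t = 0 := by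
    refine isOpen_Ioo.ae_eq_zero_of_integral_contDiff_smul_eq_zero
      ((hf.mono hIoo).locallyIntegrableOn measurableSet_Ioo) fun g hg hgc hgs => ?_
    have hga : g a = 0 := image_eq_zero_of_notMem_tsupport fun h => (hgs h).1.ne rfl
    have hgb : g b = 0 := image_eq_zero_of_notMem_tsupport fun h => (hgs h).2.ne rfl
    have hg1 : Continuous (deriv g) := hg.continuous_deriv (by simp)
    have hgp : ∫ t in a..b, (deriv g t * p t + g t * deriv p t) = 0 := by
      rw [intervalIntegral.integral_eq_sub_of_hasDerivAt (f := fun t => g t * p t)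
        (fun t ht => ((hg.differentiable (by simp)).differentiableAt.hasDerivAt).mul
          (hpd t (hu ht)))]
      · simp [hga, hgb]
      · exact ((hg1.continuousOn.mul (hp.continuousOn.mono hu)).add
          (hg.continuous.continuousOn.mul (hp'.mono hu))).intervalIntegrable
    have h1 := H g hg hga hgb
    have h2 : ∫ t in a..b, g t • (q t - deriv p t) = 0 := by
      have h3 := congrArg₂ (fun x y : ℝ => x - y) h1 hgp
      simp only [sub_zero] at h3
      rw [← h3, ← intervalIntegral.integral_sub]
      · exact intervalIntegral.integral_congr fun t _ => by simp only [smul_eq_mul]; ring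
      · exact ((hg.continuous.continuousOn.mul (hq.mono hu)).add
          (hg1.continuousOn.mul (hp.continuousOn.mono hu))).intervalIntegrable
      · exact ((hg1.continuousOn.mul (hp.continuousOn.mono hu)).add
          (hg.continuous.continuousOn.mul (hp'.mono hu))).intervalIntegrable
    rw [← h2]
    symm
    refine intervalIntegral.integral_eq_integral_of_support_subset ?_
    refine (Function.support_smul_subset_left _ _).trans ((subset_tsupport g).trans ?_)
    exact hgs.trans Set.Ioo_subset_Ioc_self
  have heq : Set.EqOn (fun t => q t - deriv p t) 0 (Set.Ioo a b) :=
    Measure.eqOn_open_of_ae_eq ((ae_restrict_iff' measurableSet_Ioo).2 hae) isOpen_Ioo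
      (hf.mono hIoo) continuousOn_const
  have h0 : q t = deriv p t := sub_eq_zero.1 (heq ht)
  rw [h0]
  exact hpd t (hIoo ht)

end Variations

section Lagrangian

variable {E : Type*} [NormedAddCommGroup E] [NormedSpace ℝ E]
  (G : E → E →L[ℝ] E →L[ℝ] ℝ) (σ : E → E →L[ℝ] ℝ)

/-- The function `G(y, y) / (2 σ(y))` of the position `p.1` and the velocity `y = p.2`, for a field
`G` of bilinear forms and a field `σ` of linear forms. -/
def lagrangian (p : E × E) : ℝ := G p.1 p.2 p.2 / (2 * σ p.1 p.2)

/-- The domain of positivity of `σ` over the set `s`. -/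
def lagrangianDomain (s : Set E) : Set (E × E) := {p | p.1 ∈ s ∧ 0 < σ p.1 p.2}

/-- The derivative of the Lagrangian at `(x, y)` in the direction `z` of the fibre. -/
def momentum (x y z : E) : ℝ := G x y z / σ x y - G x y y * σ x z / (2 * σ x y ^ 2)

/-- The derivative of the Lagrangian at `(x, y)` in the direction `z` of the base. -/
def force (x y z : E) : ℝ :=
  fderiv ℝ G x z y y / (2 * σ x y) - G x y y * fderiv ℝ σ x z y / (2 * σ x y ^ 2)

variable {G σ} {s : Set E}

lemma isOpen_lagrangianDomain (hs : IsOpen s) (hσ : ContDiffOn ℝ ∞ σ s) :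
    IsOpen (lagrangianDomain σ s) := by
  have h1 : ContinuousOn (fun p : E × E => σ p.1 p.2) (s ×ˢ Set.univ) :=
    (hσ.continuousOn.comp continuous_fst.continuousOn fun p hp => hp.1).clm_apply
      continuous_snd.continuousOn
  have := h1.isOpen_inter_preimage (hs.prod isOpen_univ) isOpen_Ioi (t := Set.Ioi (0 : ℝ))
  convert this using 1
  ext p
  simp [lagrangianDomain]

lemma contDiffOn_lagrangian (hG : ContDiffOn ℝ ∞ G s) (hσ : ContDiffOn ℝ ∞ σ s) :
    ContDiffOn ℝ ∞ (lagrangian G σ) (lagrangianDomain σ s) := by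
  have h1 : Set.MapsTo (Prod.fst : E × E → E) (lagrangianDomain σ s) s := fun p hp => hp.1
  refine ContDiffOn.div (((hG.comp contDiffOn_fst h1).clm_apply contDiffOn_snd).clm_apply
    contDiffOn_snd) (contDiffOn_const.mul ((hσ.comp contDiffOn_fst h1).clm_apply contDiffOn_snd))
    fun p hp => ?_
  exact mul_ne_zero two_ne_zero hp.2.ne'

/-- The momentum and the force are the partial derivatives of the Lagrangian. -/
lemma fderiv_lagrangian (hs : IsOpen s) (hG : ContDiffOn ℝ ∞ G s) (hσ : ContDiffOn ℝ ∞ σ s)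
    (hsymm : ∀ x u v, G x u v = G x v u) {x y : E} (hxy : (x, y) ∈ lagrangianDomain σ s) (ξ η : E) :
    fderiv ℝ (lagrangian G σ) (x, y) (ξ, η) = force G σ x y ξ + momentum G σ x y η := by
  have hGd : DifferentiableAt ℝ G x :=
    (hG.contDiffAt (hs.mem_nhds hxy.1)).differentiableAt (by simp)
  have hσd : DifferentiableAt ℝ σ x :=
    (hσ.contDiffAt (hs.mem_nhds hxy.1)).differentiableAt (by simp)
  have hpos : σ x y ≠ 0 := hxy.2.ne'
  have hG1 : HasFDerivAt (fun p : E × E => G p.1) _ (x, y) :=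
    HasFDerivAt.comp (x, y) (g := G) (f := Prod.fst) hGd.hasFDerivAt hasFDerivAt_fst
  have hσ1 : HasFDerivAt (fun p : E × E => σ p.1) _ (x, y) :=
    HasFDerivAt.comp (x, y) (g := σ) (f := Prod.fst) hσd.hasFDerivAt hasFDerivAt_fst
  have h2 : HasFDerivAt (Prod.snd : E × E → E) _ (x, y) := hasFDerivAt_snd (𝕜 := ℝ)
  have hN := (hG1.clm_apply h2).clm_apply h2
  have hD := (hσ1.clm_apply h2).const_mul (2 : ℝ)
  have hL : fderiv ℝ (fun p : E × E => G p.1 p.2 p.2 * (2 * σ p.1 p.2)⁻¹) (x, y) = _ :=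
    (hN.mul ((hasDerivAt_inv (mul_ne_zero two_ne_zero hpos)).comp_hasFDerivAt (x, y) hD)).fderiv
  change fderiv ℝ (fun p : E × E => G p.1 p.2 p.2 * (2 * σ p.1 p.2)⁻¹) (x, y) (ξ, η) = _
  rw [hL]
  simp only [force, momentum]
  simp
  rw [hsymm x η y]
  field_simp
  ring

/-- The Euler-Lagrange equation: if the first variation of `∫ L(c, c')` vanishes for all
variations with fixed end points, the momentum evolves by the force. -/
lemma hasDerivAt_momentum (hs : IsOpen s) (hG : ContDiffOn ℝ ∞ G s) (hσ : ContDiffOn ℝ ∞ σ s)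
    (hsymm : ∀ x u v, G x u v = G x v u) {c : ℝ → E} (hc : ContDiff ℝ ∞ c) {a b : ℝ} (hab : a < b)
    (hmem : ∀ t ∈ Set.Icc a b, (c t, deriv c t) ∈ lagrangianDomain σ s)
    (H : ∀ η : ℝ → E, ContDiff ℝ ∞ η → η a = 0 → η b = 0 →
      ∫ t in a..b, fderiv ℝ (lagrangian G σ) (c t, deriv c t) (η t, deriv η t) = 0)
    {t : ℝ} (ht : t ∈ Set.Ioo a b) (z : E) :
    HasDerivAt (fun t => momentum G σ (c t) (deriv c t) z) (force G σ (c t) (deriv c t) z) t := by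
  have hγ : ContDiff ℝ ∞ fun t => (c t, deriv c t) :=
    hc.prodMk (hc.iterate_deriv 1)
  have hU := isOpen_lagrangianDomain hs hσ
  have hT : IsOpen ((fun t => (c t, deriv c t)) ⁻¹' lagrangianDomain σ s) :=
    hU.preimage hγ.continuous
  have hL : ContDiffOn ℝ ∞ (fderiv ℝ (lagrangian G σ)) (lagrangianDomain σ s) :=
    (contDiffOn_lagrangian hG hσ).fderiv_of_isOpen hU (m := ∞) (by simp)
  have hp (w : E × E) : ContDiffOn ℝ ∞
      (fun t => fderiv ℝ (lagrangian G σ) (c t, deriv c t) w)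
      ((fun t => (c t, deriv c t)) ⁻¹' lagrangianDomain σ s) :=
    (hL.comp hγ.contDiffOn fun t ht => ht).clm_apply contDiffOn_const
  have hmom : ∀ t ∈ (fun t => (c t, deriv c t)) ⁻¹' lagrangianDomain σ s,
      momentum G σ (c t) (deriv c t) z = fderiv ℝ (lagrangian G σ) (c t, deriv c t) (0, z) := by
    intro t ht
    rw [fderiv_lagrangian hs hG hσ hsymm ht]
    simp [force]
  have hfor : ∀ t ∈ (fun t => (c t, deriv c t)) ⁻¹' lagrangianDomain σ s,
      force G σ (c t) (deriv c t) z = fderiv ℝ (lagrangian G σ) (c t, deriv c t) (z, 0) := by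
    intro t ht
    rw [fderiv_lagrangian hs hG hσ hsymm ht]
    simp [momentum]
  have htT := hmem t (Set.Ioo_subset_Icc_self ht)
  have key := hasDerivAt_of_forall_integral_eq_zero hT
    ((hp (0, z)).of_le (by simp)) (hp (z, 0)).continuousOn hab hmem (fun g hg ha hb => ?_) ht
  · rw [hfor t htT]
    refine key.congr_of_eventuallyEq ?_
    filter_upwards [hT.mem_nhds htT] with r hr using hmom r hr
  · have h1 := H (fun t => g t • z) (hg.smul contDiff_const) (by simp [ha]) (by simp [hb])
    rw [← h1]
    refine intervalIntegral.integral_congr fun t _ => ?_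
    have h2 : deriv (fun t => g t • z) t = deriv g t • z :=
      deriv_smul_const ((hg.differentiable (by simp)).differentiableAt) z
    have h3 : (g t • z, deriv g t • z) = g t • (z, (0 : E)) + deriv g t • ((0 : E), z) := by simp
    simp only [h2, h3, map_add, map_smul, smul_eq_mul]

end Lagrangian

section Geodesics

variable {n : ℕ} {M : Type*} [TopologicalSpace M] [ChartedSpace (Coord n) M]
  [IsManifold (𝓡 n) ∞ M] (h : Metric n M) (W : (p : M) → TangentSpace (𝓡 n) p) (k : M → ℝ)
  {e : OpenPartialHomeomorph M (Coord n)}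

lemma isAdmissible_iff {c : ℝ → Coord n} {a b : ℝ} :
    IsAdmissible (kropinaDomain h W k) e c a b ↔ ContDiff ℝ ∞ c ∧
      ∀ t ∈ Set.Icc a b, (c t, deriv c t) ∈ lagrangianDomain (chartForm h W e) e.target :=
  ⟨fun H => ⟨H.smooth, fun t ht => ⟨H.mem_target t ht,
    (mem_kropinaDomain_iff h W k _ _).1 (H.velocity_mem t ht)⟩⟩,
  fun H => ⟨H.1, fun t ht => (H.2 t ht).1,
    fun t ht => (mem_kropinaDomain_iff h W k _ _).2 (H.2 t ht).2⟩⟩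

lemma kropinaMetric_velocity (c : ℝ → Coord n) (t : ℝ) :
    kropinaMetric h W k (velocity e c t) =
      lagrangian (chartMetric h e) (chartForm h W e) (c t, deriv c t) :=
  kropinaMetric_eq h W k _ _

/-- The first variation of the length. -/
lemma hasDerivAt_curveLength (he : IsChart e) (hσ : ContDiffOn ℝ ∞ (chartForm h W e) e.target)
    {c : ℝ → Coord n} {a b : ℝ} (hab : a ≤ b) (hc : IsAdmissible (kropinaDomain h W k) e c a b)
    {η : ℝ → Coord n} (hη : ContDiff ℝ ∞ η) :
    HasDerivAt (fun s : ℝ => curveLength (kropinaMetric h W k) e (fun t => c t + s • η t) a b)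
      (∫ t in a..b, fderiv ℝ (lagrangian (chartMetric h e) (chartForm h W e)) (c t, deriv c t)
        (η t, deriv η t)) 0 := by
  obtain ⟨hc1, hc2⟩ := (isAdmissible_iff h W k).1 hc
  have hs := e.open_target
  have key := hasDerivAt_integral_add_smul (isOpen_lagrangianDomain hs hσ)
    (contDiffOn_lagrangian (contDiffOn_chartMetric h he) hσ)
    (hc1.continuous.prodMk (hc1.continuous_deriv (by simp)))
    (hη.continuous.prodMk (hη.continuous_deriv (by simp))) hab hc2
  refine key.congr_of_eventuallyEq (Filter.Eventually.of_forall fun s => ?_)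
  refine intervalIntegral.integral_congr fun t _ => ?_
  have h1 : deriv (fun t => c t + s • η t) t = deriv c t + s • deriv η t := by
    exact ((hc1.differentiable (by simp)).differentiableAt.hasDerivAt.add
      ((hη.differentiable (by simp)).differentiableAt.hasDerivAt.const_smul s)).deriv
  simp only [kropinaMetric_velocity, h1, Prod.smul_mk, Prod.mk_add_mk]

/-- The Euler-Lagrange equation of a geodesic of the Kropina metric. -/
lemma IsGeodesic.hasDerivAt_momentum (he : IsChart e)
    (hσ : ContDiffOn ℝ ∞ (chartForm h W e) e.target) {c : ℝ → Coord n} {a b : ℝ} (hab : a < b)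
    (hc : IsGeodesic (kropinaDomain h W k) (kropinaMetric h W k) e c a b) {t : ℝ}
    (ht : t ∈ Set.Ioo a b) (z : Coord n) :
    HasDerivAt (fun t => momentum (chartMetric h e) (chartForm h W e) (c t) (deriv c t) z)
      (force (chartMetric h e) (chartForm h W e) (c t) (deriv c t) z) t := by
  obtain ⟨hc1, hc2⟩ := (isAdmissible_iff h W k).1 hc.admissible
  refine Kropina.hasDerivAt_momentum e.open_target (contDiffOn_chartMetric h he) hσ
    (fun x u v => chartMetric_symm h x u v) hc1 hab hc2 (fun η hη ha hb => ?_) ht z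
  exact (hasDerivAt_curveLength h W k he hσ hab.le hc.admissible hη).unique
    (hc.critical η hη ha hb)

end Geodesics

/-! ### Flat charts -/

section FlatCharts

variable {n : ℕ} {M : Type*} [TopologicalSpace M] [ChartedSpace (Coord n) M]
  [IsManifold (𝓡 n) ∞ M] (h : Metric n M) (W : (p : M) → TangentSpace (𝓡 n) p)
  {e e' : OpenPartialHomeomorph M (Coord n)}

/-- A chart in which the metric is Euclidean and the one-form `h(W, ·)` has constant
coefficients. -/
structure IsFlatChart (e : OpenPartialHomeomorph M (Coord n)) : Prop where
  isChart : IsChart e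
  metric : ∀ x ∈ e.target, ∀ u v, chartMetric h e x u v = inner ℝ u v
  exists_form : ∃ l : Coord n →L[ℝ] ℝ, ∀ x ∈ e.target, chartForm h W e x = l

variable {h W}

/-- The transition map to a flat chart has parallel differential. -/
lemma IsFlatChart.fderiv_fderiv_transition (he' : IsFlatChart h W e') (he : IsChart e)
    {x : Coord n} (hx : x ∈ e.target ∩ e.symm ⁻¹' e'.source) (u v : Coord n) :
    fderiv ℝ (fderiv ℝ (transition e e')) x u v =
      fderiv ℝ (transition e e') x (chartConnection h e x u v) := by
  have ho := isOpen_transition_domain (e := e) (e' := e')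
  have hψ := (contDiffOn_transition he he'.isChart).contDiffAt (ho.mem_nhds hx)
  have hsymm : IsSymmSndFDerivAt ℝ (transition e e') x :=
    hψ.isSymmSndFDerivAt two_le_minSmoothness_infty
  have hG : ∀ y ∈ e.target ∩ e.symm ⁻¹' e'.source, ∀ u v, chartMetric h e y u v =
      inner ℝ (fderiv ℝ (transition e e') y u) (fderiv ℝ (transition e e') y v) :=
    fun y hy u v => by
      rw [chartMetric_transition h he he'.isChart hy.1 hy.2]
      exact he'.metric _ (e'.map_source hy.2) _ _
  have hd : DifferentiableAt ℝ (fderiv ℝ (transition e e')) x :=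
    (hψ.fderiv_right (m := ∞) (by simp)).differentiableAt (by simp)
  have hDG (w u v : Coord n) : fderiv ℝ (chartMetric h e) x w u v =
      inner ℝ (fderiv ℝ (transition e e') x u) (fderiv ℝ (fderiv ℝ (transition e e')) x w v) +
      inner ℝ (fderiv ℝ (fderiv ℝ (transition e e')) x w u) (fderiv ℝ (transition e e') x v) := by
    rw [← fderiv_clm_apply_apply (differentiableAt_chartMetric h he hx.1)]
    have h1 : (fun y => chartMetric h e y u v) =ᶠ[nhds x] fun y =>
        inner ℝ (fderiv ℝ (transition e e') y u) (fderiv ℝ (transition e e') y v) := by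
      filter_upwards [ho.mem_nhds hx] with y hy using hG y hy u v
    have h2 (z : Coord n) : HasFDerivAt (fun y => fderiv ℝ (transition e e') y z)
        ((fderiv ℝ (fderiv ℝ (transition e e')) x).flip z) x := by
      simpa using hd.hasFDerivAt.clm_apply (hasFDerivAt_const z x)
    rw [h1.fderiv_eq, ((h2 u).inner ℝ (h2 v)).fderiv]
    simp
  refine ext_inner_right ℝ fun z => ?_
  obtain ⟨w, rfl⟩ := fderiv_transition_surjective he he'.isChart hx.1 hx.2 z
  rw [← hG x hx, koszul h he hx.1, hDG, hDG, hDG, hsymm v w, hsymm v u, hsymm u w]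
  simp only [real_inner_comm]
  ring

/-- The differential of the transition map is parallel and injective, so the curvature vanishes. -/
lemma IsFlatChart.curvature_eq_zero (he' : IsFlatChart h W e') (he : IsChart e)
    {x : Coord n} (hx : x ∈ e.target ∩ e.symm ⁻¹' e'.source) (u v z : Coord n) :
    curvature (chartConnection h e) x u v z = 0 := by
  have ho := isOpen_transition_domain (e := e) (e' := e')
  have h1 := apply_curvature_of_parallel (θ := fderiv ℝ (transition e e')) ho
    ((contDiffOn_transition he he'.isChart).fderiv_of_isOpen ho (m := ∞) (by simp))
    ((contDiffOn_chartConnection h he).mono Set.inter_subset_left)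
    (fun y hy u v => he'.fderiv_fderiv_transition he hy u v) hx u v z
  have hinj : Function.Injective (fderiv ℝ (transition e e') x : Coord n →ₗ[ℝ] Coord n) :=
    LinearMap.injective_iff_surjective.2 (fderiv_transition_surjective he he'.isChart hx.1 hx.2)
  exact hinj (h1.trans (map_zero _).symm)

/-- The one-form is a constant form composed with the parallel differential of the transition map,
so it is parallel. -/
lemma IsFlatChart.fderiv_chartForm (he' : IsFlatChart h W e') (he : IsChart e)
    {x : Coord n}
    (hx : x ∈ e.target ∩ e.symm ⁻¹' e'.source) (u v : Coord n) :
    fderiv ℝ (chartForm h W e) x v u = chartForm h W e x (chartConnection h e x u v) := by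
  have ho := isOpen_transition_domain (e := e) (e' := e')
  obtain ⟨l, hl⟩ := he'.exists_form
  have hψ := (contDiffOn_transition he he'.isChart).contDiffAt (ho.mem_nhds hx)
  have hd : DifferentiableAt ℝ (fderiv ℝ (transition e e')) x :=
    (hψ.fderiv_right (m := ∞) (by simp)).differentiableAt (by simp)
  have h1 : chartForm h W e =ᶠ[nhds x] fun y => l.comp (fderiv ℝ (transition e e') y) := by
    filter_upwards [ho.mem_nhds hx] with y hy
    ext u
    rw [chartForm_transition h W he he'.isChart hy.1 hy.2]
    exact congrArg (fun m : Coord n →L[ℝ] ℝ => m _) (hl _ (e'.map_source hy.2))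
  rw [h1.fderiv_eq, h1.self_of_nhds,
    ((hasFDerivAt_const l x).clm_comp hd.hasFDerivAt).fderiv]
  simp [he'.fderiv_fderiv_transition he hx, chartConnection_symm h he hx.1 u v]

/-- If `M` is covered by flat charts, `h` is flat and `W` is parallel. -/
lemma isFlat_and_isParallel_of_isFlatChart (hW : ContMDiff (𝓡 n) ((𝓡 n).prod 𝓘(ℝ, Coord n)) ∞
    (fun p : M => (⟨p, W p⟩ : TangentBundle (𝓡 n) M)))
    (H : ∀ p : M, ∃ e : OpenPartialHomeomorph M (Coord n), p ∈ e.source ∧ IsFlatChart h W e) :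
    IsFlat h ∧ IsParallel h W := by
  constructor <;> intro e he x hx <;> obtain ⟨e', hp, he'⟩ := H (e.symm x)
  · exact (curvature_eq_zero_iff h he hx).2 fun u v z => he'.curvature_eq_zero he ⟨hx, hp⟩ u v z
  · have hσ : DifferentiableAt ℝ (chartForm h W e) x :=
      ((contDiffOn_chartForm h W hW he).contDiffAt (e.open_target.mem_nhds hx)).differentiableAt
        (by simp)
    exact (covDeriv_eq_zero_iff h hσ).2 fun u v => he'.fderiv_chartForm he ⟨hx, hp⟩ u v

/-- The composition of a chart with a local diffeomorphism of `ℝⁿ` is a chart. -/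
lemma isChart_trans (he : IsChart e) {g : OpenPartialHomeomorph (Coord n) (Coord n)}
    (hg : ContDiffOn ℝ ∞ g g.source) (hg' : ContDiffOn ℝ ∞ g.symm g.target) :
    IsChart (e.trans g) := by
  refine (IsManifold.mem_maximalAtlas_iff_contMDiffOn _).2 ⟨?_, ?_⟩
  · refine hg.contMDiffOn.comp ((contMDiffOn_of_mem_maximalAtlas he).mono ?_) fun x hx => ?_
    · simp
    · simpa using hx.2
  · refine (contMDiffOn_symm_of_mem_maximalAtlas he).comp (hg'.contMDiffOn.mono ?_) fun x hx => ?_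
    · simp
    · simpa using hx.2

/-- Where `h` is flat and `W` is parallel, there are flat charts. -/
lemma exists_isFlatChart (he : IsChart e) (hσ : ContDiffOn ℝ ∞ (chartForm h W e) e.target)
    (hR : ∀ x ∈ e.target, ∀ u v z, curvature (chartConnection h e) x u v z = 0)
    (hpar : ∀ x ∈ e.target, ∀ u v,
      fderiv ℝ (chartForm h W e) x v u = chartForm h W e x (chartConnection h e x u v))
    {p : M} (hp : p ∈ e.source) :
    ∃ e' : OpenPartialHomeomorph M (Coord n), p ∈ e'.source ∧ IsFlatChart h W e' := by
  obtain ⟨r, hr, hrs, φ, Y, hφ, H⟩ := exists_flat_coordinates e.open_target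
    (contDiffOn_chartMetric h he) (contDiffOn_chartConnection h he)
    (fun x _ u v => chartMetric_symm h x u v) (fun x hx u hu => chartMetric_pos h he hx hu)
    (fun x hx u v => chartConnection_symm h he hx u v)
    (fun x hx u v w => fderiv_chartMetric h he hx u v w) hR (e.map_source hp)
  have hx₀ : e p ∈ Metric.ball (e p) r := Metric.mem_ball_self hr
  have hφx (x) (hx : x ∈ Metric.ball (e p) r) : ContDiffAt ℝ ∞ φ x :=
    hφ.contDiffAt (Metric.isOpen_ball.mem_nhds hx)
  obtain ⟨D, hD⟩ : ∃ D : Coord n → (Coord n ≃L[ℝ] Coord n), ∀ x ∈ Metric.ball (e p) r,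
      HasFDerivAt φ (D x : Coord n →L[ℝ] Coord n) x := by
    classical
    refine ⟨fun x => if hx : x ∈ Metric.ball (e p) r then
      ContinuousLinearEquiv.equivOfInverse (fderiv ℝ φ x) (Y x) (H x hx).2.1 (H x hx).2.2.1
      else ContinuousLinearEquiv.refl ℝ _, fun x hx => ?_⟩
    simp only [dif_pos hx]
    exact ((hφx x hx).differentiableAt (by simp)).hasFDerivAt
  let g₀ := (hφx _ hx₀).toOpenPartialHomeomorph φ (hD _ hx₀) (by simp)
  let g := g₀.restrOpen (Metric.ball (e p) r) Metric.isOpen_ball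
  have hgφ : (g : Coord n → Coord n) = φ := rfl
  have hgs : g.source ⊆ Metric.ball (e p) r := Set.inter_subset_right
  have hgt : ∀ y ∈ g.target, g.symm y ∈ Metric.ball (e p) r := fun y hy => hgs (g.map_target hy)
  have hpg : e p ∈ g.source :=
    ⟨(hφx _ hx₀).mem_toOpenPartialHomeomorph_source (hD _ hx₀) (by simp), hx₀⟩
  have hch : IsChart (e.trans g) := by
    refine isChart_trans he (hφ.mono hgs) fun y hy => ContDiffAt.contDiffWithinAt ?_
    exact g.contDiffAt_symm hy (hD _ (hgt y hy)) (hφx _ (hgt y hy))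
  -- in the new chart the coordinate vectors are given by the parallel frame `Y`
  have htr : ∀ y ∈ (e.trans g).target, ∃ x ∈ Metric.ball (e p) r, x ∈ e.target ∧
      e.symm x ∈ (e.trans g).source ∧ transition e (e.trans g) x = y ∧
      fderiv ℝ (transition e (e.trans g)) x = fderiv ℝ φ x := by
    intro y hy
    have hyg : y ∈ g.target := hy.1
    have hx := hgt y hyg
    have hxs : e.symm (g.symm y) ∈ (e.trans g).source := (e.trans g).map_target hy
    refine ⟨g.symm y, hx, hrs hx, hxs, (e.trans g).right_inv hy, ?_⟩
    refine Filter.EventuallyEq.fderiv_eq ?_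
    filter_upwards [e.open_target.mem_nhds (hrs hx)] with z hz
    change g (e (e.symm z)) = φ z
    rw [e.right_inv hz, hgφ]
  refine ⟨e.trans g, ⟨hp, hpg⟩, hch, fun y hy u v => ?_, (chartForm h W e (e p)).comp (Y (e p)),
    fun y hy => ContinuousLinearMap.ext fun u => ?_⟩
  · obtain ⟨x, hx, hxe, hxs, rfl, hd⟩ := htr y hy
    have h1 := chartMetric_transition h he hch hxe hxs (Y x u) (Y x v)
    rw [hd, (H x hx).2.2.1, (H x hx).2.2.1, (H x hx).1, (H x hx).2.2.1, (H x hx).2.2.1] at h1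
    exact h1.symm
  · obtain ⟨x, hx, hxe, hxs, rfl, hd⟩ := htr y hy
    have h1 := chartForm_transition h W he hch hxe hxs (Y x u)
    rw [hd, (H x hx).2.2.1] at h1
    rw [← h1]
    have hder : ∀ x ∈ Metric.ball (e p) r,
        HasFDerivAt (𝕜 := ℝ) (fun x => chartForm h W e x (Y x u)) 0 x := by
      intro x hx
      have hσd : DifferentiableAt ℝ (chartForm h W e) x :=
        (hσ.contDiffAt (e.open_target.mem_nhds (hrs hx))).differentiableAt (by simp)
      have h2 := hσd.hasFDerivAt.clm_apply
        ((H x hx).2.2.2.1.hasFDerivAt.clm_apply (hasFDerivAt_const u x))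
      refine h2.congr_fderiv (ContinuousLinearMap.ext fun v => ?_)
      simp [(H x hx).2.2.2.2, hpar x (hrs hx), chartConnection_symm h he (hrs hx) v]
    exact Metric.isOpen_ball.is_const_of_fderiv_eq_zero (𝕜 := ℝ)
      (convex_ball (e p) r).isPreconnected
      (fun x hx => (hder x hx).differentiableAt.differentiableWithinAt)
      (fun x hx => (hder x hx).fderiv) hx hx₀

end FlatCharts

/-! ### Extremals in a flat chart -/

section FlatExtremals

variable {n : ℕ} {M : Type*} [TopologicalSpace M] [ChartedSpace (Coord n) M]
  [IsManifold (𝓡 n) ∞ M] {h : Metric n M} {W : (p : M) → TangentSpace (𝓡 n) p} {k : M → ℝ}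
  {e : OpenPartialHomeomorph M (Coord n)}

/-- In Euclidean space with a constant unit one-form, the momentum determines the direction. -/
lemma smul_eq_smul_of_momentum_eq {w y y' : Coord n} (hw : inner ℝ w w = (1 : ℝ))
    (hy : 0 < inner ℝ w y) (hy' : 0 < inner ℝ w y')
    (H : ∀ z : Coord n, inner ℝ y z / inner ℝ w y - inner ℝ y y * inner ℝ w z / (2 * inner ℝ w y ^ 2)
      = inner ℝ y' z / inner ℝ w y' -
        inner ℝ y' y' * inner ℝ w z / (2 * (inner ℝ w y' : ℝ) ^ 2)) :
    y = (inner ℝ w y : ℝ) • (inner ℝ w y' : ℝ)⁻¹ • y' := by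
  -- the component along `w` determines `|y|² / σ(y)²`, and then the others determine `y / σ(y)`
  have h1 := H w
  rw [hw, real_inner_comm w y, real_inner_comm w y', div_self hy.ne', div_self hy'.ne',
    mul_one, mul_one] at h1
  have h2 : (inner ℝ y y : ℝ) / (2 * inner ℝ w y ^ 2) =
      inner ℝ y' y' / (2 * inner ℝ w y' ^ 2) := by linarith
  have h3 : (inner ℝ w y : ℝ)⁻¹ • y = (inner ℝ w y' : ℝ)⁻¹ • y' := by
    refine ext_inner_right ℝ fun z => ?_
    have h4 := H z
    rw [mul_div_right_comm, mul_div_right_comm (inner ℝ y' y' : ℝ), h2] at h4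
    rw [inner_smul_left, inner_smul_left]
    simp only [conj_trivial]
    rw [inv_mul_eq_div, inv_mul_eq_div]
    linarith
  rw [← h3, smul_inv_smul₀ hy.ne']

/-- In a flat chart the one-form is the inner product with a constant unit vector. -/
lemma IsFlatChart.exists_dual (he : IsFlatChart h W e)
    (hunit : ∀ p : M, h.inner p (W p) (W p) = 1) {x : Coord n} (hx : x ∈ e.target) :
    ∃ w : Coord n, inner ℝ w w = (1 : ℝ) ∧ ∀ x ∈ e.target, ∀ u,
      chartForm h W e x u = inner ℝ w u := by
  obtain ⟨l, hl⟩ := he.exists_form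
  obtain ⟨w, hw, hw1⟩ := exists_dual_chartForm h W he.isChart hx
  refine ⟨w, ?_, fun x' hx' u => ?_⟩
  · rw [← he.metric x hx, ← hw, hw1, hunit]
  · rw [hl x' hx', ← hl x hx, hw, he.metric x hx]

lemma IsFlatChart.momentum_eq (he : IsFlatChart h W e) {w : Coord n}
    (hw : ∀ x ∈ e.target, ∀ u, chartForm h W e x u = inner ℝ w u) {x : Coord n}
    (hx : x ∈ e.target) (y z : Coord n) :
    momentum (chartMetric h e) (chartForm h W e) x y z =
      inner ℝ y z / inner ℝ w y - inner ℝ y y * inner ℝ w z / (2 * inner ℝ w y ^ 2) := by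
  simp only [momentum, he.metric x hx, hw x hx]

lemma IsFlatChart.force_eq_zero (he : IsFlatChart h W e) {x : Coord n} (hx : x ∈ e.target)
    (y z : Coord n) : force (chartMetric h e) (chartForm h W e) x y z = 0 := by
  obtain ⟨l, hl⟩ := he.exists_form
  have h1 : chartMetric h e =ᶠ[nhds x] fun _ => chartMetric h e x := by
    filter_upwards [e.open_target.mem_nhds hx] with x' hx'
    ext u v
    rw [he.metric x' hx', he.metric x hx]
  have h2 : chartForm h W e =ᶠ[nhds x] fun _ => l := by
    filter_upwards [e.open_target.mem_nhds hx] with x' hx' using hl x' hx'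
  simp [force, h1.fderiv_eq, h2.fderiv_eq]

/-- In a flat chart the momentum of a geodesic is constant, hence so is its direction. -/
lemma IsFlatChart.geodesic_straight (he : IsFlatChart h W e)
    (hunit : ∀ p : M, h.inner p (W p) (W p) = 1)
    (hσ : ContDiffOn ℝ ∞ (chartForm h W e) e.target) {c : ℝ → Coord n} {a b : ℝ} (hab : a < b)
    (hc : IsGeodesic (kropinaDomain h W k) (kropinaMetric h W k) e c a b) :
    ∃ p v : Coord n, ∀ t ∈ Set.Icc a b, ∃ τ : ℝ, c t = p + τ • v := by
  obtain ⟨hc1, hc2⟩ := (isAdmissible_iff h W k).1 hc.admissible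
  obtain ⟨w, hw, hwσ⟩ := he.exists_dual hunit (hc2 a (Set.left_mem_Icc.2 hab.le)).1
  obtain ⟨t₀, ht₀⟩ : (Set.Ioo a b).Nonempty := Set.nonempty_Ioo.2 hab
  have hpos : ∀ t ∈ Set.Icc a b, (0 : ℝ) < inner ℝ w (deriv c t) := fun t ht => by
    rw [← hwσ _ (hc2 t ht).1]; exact (hc2 t ht).2
  have hI : Set.Ioo a b ⊆ Set.Icc a b := Set.Ioo_subset_Icc_self
  -- the direction `c' / σ(c')` is constant
  obtain ⟨u, hu⟩ : ∃ u : Coord n, ∀ t ∈ Set.Ioo a b,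
      deriv c t = (inner ℝ w (deriv c t) : ℝ) • u := by
    refine ⟨(inner ℝ w (deriv c t₀) : ℝ)⁻¹ • deriv c t₀, fun t ht => ?_⟩
    refine smul_eq_smul_of_momentum_eq hw (hpos t (hI ht)) (hpos t₀ (hI ht₀)) fun z => ?_
    rw [← he.momentum_eq hwσ (hc2 t (hI ht)).1, ← he.momentum_eq hwσ (hc2 t₀ (hI ht₀)).1]
    have hd : ∀ t ∈ Set.Ioo a b, HasDerivAt (fun t =>
        momentum (chartMetric h e) (chartForm h W e) (c t) (deriv c t) z) 0 t := fun t ht => by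
      have := hc.hasDerivAt_momentum h W k he.isChart hσ hab ht z
      rwa [he.force_eq_zero (hc2 t (hI ht)).1] at this
    exact isOpen_Ioo.is_const_of_deriv_eq_zero isPreconnected_Ioo
      (fun t ht => (hd t ht).differentiableAt.differentiableWithinAt)
      (fun t ht => (hd t ht).deriv) ht ht₀
  have hcl : Set.EqOn (deriv c) (fun t => (inner ℝ w (deriv c t) : ℝ) • u) (Set.Icc a b) := by
    have hc' : Continuous (deriv c) := hc1.continuous_deriv (by simp)
    have h1 : Set.EqOn (deriv c) (fun t => (inner ℝ w (deriv c t) : ℝ) • u) (Set.Ioo a b) := hu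
    have h2 := h1.closure hc' (by fun_prop)
    rwa [closure_Ioo hab.ne] at h2
  have hd (t : ℝ) : HasDerivAt (fun t => c t - (inner ℝ w (c t) : ℝ) • u)
      (deriv c t - (inner ℝ w (deriv c t) : ℝ) • u) t := by
    have h1 := (hc1.differentiable (by simp)).differentiableAt (x := t) |>.hasDerivAt
    have h2 := (hasDerivAt_const t w).inner ℝ h1
    simp only [inner_zero_left, add_zero] at h2
    exact h1.sub (h2.smul_const u)
  have hconst := constant_of_has_deriv_right_zero
    (f := fun t => c t - (inner ℝ w (c t) : ℝ) • u) (a := a) (b := b)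
    (fun t _ => (hd t).continuousAt.continuousWithinAt) (fun t ht => by
      exact (hd t).hasDerivWithinAt.congr_deriv
        (sub_eq_zero.2 (hcl (Set.Ico_subset_Icc_self ht))))
  refine ⟨c a - (inner ℝ w (c a) : ℝ) • u, u, fun t ht => ⟨inner ℝ w (c t), ?_⟩⟩
  rw [← hconst t ht, sub_add_cancel]

/-- In a flat chart the segments are extremals, since the momentum is constant along them. -/
lemma IsFlatChart.straight_geodesic (he : IsFlatChart h W e)
    (hunit : ∀ p : M, h.inner p (W p) (W p) = 1)
    (hσ : ContDiffOn ℝ ∞ (chartForm h W e) e.target) {p q : Coord n}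
    (hpq : segment ℝ p q ⊆ e.target)
    (hA : ∀ x ∈ segment ℝ p q, (⟨e.symm x, vec e x (q - p)⟩ : TangentBundle (𝓡 n) M) ∈
      kropinaDomain h W k) :
    ∃ (c : ℝ → Coord n) (a b : ℝ), a < b ∧
      IsGeodesic (kropinaDomain h W k) (kropinaMetric h W k) e c a b ∧ c a = p ∧ c b = q ∧
      c '' Set.Icc a b = segment ℝ p q := by
  obtain ⟨w, hw, hwσ⟩ := he.exists_dual hunit (hpq (left_mem_segment ℝ p q))
  have him := segment_eq_image' ℝ p q
  have hmem : ∀ t ∈ Set.Icc (0 : ℝ) 1, p + t • (q - p) ∈ segment ℝ p q := fun t ht => by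
    rw [him]; exact ⟨t, ht, rfl⟩
  have hd (t : ℝ) : deriv (fun t : ℝ => p + t • (q - p)) t = q - p := by
    have h1 : HasDerivAt (fun t : ℝ => p + t • (q - p)) ((1 : ℝ) • (q - p)) t :=
      ((hasDerivAt_id t).smul_const (q - p)).const_add p
    rw [h1.deriv, one_smul]
  have hsm : ContDiff ℝ ∞ fun t : ℝ => p + t • (q - p) := by fun_prop
  have hadm : IsAdmissible (kropinaDomain h W k) e (fun t : ℝ => p + t • (q - p)) 0 1 := by
    refine ⟨hsm, fun t ht => hpq (hmem t ht), fun t ht => ?_⟩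
    have := hA _ (hmem t ht)
    unfold velocity
    rwa [hd]
  obtain ⟨-, hadm2⟩ := (isAdmissible_iff h W k).1 hadm
  refine ⟨fun t => p + t • (q - p), 0, 1, one_pos, ⟨hadm, ?_, fun η hη h0 h1 => ?_⟩, by simp,
    by simp, him.symm⟩
  · refine ⟨inner ℝ (q - p) (q - p) / (2 * inner ℝ w (q - p)), fun t ht => ?_⟩
    rw [kropinaMetric_velocity, hd, lagrangian, he.metric _ (hpq (hmem t ht)),
      hwσ _ (hpq (hmem t ht))]
  · have key := hasDerivAt_curveLength h W k he.isChart hσ zero_le_one hadm hη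
    obtain ⟨B, hB⟩ : ∃ B : Coord n →L[ℝ] ℝ, ∀ z, B z = inner ℝ (q - p) z / inner ℝ w (q - p) -
        inner ℝ (q - p) (q - p) * inner ℝ w z / (2 * inner ℝ w (q - p) ^ 2) := by
      refine ⟨(inner ℝ w (q - p) : ℝ)⁻¹ • innerSL ℝ (q - p) - (inner ℝ (q - p) (q - p) /
        (2 * inner ℝ w (q - p) ^ 2) : ℝ) • innerSL ℝ w, fun z => ?_⟩
      simp only [_root_.sub_apply, _root_.smul_apply, innerSL_apply_apply, smul_eq_mul]
      ring
    have hint : ∫ t in (0 : ℝ)..1, fderiv ℝ (lagrangian (chartMetric h e) (chartForm h W e))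
        (p + t • (q - p), deriv (fun t : ℝ => p + t • (q - p)) t) (η t, deriv η t) = 0 := by
      have h2 : ∫ t in (0 : ℝ)..1, B (deriv η t) = 0 := by
        have hBd (t : ℝ) : HasDerivAt (fun t => B (η t)) (B (deriv η t)) t :=
          (B.hasFDerivAt (x := η t)).comp_hasDerivAt t
            ((hη.differentiable (by simp)).differentiableAt (x := t)).hasDerivAt
        rw [intervalIntegral.integral_eq_sub_of_hasDerivAt (fun t _ => hBd t)
          (B.continuous.comp (hη.continuous_deriv (by simp))).continuousOn.intervalIntegrable]
        simp [h0, h1]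
      refine Eq.trans ?_ h2
      refine intervalIntegral.integral_congr fun t ht => ?_
      rw [Set.uIcc_of_le zero_le_one] at ht
      rw [fderiv_lagrangian e.open_target (contDiffOn_chartMetric h he.isChart) hσ
        (fun x u v => chartMetric_symm h x u v) (hadm2 t ht), he.force_eq_zero (hadm2 t ht).1,
        he.momentum_eq hwσ (hadm2 t ht).1, hB, hd, zero_add]
    rwa [hint] at key

/-- In a flat chart the extremals of the Kropina metric are the straight lines. -/
lemma IsFlatChart.isRectilinearChart (he : IsFlatChart h W e) (hK : IsUKKropina h W k) :
    IsRectilinearChart (kropinaDomain h W k) (kropinaMetric h W k) e :=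
  have hσ := contDiffOn_chartForm h W hK.smooth_field he.isChart
  ⟨he.isChart, fun _ _ _ hab hc => he.geodesic_straight hK.unit hσ hab hc,
    fun _ _ hpq hA => he.straight_geodesic hK.unit hσ hpq hA⟩

end FlatExtremals

/-! ### The condition of Hamel -/

section Hamel

variable {E : Type*} [NormedAddCommGroup E] [NormedSpace ℝ E]
  {G : E → E →L[ℝ] E →L[ℝ] ℝ} {σ : E → E →L[ℝ] ℝ}

lemma momentum_smul {r : ℝ} (hr : r ≠ 0) (x y z : E) :
    momentum G σ x (r • y) z = momentum G σ x y z := by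
  simp only [momentum, map_smul, _root_.smul_apply, smul_eq_mul]
  rw [mul_div_mul_left _ _ hr]
  congr 1
  by_cases h : σ x y = 0
  · simp [h]
  · field_simp

lemma force_smul (r : ℝ) (x y z : E) :
    force G σ x (r • y) z = r * force G σ x y z := by
  simp only [force, map_smul, _root_.smul_apply, smul_eq_mul]
  by_cases hr : r = 0
  · simp [hr]
  by_cases h : σ x y = 0
  · simp [h]
  · field_simp

lemma hasDerivAt_line {F : Type*} [NormedAddCommGroup F] [NormedSpace ℝ F] {f : E → F} {x : E}
    (hf : DifferentiableAt ℝ f x) (v : E) :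
    HasDerivAt (fun r : ℝ => f (x + r • v)) (fderiv ℝ f x v) 0 := by
  have h0 : x + (0 : ℝ) • v = x := by rw [zero_smul, add_zero]
  have h1 := hasDerivAt_comp_line (A := f) (x := x) (y := v) (t := 0) (by rwa [h0])
  rwa [h0] at h1

lemma hasDerivAt_clm_apply_const {F : Type*} [NormedAddCommGroup F] [NormedSpace ℝ F]
    {f : ℝ → E →L[ℝ] F} {f' : E →L[ℝ] F} {t : ℝ} (hf : HasDerivAt f f' t) (a : E) :
    HasDerivAt (fun r => f r a) (f' a) t := by
  simpa using hf.clm_apply (hasDerivAt_const t a)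

lemma hasDerivAt_momentum_line {x v : E} (hG : DifferentiableAt ℝ G x)
    (hσ : DifferentiableAt ℝ σ x) (hv : σ x v ≠ 0) (z : E) :
    HasDerivAt (fun r : ℝ => momentum G σ (x + r • v) v z)
      (fderiv ℝ G x v v z / σ x v - G x v z * fderiv ℝ σ x v v / σ x v ^ 2 -
        fderiv ℝ G x v v v * σ x z / (2 * σ x v ^ 2) -
        G x v v * fderiv ℝ σ x v z / (2 * σ x v ^ 2) +
        G x v v * σ x z * fderiv ℝ σ x v v / σ x v ^ 3) 0 := by
  have h0 : x + (0 : ℝ) • v = x := by rw [zero_smul, add_zero]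
  have hGl (a b : E) : HasDerivAt (fun r : ℝ => G (x + r • v) a b) (fderiv ℝ G x v a b) 0 :=
    hasDerivAt_clm_apply_const (hasDerivAt_clm_apply_const (hasDerivAt_line hG v) a) b
  have hσl (a : E) : HasDerivAt (fun r : ℝ => σ (x + r • v) a) (fderiv ℝ σ x v a) 0 :=
    hasDerivAt_clm_apply_const (hasDerivAt_line hσ v) a
  have hv0 : σ (x + (0 : ℝ) • v) v ≠ 0 := by rwa [h0]
  have key := ((hGl v z).div (hσl v) hv0).sub (((hGl v v).mul (hσl z)).div
    (((hσl v).pow 2).const_mul 2) (mul_ne_zero two_ne_zero (pow_ne_zero 2 hv0)))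
  refine key.congr_deriv ?_
  simp only [Pi.mul_apply, Pi.pow_apply, h0]
  field_simp
  ring

variable {n : ℕ} {M : Type*} [TopologicalSpace M] [ChartedSpace (Coord n) M]
  [IsManifold (𝓡 n) ∞ M] {h : Metric n M} {W : (p : M) → TangentSpace (𝓡 n) p} {k : M → ℝ}
  {e : OpenPartialHomeomorph M (Coord n)}

/-- If the segments are extremals, the Euler-Lagrange equation holds along every line: the
condition of Hamel. The parametrization of the extremal does not matter, since the momentum and
the force are homogeneous in the velocity. -/
lemma hasDerivAt_momentum_of_isRectilinearChart
    (he : IsRectilinearChart (kropinaDomain h W k) (kropinaMetric h W k) e)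
    (hσ : ContDiffOn ℝ ∞ (chartForm h W e) e.target) {x v : Coord n} (hx : x ∈ e.target)
    (hv : 0 < chartForm h W e x v) (z : Coord n) :
    HasDerivAt (fun r : ℝ => momentum (chartMetric h e) (chartForm h W e) (x + r • v) v z)
      (force (chartMetric h e) (chartForm h W e) x v z) 0 := by
  have hU := isOpen_lagrangianDomain e.open_target hσ
  obtain ⟨ε, hε, hball⟩ : ∃ ε > 0, ∀ r : ℝ, |r| ≤ ε →
      (x + r • v, v) ∈ lagrangianDomain (chartForm h W e) e.target := by
    have hc : Continuous fun r : ℝ => (x + r • v, v) := by fun_prop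
    have h0 : (fun r : ℝ => (x + r • v, v)) 0 ∈ lagrangianDomain (chartForm h W e) e.target := by
      simpa [lagrangianDomain] using ⟨hx, hv⟩
    obtain ⟨ε, hε, H⟩ := Metric.mem_nhds_iff.1 (hc.continuousAt.preimage_mem_nhds (hU.mem_nhds h0))
    refine ⟨ε / 2, by positivity, fun r hr => H (a := r) ?_⟩
    rw [Metric.mem_ball, Real.dist_eq, sub_zero]
    linarith
  have hv0 : v ≠ 0 := by
    rintro rfl
    simp at hv
  have hvv : (inner ℝ v v : ℝ) ≠ 0 := inner_self_ne_zero.2 hv0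
  have hqp : x + ε • v - (x - ε • v) = (2 * ε) • v := by
    rw [mul_smul, two_smul]; abel
  have hseg : ∀ y ∈ segment ℝ (x - ε • v) (x + ε • v), ∃ r : ℝ, |r| ≤ ε ∧ y = x + r • v := by
    intro y hy
    rw [segment_eq_image'] at hy
    obtain ⟨θ, hθ, rfl⟩ := hy
    refine ⟨2 * ε * θ - ε, ?_, ?_⟩
    · rw [abs_le]; constructor <;> nlinarith [hθ.1, hθ.2]
    · rw [hqp]; module
  have hxseg : x ∈ segment ℝ (x - ε • v) (x + ε • v) := by
    rw [segment_eq_image']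
    refine ⟨1 / 2, by norm_num, ?_⟩
    simp only
    rw [hqp]; module
  -- an extremal that covers a short segment through `x` in the direction `v`
  obtain ⟨c, a, b, hab, hc, hca, hcb, him⟩ := he.straight_geodesic (x - ε • v) (x + ε • v)
    (fun y hy => by
      obtain ⟨r, hr, rfl⟩ := hseg y hy
      exact (hball r hr).1)
    (fun y hy => by
      obtain ⟨r, hr, rfl⟩ := hseg y hy
      rw [mem_kropinaDomain_iff, hqp, map_smul]
      exact mul_pos (by positivity) (hball r hr).2)
  obtain ⟨t₀, ht₀, hct₀⟩ : x ∈ c '' Set.Icc a b := him ▸ hxseg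
  have hεv : ε • v ≠ 0 := smul_ne_zero hε.ne' hv0
  have ht₀' : t₀ ∈ Set.Ioo a b := by
    refine ⟨lt_of_le_of_ne ht₀.1 ?_, lt_of_le_of_ne ht₀.2 ?_⟩
    · rintro rfl
      rw [hca] at hct₀
      exact hεv (sub_eq_self.1 hct₀)
    · rintro rfl
      rw [hcb] at hct₀
      exact hεv (add_eq_left.1 hct₀)
  obtain ⟨hc1, hc2⟩ := (isAdmissible_iff h W k).1 hc.admissible
  have hcd (t : ℝ) : HasDerivAt c (deriv c t) t :=
    ((hc1.differentiable (by simp)).differentiableAt (x := t)).hasDerivAt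
  -- the parameter of `c t` on the line through `x` with direction `v`
  obtain ⟨τ, hτ⟩ : ∃ τ : ℝ → ℝ, τ = fun t => (inner ℝ v v : ℝ)⁻¹ * inner ℝ v (c t - x) := ⟨_, rfl⟩
  have hcτ : ∀ t ∈ Set.Icc a b, |τ t| ≤ ε ∧ c t = x + τ t • v := by
    intro t ht
    obtain ⟨r, hr, hcr⟩ := hseg (c t) (him ▸ Set.mem_image_of_mem c ht)
    have h1 : τ t = r := by
      simp only [hτ]
      rw [hcr, add_sub_cancel_left, inner_smul_right, mul_comm r, inv_mul_cancel_left₀ hvv]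
    rw [h1]; exact ⟨hr, hcr⟩
  have hτd (t : ℝ) : HasDerivAt τ ((inner ℝ v v : ℝ)⁻¹ * inner ℝ v (deriv c t)) t := by
    rw [hτ]
    have h1 := (hasDerivAt_const t v).inner ℝ ((hcd t).sub_const x)
    simp only [inner_zero_left, add_zero] at h1
    exact h1.const_mul _
  have hc' : ∀ t ∈ Set.Ioo a b, deriv c t = deriv τ t • v := by
    intro t ht
    have h1 : c =ᶠ[nhds t] fun t => x + τ t • v := by
      filter_upwards [isOpen_Ioo.mem_nhds ht] with r hr
      exact (hcτ r (Set.Ioo_subset_Icc_self hr)).2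
    rw [h1.deriv_eq]
    exact (((hτd t).differentiableAt.hasDerivAt.smul_const v).const_add x).deriv
  have hτpos : ∀ t ∈ Set.Ioo a b, 0 < deriv τ t := by
    intro t ht
    have htI := Set.Ioo_subset_Icc_self ht
    have h1 := (hc2 t htI).2
    have h2 := (hball _ (hcτ t htI).1).2
    rw [← (hcτ t htI).2] at h2
    simp only [hc' t ht, map_smul, smul_eq_mul] at h1
    exact (pos_iff_pos_of_mul_pos h1).2 h2
  have hτ0 : τ t₀ = 0 := by simp [hτ, hct₀]
  have hEL := hc.hasDerivAt_momentum h W k he.isChart hσ hab ht₀' z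
  rw [hct₀, hc' t₀ ht₀', force_smul] at hEL
  have hm := hasDerivAt_momentum_line (differentiableAt_chartMetric h he.isChart hx)
    ((hσ.contDiffAt (e.open_target.mem_nhds hx)).differentiableAt (by simp)) hv.ne' z
  have hcomp := (hτ0 ▸ hm).comp t₀ (hτd t₀).differentiableAt.hasDerivAt
  have heq : (fun t => momentum (chartMetric h e) (chartForm h W e) (c t) (deriv c t) z)
      =ᶠ[nhds t₀] (fun r => momentum (chartMetric h e) (chartForm h W e) (x + r • v) v z) ∘ τ := by
    filter_upwards [isOpen_Ioo.mem_nhds ht₀'] with t ht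
    rw [hc' t ht, momentum_smul (hτpos t ht).ne', (hcτ t (Set.Ioo_subset_Icc_self ht)).2]
    rfl
  have huniq := (hEL.congr_of_eventuallyEq heq.symm).unique hcomp
  rw [mul_comm] at huniq
  rw [mul_right_cancel₀ (hτpos t₀ ht₀').ne' huniq]
  exact hm

end Hamel

/-! ### Projectively flat Kropina spaces -/

section ProjectivelyFlat

variable {n : ℕ} {M : Type*} [TopologicalSpace M] [ChartedSpace (Coord n) M]
  [IsManifold (𝓡 n) ∞ M] {h : Metric n M} {W : (p : M) → TangentSpace (𝓡 n) p} {k : M → ℝ}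
  {e : OpenPartialHomeomorph M (Coord n)}

variable (h W) in
/-- The covariant derivative of the one-form `h(W, ·)`; the direction of differentiation is the
first argument. -/
def covDerivForm (e : OpenPartialHomeomorph M (Coord n)) (x : Coord n) :
    Coord n →L[ℝ] Coord n →L[ℝ] ℝ :=
  fderiv ℝ (chartForm h W e) x -
    ((ContinuousLinearMap.compL ℝ (Coord n) (Coord n) ℝ) (chartForm h W e x)).comp
      (chartConnection h e x)

lemma covDerivForm_apply (x u v : Coord n) : covDerivForm h W e x u v =
    fderiv ℝ (chartForm h W e) x u v - chartForm h W e x (chartConnection h e x u v) := rfl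

/-- The covariant derivative of a unit form vanishes on the dual vector: `h(W, W) - σ(w) ^ 2`,
for a vector `w` with constant components, is non-negative and vanishes at `x`. -/
lemma covDerivForm_apply_dual (he : IsChart e)
    (hσ : ContDiffOn ℝ ∞ (chartForm h W e) e.target) (hunit : ∀ p : M, h.inner p (W p) (W p) = 1)
    {x : Coord n} (hx : x ∈ e.target) {w : Coord n}
    (hw : ∀ u, chartForm h W e x u = chartMetric h e x w u) (hww : chartMetric h e x w w = 1)
    (u : Coord n) : covDerivForm h W e x u w = 0 := by
  have hσd : DifferentiableAt ℝ (chartForm h W e) x :=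
    (hσ.contDiffAt (e.open_target.mem_nhds hx)).differentiableAt (by simp)
  have hGd := differentiableAt_chartMetric h he hx
  -- the Cauchy-Schwarz inequality with the unit vector dual to the form at `y`
  have hmin : IsLocalMin (fun y => chartMetric h e y w w - chartForm h W e y w ^ 2) x := by
    filter_upwards [e.open_target.mem_nhds hx] with y hy
    obtain ⟨a, ha, ha1⟩ := exists_dual_chartForm h W he hy
    have haa : chartMetric h e y a a = 1 := by rw [← ha, ha1, hunit]
    have h1 : 0 ≤ chartMetric h e y (w - chartForm h W e y w • a)
        (w - chartForm h W e y w • a) := by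
      rcases eq_or_ne (w - chartForm h W e y w • a) 0 with h0 | h0
      · rw [h0]; simp
      · exact (chartMetric_pos h he hy h0).le
    simp only [map_sub, map_smul, _root_.sub_apply, _root_.smul_apply, smul_eq_mul,
      chartMetric_symm h y w a, ← ha] at h1
    rw [hw w, hww]
    have h2 : chartForm h W e y a = 1 := by rw [ha, haa]
    rw [h2] at h1
    nlinarith
  have hG1 : HasFDerivAt (fun y => chartMetric h e y w w)
      (fderiv ℝ (fun y => chartMetric h e y w w) x) x :=
    ((hGd.clm_apply (differentiableAt_const w)).clm_apply (differentiableAt_const w)).hasFDerivAt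
  have hσ1 := hσd.hasFDerivAt.clm_apply (hasFDerivAt_const w x)
  have h0 := hmin.hasFDerivAt_eq_zero (hG1.sub (hσ1.pow 2))
  have h1 := congrArg (fun L : Coord n →L[ℝ] ℝ => L u) h0
  simp [fderiv_clm_apply_apply hGd, fderiv_chartMetric h he hx, hw, hww,
    chartMetric_symm h x _ w] at h1
  rw [covDerivForm_apply, hw]
  linarith

/-- The condition of Hamel at a point, cleared of denominators. -/
lemma hamel_cleared {s sz g gz a az c d dz d' : ℝ} (hs : s ≠ 0)
    (H : (c + c) / (2 * s) - g * d' / (2 * s ^ 2) = (az + c) / s - gz * d / s ^ 2 -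
      (a + a) * sz / (2 * s ^ 2) - g * dz / (2 * s ^ 2) + g * sz * d / s ^ 3) :
    s ^ 2 * az - s * (gz * d + a * sz + g * ((dz - d') / 2)) + g * sz * d = 0 := by
  have h1 : s ^ 2 * az - s * (gz * d + a * sz + g * ((dz - d') / 2)) + g * sz * d =
      s ^ 3 * (((az + c) / s - gz * d / s ^ 2 - (a + a) * sz / (2 * s ^ 2) -
        g * dz / (2 * s ^ 2) + g * sz * d / s ^ 3) -
        ((c + c) / (2 * s) - g * d' / (2 * s ^ 2))) := by
    field_simp
    ring
  rw [h1, H, sub_self, mul_zero]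

/-- In a rectilinear chart of a Kropina space with unit Killing field, the condition of Hamel
forces `W` to be parallel and the Levi-Civita connection to be projectively equivalent to the
standard one. -/
lemma covDerivForm_eq_zero_and_exists (hK : IsUKKropina h W k)
    (he : IsRectilinearChart (kropinaDomain h W k) (kropinaMetric h W k) e)
    {x : Coord n} (hx : x ∈ e.target) :
    (∀ u v, covDerivForm h W e x u v = 0) ∧
      ∃ P : Coord n →L[ℝ] ℝ, ∀ u v, chartConnection h e x u v = P u • v + P v • u := by
  have hσ := contDiffOn_chartForm h W hK.smooth_field he.isChart
  have hσd : DifferentiableAt ℝ (chartForm h W e) x :=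
    (hσ.contDiffAt (e.open_target.mem_nhds hx)).differentiableAt (by simp)
  obtain ⟨w, hw, hw1⟩ := exists_dual_chartForm h W he.isChart hx
  have hww : chartMetric h e x w w = 1 := by rw [← hw, hw1, hK.unit]
  have hskew : ∀ u v, covDerivForm h W e x u v = -covDerivForm h W e x v u := fun u v => by
    have h1 := hK.killing.fderiv_chartForm h he.isChart hx hσd u v
    rw [covDerivForm_apply, covDerivForm_apply, chartConnection_symm h he.isChart hx u v,
      chartConnection_symm h he.isChart hx v u]
    rw [chartConnection_symm h he.isChart hx u v, chartConnection_symm h he.isChart hx v u] at h1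
    linarith
  have hpos : ∀ u, u ≠ 0 → 0 < chartMetric h e x u u := fun u hu =>
    chartMetric_pos h he.isChart hx hu
  refine algebra_of_projectively_flat (fun u v => chartMetric_symm h x u v) hpos hww
    (fun u v => chartConnection_symm h he.isChart hx u v) hskew
    (covDerivForm_apply_dual he.isChart hσ hK.unit hx hw hww) fun y hy z => ?_
  have hy' : 0 < chartForm h W e x y := by rwa [hw]
  have key := (hasDerivAt_momentum_of_isRectilinearChart he hσ hx hy' z).unique
    (hasDerivAt_momentum_line (differentiableAt_chartMetric h he.isChart hx) hσd hy'.ne' z)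
  have hyy : covDerivForm h W e x y y = 0 := by linarith [hskew y y]
  have hyz := hskew y z
  rw [covDerivForm_apply] at hyy
  have hyz' := covDerivForm_apply (h := h) (W := W) (e := e) x y z
  rw [covDerivForm_apply x z y] at hyz
  rw [chartConnection_symm h he.isChart hx z y] at hyz
  simp only [force, fderiv_chartMetric h he.isChart hx] at key
  rw [chartConnection_symm h he.isChart hx z y, chartMetric_symm h x y (chartConnection h e x y y),
    chartMetric_symm h x y (chartConnection h e x y z)] at key
  rw [← hw, ← hw, ← hw]
  have h1 := hamel_cleared hy'.ne' key
  rw [hyz']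
  rw [sub_eq_zero] at hyy
  have h2 : (fderiv ℝ (chartForm h W e) x y z - fderiv ℝ (chartForm h W e) x z y) / 2 =
      fderiv ℝ (chartForm h W e) x y z - chartForm h W e x (chartConnection h e x y z) := by
    linarith
  rw [hyy, h2] at h1
  linarith

/-- The one-form `P` with `Γ(u, v) = P(u) v + P(v) u` is smooth, being the trace of the connection
divided by `n + 1`. -/
lemma exists_smooth_projective_form {s : Set (Coord n)}
    {Γ : Coord n → Coord n →L[ℝ] Coord n →L[ℝ] Coord n} (hΓ : ContDiffOn ℝ ∞ Γ s)
    (H : ∀ x ∈ s, ∃ P : Coord n →L[ℝ] ℝ, ∀ u v, Γ x u v = P u • v + P v • u) :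
    ∃ P : Coord n → Coord n →L[ℝ] ℝ, ContDiffOn ℝ ∞ P s ∧
      ∀ x ∈ s, ∀ u v, Γ x u v = P x u • v + P x v • u := by
  refine ⟨fun x => (n + 1 : ℝ)⁻¹ • ∑ i, (EuclideanSpace.proj i : Coord n →L[ℝ] ℝ).comp (Γ x (basisVec i)), ?_,
    fun x hx u v => ?_⟩
  · have h1 (i : Fin n) : ContDiffOn ℝ ∞
        (fun x => (EuclideanSpace.proj i : Coord n →L[ℝ] ℝ).comp (Γ x (basisVec i))) s :=
      contDiffOn_const.clm_comp (hΓ.clm_apply contDiffOn_const)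
    exact (ContDiffOn.sum fun i _ => h1 i).const_smul _
  · obtain ⟨P, hP⟩ := H x hx
    have h1 : ∀ u, ((n + 1 : ℝ)⁻¹ • ∑ i, (EuclideanSpace.proj i : Coord n →L[ℝ] ℝ).comp (Γ x (basisVec i)) :
        Coord n →L[ℝ] ℝ) u = P u := by
      intro u
      have h2 : P u = ∑ i, u i * P (basisVec i) := by
        conv_lhs => rw [← sum_smul_basisVec u]
        simp
      have h3 : ∀ i, Γ x (basisVec i) u i = P (basisVec i) * u i + P u := by
        intro i
        rw [hP]
        simp [basisVec]
      have hproj : ∀ (i : Fin n) (a : Coord n), (EuclideanSpace.proj i : Coord n →L[ℝ] ℝ) a = a i :=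
        fun _ _ => rfl
      have hn : (n + 1 : ℝ) ≠ 0 := by positivity
      simp only [_root_.smul_apply, _root_.sum_apply, ContinuousLinearMap.comp_apply,
        hproj, h3, Finset.sum_add_distrib, smul_eq_mul]
      rw [inv_mul_eq_iff_eq_mul₀ hn, Finset.sum_const, Finset.card_univ, Fintype.card_fin, h2]
      simp only [mul_comm (P _)]
      ring
    rw [hP, h1, h1]

/-- A nonzero vector orthogonal to a given one, in dimension at least two. -/
lemma exists_ne_zero_apply_eq_zero (hn : 2 ≤ n) (l : Coord n →L[ℝ] ℝ) :
    ∃ X : Coord n, X ≠ 0 ∧ l X = 0 := by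
  by_contra! H
  have hinj : Function.Injective (l : Coord n →ₗ[ℝ] ℝ) := by
    refine (injective_iff_map_eq_zero _).2 fun X hX => ?_
    by_contra h0
    exact H X h0 hX
  have := LinearMap.finrank_le_finrank_of_injective hinj
  simp at this
  omega

/-- A rectilinear chart of a Kropina space with unit Killing field is flat. The curvature tensor
of the projectively flat connection annihilates `W`, and is skew-symmetric with respect to `h`;
both together force it to vanish. -/
lemma curvature_eq_zero_of_isRectilinearChart (hn : 2 ≤ n) (hK : IsUKKropina h W k)
    (he : IsRectilinearChart (kropinaDomain h W k) (kropinaMetric h W k) e)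
    {x : Coord n} (hx : x ∈ e.target) (u v z : Coord n) :
    curvature (chartConnection h e) x u v z = 0 := by
  have hσ := contDiffOn_chartForm h W hK.smooth_field he.isChart
  have hs := e.open_target
  have hΓ := contDiffOn_chartConnection h he.isChart
  have hpar : ∀ x ∈ e.target, ∀ u v, fderiv ℝ (chartForm h W e) x u v =
      chartForm h W e x (chartConnection h e x u v) := fun x hx u v => by
    rw [← sub_eq_zero, ← covDerivForm_apply]
    exact (covDerivForm_eq_zero_and_exists hK he hx).1 u v
  obtain ⟨P, hP, hΓP⟩ := exists_smooth_projective_form hΓ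
    fun x hx => (covDerivForm_eq_zero_and_exists hK he hx).2
  obtain ⟨w, hw, hw1⟩ := exists_dual_chartForm h W he.isChart hx
  have hww : chartMetric h e x w w = 1 := by rw [← hw, hw1, hK.unit]
  obtain ⟨X, hX0, hX⟩ := exists_ne_zero_apply_eq_zero hn (chartMetric h e x w)
  have hpos : ∀ u, u ≠ 0 → 0 < chartMetric h e x u u := fun u hu =>
    chartMetric_pos h he.isChart hx hu
  have hPd : DifferentiableAt ℝ P x :=
    (hP.contDiffAt (hs.mem_nhds hx)).differentiableAt (by simp)
  obtain ⟨Q, hQ⟩ : ∃ Q : Coord n →L[ℝ] Coord n →L[ℝ] ℝ,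
      ∀ u v, Q u v = fderiv ℝ P x u v - P x u * P x v :=
    ⟨fderiv ℝ P x - (P x).smulRight (P x), fun u v => by simp⟩
  have hR : ∀ u v z, curvature (chartConnection h e) x u v z =
      (Q u v - Q v u) • z + Q u z • v - Q v z • u := fun u v z => by
    rw [curvature_of_projective hs hΓ hx hPd hΓP]
    simp only [hQ]
  have hQ0 : ∀ u v, Q u v = 0 := by
    refine eq_zero_of_skew_of_annihilates (fun u v => chartMetric_symm h x u v) hww hX
      (hpos X hX0) hpos (fun u v z => ?_) fun u v z => ?_
    · have h1 := apply_curvature_of_parallel hs hσ hΓ hpar hx u v z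
      rw [hR] at h1
      simpa [hw] using h1
    · have h1 := curvature_skew hs (contDiffOn_chartMetric h he.isChart) hΓ
        (fun x hx u v w => fderiv_chartMetric h he.isChart hx u v w) hx u v z z
      rw [hR, chartMetric_symm h x z] at h1
      simp only [map_sub, map_add, map_smul, _root_.sub_apply, _root_.add_apply,
        _root_.smul_apply, smul_eq_mul] at h1
      linarith
  simp [hR, hQ0]

/-- A Kropina space with unit Killing field is projectively flat if and only if it is covered by
flat charts. -/
lemma isProjectivelyFlat_iff (hn : 2 ≤ n) (hK : IsUKKropina h W k) :
    IsProjectivelyFlat (kropinaDomain h W k) (kropinaMetric h W k) ↔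
      ∀ p : M, ∃ e : OpenPartialHomeomorph M (Coord n), p ∈ e.source ∧ IsFlatChart h W e := by
  constructor <;> intro H p <;> obtain ⟨e, hp, he⟩ := H p
  · refine exists_isFlatChart he.isChart (contDiffOn_chartForm h W hK.smooth_field he.isChart)
      (fun x hx => curvature_eq_zero_of_isRectilinearChart hn hK he hx) (fun x hx u v => ?_) hp
    rw [chartConnection_symm h he.isChart hx, ← sub_eq_zero, ← covDerivForm_apply]
    exact (covDerivForm_eq_zero_and_exists hK he hx).1 v u
  · exact ⟨e, hp, he.isRectilinearChart hK⟩

/-- A Kropina space with unit Killing field is projectively flat if and only if `h` is flat and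
`W` is parallel. -/
theorem isProjectivelyFlat_iff_isFlat_and_isParallel (hn : 2 ≤ n) (hK : IsUKKropina h W k) :
    IsProjectivelyFlat (kropinaDomain h W k) (kropinaMetric h W k) ↔
      IsFlat h ∧ IsParallel h W := by
  rw [isProjectivelyFlat_iff hn hK]
  refine ⟨isFlat_and_isParallel_of_isFlatChart hK.smooth_field, fun H p => ?_⟩
  have he : IsChart (chartAt (Coord n) p) := IsManifold.chart_mem_maximalAtlas p
  have hσ := contDiffOn_chartForm h W hK.smooth_field he
  refine exists_isFlatChart he hσ
    (fun x hx => (curvature_eq_zero_iff h he hx).1 (H.1 _ he x hx))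
    (fun x hx => (covDeriv_eq_zero_iff h ?_).1 (H.2 _ he x hx)) (mem_chart_source _ p)
  exact (hσ.contDiffAt ((chartAt (Coord n) p).open_target.mem_nhds hx)).differentiableAt (by simp)

/-- A Riemannian manifold of constant sectional curvature with a parallel unit field is flat: the
planes that contain the field have curvature zero. -/
lemma isFlat_of_isParallel (hn : 2 ≤ n) {K : ℝ} (hK : IsCCKropina h W k K)
    (hpar : IsParallel h W) : IsFlat h := by
  intro e he x hx
  have hσ := contDiffOn_chartForm h W hK.smooth_field he
  have hσd : ∀ y ∈ e.target, DifferentiableAt ℝ (chartForm h W e) y := fun y hy =>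
    (hσ.contDiffAt (e.open_target.mem_nhds hy)).differentiableAt (by simp)
  have hs := e.open_target
  have hΓ := contDiffOn_chartConnection h he
  have hpos : ∀ u, u ≠ 0 → 0 < chartMetric h e x u u := fun u hu => chartMetric_pos h he hx hu
  have hskew := curvature_skew hs (contDiffOn_chartMetric h he) hΓ
    (fun x hx u v w => fderiv_chartMetric h he hx u v w) hx
  obtain ⟨w, hw, hw1⟩ := exists_dual_chartForm h W he hx
  have hww : chartMetric h e x w w = 1 := by rw [← hw, hw1, hK.unit]
  obtain ⟨X, hX0, hX⟩ := exists_ne_zero_apply_eq_zero hn (chartMetric h e x w)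
  have hσR (u v z) : chartForm h W e x (curvature (chartConnection h e) x u v z) = 0 :=
    apply_curvature_of_parallel hs hσ hΓ (fun y hy u v => by
      rw [(covDeriv_eq_zero_iff h (hσd y hy)).1 (hpar e he y hy), chartConnection_symm h he hy])
      hx u v z
  have hsec : ∀ X Y : Coord n, LinearIndependent ℝ ![X, Y] →
      chartMetric h e x (curvature (chartConnection h e) x X Y Y) X /
        (chartMetric h e x X X * chartMetric h e x Y Y - chartMetric h e x X Y ^ 2) = K := by
    intro X Y hXY
    have := hK.constant_curvature e he x hx X Y hXY
    rwa [sectionalCurvature, sum_riemann_eq h he hx] at this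
  -- the plane spanned by `X ⊥ w` and `w` has curvature zero
  have hK0 : K = 0 := by
    have hind : LinearIndependent ℝ ![X, w] := by
      rw [LinearIndependent.pair_iff]
      intro s t hst
      have h1 := congrArg (chartMetric h e x w) hst
      simp only [map_add, map_smul, hX, hww, smul_eq_mul, mul_zero, mul_one, zero_add,
        map_zero] at h1
      refine ⟨?_, h1⟩
      rw [h1, zero_smul, add_zero] at hst
      exact (smul_eq_zero.1 hst).resolve_right hX0
    rw [← hsec X w hind]
    have h1 := hskew X w w X
    rw [← hw, hσR, add_zero] at h1
    rw [h1, zero_div]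
  rw [curvature_eq_zero_iff h he hx]
  refine eq_zero_of_sectional_eq_zero hpos (isTrilinear_curvature _ x)
    (fun u v z => curvature_swap _ x u v z) (fun u v a b => ?_)
    (fun u v z => curvature_bianchi hs hΓ (fun y hy => chartConnection_symm h he hy) hx u v z)
    fun u v => ?_
  · rw [chartMetric_symm h x (curvature _ x u v b)]
    exact hskew u v a b
  · by_cases hind : LinearIndependent ℝ ![u, v]
    · have h1 := hsec u v hind
      rw [hK0, div_eq_zero_iff] at h1
      refine h1.resolve_right (ne_of_gt ?_)
      -- `g(v, v)` times the Gram determinant is the squared norm of `g(v, v) u - g(u, v) v`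
      have hv : v ≠ 0 := hind.ne_zero 1
      have hvv := hpos v hv
      have hne : chartMetric h e x v v • u - chartMetric h e x u v • v ≠ 0 := by
        intro h0
        rw [LinearIndependent.pair_iff] at hind
        exact hvv.ne' (hind _ (-chartMetric h e x u v)
          (by rw [neg_smul, ← sub_eq_add_neg, h0])).1
      have h2 := hpos _ hne
      simp only [map_sub, map_smul, _root_.sub_apply, _root_.smul_apply, smul_eq_mul,
        chartMetric_symm h x v u] at h2
      refine (pos_iff_pos_of_mul_pos ?_).1 hvv
      linarith
    · rw [LinearIndependent.pair_iff] at hind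
      push Not at hind
      obtain ⟨s, t, hst, hne⟩ := hind
      rcases eq_or_ne s 0 with rfl | hs0
      · rw [zero_smul, zero_add] at hst
        have hv : v = 0 := (smul_eq_zero.1 hst).resolve_left (hne rfl)
        simp [curvature, hv]
      · have hu : u = (-(s⁻¹ * t)) • v := by
          rw [neg_smul, mul_smul, ← smul_neg, ← eq_neg_of_add_eq_zero_left hst, inv_smul_smul₀ hs0]
        have h1 := hskew u v v v
        rw [chartMetric_symm h x v] at h1
        have h2 : chartMetric h e x (curvature (chartConnection h e) x u v v) v = 0 := by linarith
        generalize curvature (chartConnection h e) x u v v = r at h2 ⊢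
        rw [hu, map_smul, h2, smul_zero]

end ProjectivelyFlat

/-! ### Unit Killing fields of Euclidean space -/

section Euclidean

variable {n : ℕ}

lemma isChart_refl : IsChart (OpenPartialHomeomorph.refl (Coord n)) :=
  IsManifold.chart_mem_maximalAtlas (I := 𝓡 n) (0 : Coord n)

lemma chartMetric_euclideanMetric (x u v : Coord n) :
    chartMetric (euclideanMetric n) (OpenPartialHomeomorph.refl (Coord n)) x u v =
      inner ℝ u v := by
  have h1 : mfderiv (𝓡 n) (𝓡 n) (OpenPartialHomeomorph.refl (Coord n)).symm x =
      ContinuousLinearMap.id ℝ (Coord n) := by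
    rw [mfderiv_eq_fderiv]
    exact fderiv_id
  rw [chartMetric_apply]
  unfold vec
  rw [h1]
  rfl

/-- A field of covectors on `ℝⁿ` that satisfies the Killing equation and is bounded is constant:
`σ y (y - x) = σ x (y - x)` for all `x` and `y`, so that `σ y x - σ 0 x` is linear in `y`, and a
bounded linear function on `ℝⁿ` vanishes. -/
lemma eq_of_killing_of_bounded {σ : Coord n → Coord n →L[ℝ] ℝ} (hσ : Differentiable ℝ σ)
    (hK : ∀ x v, fderiv ℝ σ x v v = 0) (hb : ∀ x u, |σ x u| ≤ ‖u‖) (x : Coord n) :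
    σ x = σ 0 := by
  have hline : ∀ x y, σ y (y - x) = σ x (y - x) := by
    intro x y
    have hd (t : ℝ) : HasDerivAt (fun t : ℝ => σ (x + t • (y - x)) (y - x)) 0 t := by
      have h1 : HasDerivAt (fun r : ℝ => σ (x + t • (y - x) + r • (y - x)) (y - x)) 0 (t - t) := by
        rw [sub_self]
        have := hasDerivAt_clm_apply_const
          (hasDerivAt_line (hσ (x + t • (y - x))) (y - x)) (y - x)
        rwa [hK] at this
      have h2 : HasDerivAt (fun r : ℝ => r - t) 1 t := (hasDerivAt_id t).sub_const t
      have h3 := HasDerivAt.comp (h := fun r : ℝ => r - t) t h1 h2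
      rw [zero_mul] at h3
      refine h3.congr_of_eventuallyEq (Filter.Eventually.of_forall fun r => ?_)
      simp only [Function.comp]
      rw [add_assoc, ← add_smul, add_sub_cancel]
    have h1 := is_const_of_deriv_eq_zero (fun t => (hd t).differentiableAt)
      (fun t => (hd t).deriv) 1 0
    simpa using h1
  have hskew : ∀ x y, σ y x - σ 0 x = -(σ x y - σ 0 y) := by
    intro x y
    have h1 := hline x y
    have h2 := hline 0 x
    have h3 := hline 0 y
    simp only [map_sub, sub_zero] at h1 h2 h3
    linarith
  ext z
  by_contra hne
  have hne' : σ x z - σ 0 z ≠ 0 := sub_ne_zero.2 hne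
  -- `t (σ x z - σ 0 z)` is bounded in `t`, which is absurd
  have hbd : ∀ t : ℝ, |t * (σ x z - σ 0 z)| ≤ 2 * ‖x‖ := by
    intro t
    have h1 := hskew x (t • z)
    rw [map_smul, map_smul, smul_eq_mul, smul_eq_mul, ← mul_sub] at h1
    have h2 : t * (σ x z - σ 0 z) = σ 0 x - σ (t • z) x := by linarith
    rw [h2]
    refine (abs_sub _ _).trans ?_
    linarith [hb 0 x, hb (t • z) x]
  have h1 := hbd ((2 * ‖x‖ + 1) / (σ x z - σ 0 z))
  rw [div_mul_cancel₀ _ hne', abs_of_pos (by positivity)] at h1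
  linarith

/-- A unit Killing field of Euclidean space has constant components. -/
lemma isFlatChart_refl {W : (p : Coord n) → TangentSpace (𝓡 n) p} {k : Coord n → ℝ}
    (hK : IsUKKropina (euclideanMetric n) W k) :
    IsFlatChart (euclideanMetric n) W (OpenPartialHomeomorph.refl (Coord n)) := by
  have he := isChart_refl (n := n)
  have hσ := contDiffOn_chartForm (euclideanMetric n) W hK.smooth_field he
  have hmem (x : Coord n) : x ∈ (OpenPartialHomeomorph.refl (Coord n)).target := Set.mem_univ x
  have hσd : Differentiable ℝ
      (chartForm (euclideanMetric n) W (OpenPartialHomeomorph.refl (Coord n))) := fun x =>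
    (hσ.contDiffAt (Filter.univ_mem)).differentiableAt (by simp)
  refine ⟨he, fun x _ => chartMetric_euclideanMetric x, _, fun x _ =>
    eq_of_killing_of_bounded hσd (fun x v => ?_) (fun x u => ?_) x⟩
  · have hΓ : chartConnection (euclideanMetric n) (OpenPartialHomeomorph.refl (Coord n)) x v v =
        0 := by
      refine eq_of_chartMetric_eq (euclideanMetric n) he (hmem x) fun w => ?_
      have hG : chartMetric (euclideanMetric n) (OpenPartialHomeomorph.refl (Coord n)) =
          fun _ => innerSL ℝ := by
        ext x u v
        exact chartMetric_euclideanMetric x u v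
      rw [koszul _ he (hmem x), hG]
      simp
    have h1 := hK.killing.fderiv_chartForm (euclideanMetric n) he (hmem x) (hσd x) v v
    rw [hΓ, map_zero, sub_zero] at h1
    linarith
  · obtain ⟨w, hw, hw1⟩ := exists_dual_chartForm (euclideanMetric n) W he (hmem x)
    rw [hK.unit, hw, chartMetric_euclideanMetric, real_inner_self_eq_norm_sq] at hw1
    have hw2 : ‖w‖ = 1 := by
      nlinarith [norm_nonneg w]
    rw [hw, chartMetric_euclideanMetric]
    exact (abs_real_inner_le_norm w u).trans_eq (by rw [hw2, one_mul])

end Euclidean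

end Kropina

end

theorem mainTheorem7 (n : ℕ) (hn : 2 ≤ n) :
    (∀ (M : Type*) [TopologicalSpace M] [ChartedSpace (Kropina.Coord n) M]
        [IsManifold (𝓡 n) ∞ M] (h : Kropina.Metric n M)
        (W : (p : M) → TangentSpace (𝓡 n) p) (k : M → ℝ),
        Kropina.IsUKKropina h W k →
          (Kropina.IsProjectivelyFlat (Kropina.kropinaDomain h W k) (Kropina.kropinaMetric h W k) ↔
            Kropina.IsFlat h ∧ Kropina.IsParallel h W)) ∧
    (∀ (M : Type*) [TopologicalSpace M] [ChartedSpace (Kropina.Coord n) M]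
        [IsManifold (𝓡 n) ∞ M] (h : Kropina.Metric n M)
        (W : (p : M) → TangentSpace (𝓡 n) p) (k : M → ℝ) (K : ℝ), 0 ≤ K →
        Kropina.IsCCKropina h W k K →
          (Kropina.IsProjectivelyFlat (Kropina.kropinaDomain h W k) (Kropina.kropinaMetric h W k) ↔
            Kropina.IsParallel h W)) ∧
    (∀ (W : (p : Kropina.Coord n) → TangentSpace (𝓡 n) p) (k : Kropina.Coord n → ℝ),
        Kropina.IsCCKropina (Kropina.euclideanMetric n) W k 0 →
          Kropina.IsProjectivelyFlat (Kropina.kropinaDomain (Kropina.euclideanMetric n) W k)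
            (Kropina.kropinaMetric (Kropina.euclideanMetric n) W k)) := by
  refine ⟨fun M _ _ _ h W k hK => Kropina.isProjectivelyFlat_iff_isFlat_and_isParallel hn hK,
    fun M _ _ _ h W k K _ hK => ?_, fun W k hK p => ?_⟩
  · rw [Kropina.isProjectivelyFlat_iff_isFlat_and_isParallel hn hK.toIsUKKropina]
    exact ⟨And.right, fun hpar => ⟨Kropina.isFlat_of_isParallel hn hK hpar, hpar⟩⟩
  · exact ⟨OpenPartialHomeomorph.refl _, Set.mem_univ p,
      (Kropina.isFlatChart_refl hK.toIsUKKropina).isRectilinearChart hK.toIsUKKropina⟩
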